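/- Let $M$ be a smooth connected paracompact Hausdorff manifold of dimension $n$, let $F\colon TM\to[0,\infty)$ be a Finsler metric on $M$ (continuous on $TM$, smooth off the zero section, positive on nonzero vectors, positively homogeneous of degree one on fibres, with $g_v=\tfrac12\partial^2_v F^2(v)$ positive definite for every $v\neq 0$), and let $\Lambda\colon M\to(0,\infty)$ be smooth. Let $(\tilde M,L)$ be the associated standard static Finsler spacetime, $\tilde M=\mathbb R\times M$, $L(\tau,v)=-\Lambda\tau^2+F^2(v)$. Let $\mathcal T\subset T\tilde M$ be the line bundle spanned by $\partial_t=(1,0)$, and for $w\in T\tilde M\setminus\mathcal T$ let $\tilde g_w$ be the vertical Hessian of $\tfrac12 L$ at $w$. All curves are defined on compact intervals of positive length and are continuous and piecewise smooth. A curve $\gamma$ on $[a,b]$ in a manifold $N$ is a *geodesic* of a function $\mathcal L\colon TN\to\mathbb R$ if it is a critical point of the energy $\frac12\int_a^b \mathcal L(\dot\gamma)\,ds$, that is, if $\frac{d}{dr}\big|_{r=0}$ of the energy vanishes along every continuous, piecewise smooth variation with fixed end points. A $C^1$ curve $\gamma$ on $[c,d]$ is a *pregeodesic* of $\mathcal L$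 if $\gamma\circ\varphi$ is a geodesic for some $C^1$ bijection $\varphi\colon[a',b']\to[c,d]$ with $\dot\varphi>0$. Geodesics and pregeodesics of $(\tilde M,L)$ are those of $L$; geodesics and pregeodesics of a Finsler metric $\tilde F$ on $M$ are those of $\tilde F^2$. A vector $w\in T\tilde M\setminus\mathcal T$ is *lightlike* if $\tilde g_w(w,w)=0$, and a lightlike vector $w$ is *future-pointing* if $\tilde g_w(w,\partial_t)<0$; a curve in $\tilde M$ is future-pointing lightlike if all its one-sided velocities are. Then a curve $\gamma=(\theta,\sigma)\colon[a,b]\to\tilde M$ is a future-pointing lightlike geodesic of $(\tilde M,L)$ if and only if the following three conditions hold: 1. $\sigma$ is a non-constant pregeodesic of the Finsler metric $F/\sqrt\Lambda$ on $M$; 2. $\sqrt{\Lambda(\sigma)}\,F(\dot\sigma)$ is constant on $[a,b]$; 3. $\displaystyle \theta(s)=\theta(a)+\int_a^s\frac{F(\dot\sigma)}{\sqrt{\Lambda(\sigma)}}\,d\mu$ for all $s\in[a,b]$. -/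

import Mathlib

open Set MeasureTheory
open scoped Manifold ContDiff

noncomputable section

section Curves

variable {E : Type*} [NormedAddCommGroup E] [NormedSpace ℝ E]
  {H : Type*} [TopologicalSpace H] (I : ModelWithCorners ℝ E H)
  {N : Type*} [TopologicalSpace N] [ChartedSpace H N]

/-- `a = s 0 < s 1 < ⋯ < s k = b`. -/
def IsSubdivision (a b : ℝ) (k : ℕ) (s : ℕ → ℝ) : Prop :=
  s 0 = a ∧ s k = b ∧ ∀ j < k, s j < s (j + 1)

/-- `γ`, restricted to `[a, b]`, is a continuous piecewise smooth curve in `N`.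
(Curves are total functions on `ℝ`; only their values on `[a, b]` matter.) -/
def IsPiecewiseSmooth (a b : ℝ) (γ : ℝ → N) : Prop :=
  ContinuousOn γ (Icc a b) ∧
    ∃ (k : ℕ) (s : ℕ → ℝ), IsSubdivision a b k s ∧
      ∀ j < k, ContMDiffOn 𝓘(ℝ, ℝ) I ∞ γ (Icc (s j) (s (j + 1)))

/-- The velocity at the instant `s` of the curve `γ` restricted to the interval `S`, as a point of
the tangent bundle. With `S = [s, b]` and `S = [a, s]` it is the right and the left velocity. -/
def velocity (γ : ℝ → N) (S : Set ℝ) (s : ℝ) : TangentBundle I N :=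
  ⟨γ s, mfderivWithin 𝓘(ℝ, ℝ) I γ S s (1 : ℝ)⟩

/-- The energy `½ ∫ₐᵇ L(γ'(s)) ds`. -/
def energy (L : TangentBundle I N → ℝ) (a b : ℝ) (γ : ℝ → N) : ℝ :=
  (1 / 2) * ∫ s in a..b, L (velocity I γ (Icc a b) s)

/-- `ψ : (-ε, ε) × [a, b] → N` is a proper (fixed end points) variation of `γ`. -/
structure IsProperVariation (a b : ℝ) (γ : ℝ → N) (ε : ℝ) (ψ : ℝ → ℝ → N) : Prop where
  pos : 0 < ε
  continuousOn : ContinuousOn (Function.uncurry ψ) (Ioo (-ε) ε ×ˢ Icc a b)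
  piecewise_smooth : ∃ (k : ℕ) (s : ℕ → ℝ), IsSubdivision a b k s ∧
    ∀ j < k, ContMDiffOn 𝓘(ℝ, ℝ × ℝ) I ∞ (Function.uncurry ψ)
      (Ioo (-ε) ε ×ˢ Icc (s j) (s (j + 1)))
  base : ∀ s ∈ Icc a b, ψ 0 s = γ s
  left : ∀ r ∈ Ioo (-ε) ε, ψ r a = γ a
  right : ∀ r ∈ Ioo (-ε) ε, ψ r b = γ b

/-- A (affinely parametrized) geodesic of `L` : a continuous piecewise smooth curve which is a
critical point of the energy functional of `L`. -/
def IsGeodesic (L : TangentBundle I N → ℝ) (a b : ℝ) (γ : ℝ → N) : Prop :=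
  IsPiecewiseSmooth I a b γ ∧
    ∀ (ε : ℝ) (ψ : ℝ → ℝ → N), IsProperVariation I a b γ ε ψ →
      HasDerivAt (fun r => energy I L a b (ψ r)) 0 0

/-- A pregeodesic of `L` on `[c, d]` : a `C¹` curve which becomes a geodesic after a
`C¹`, regular, orientation preserving reparametrization `φ : [a, b] → [c, d]`. -/
def IsPregeodesic (L : TangentBundle I N → ℝ) (c d : ℝ) (γ : ℝ → N) : Prop :=
  ContMDiffOn 𝓘(ℝ, ℝ) I 1 γ (Icc c d) ∧
    ∃ (a b : ℝ) (φ : ℝ → ℝ), a < b ∧ ContDiffOn ℝ 1 φ (Icc a b) ∧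
      (∀ s ∈ Icc a b, 0 < derivWithin φ (Icc a b) s) ∧ φ a = c ∧ φ b = d ∧
      IsGeodesic I L a b (γ ∘ φ)

/-- The fundamental tensor (one half of the vertical Hessian) of `L` at `w ∈ T_x N`,
`g_w(u, v) = ½ ∂²/∂r∂s L(w + r u + s v)` at `r = s = 0`. -/
def fundTensor (L : TangentBundle I N → ℝ) (x : N) (w u v : TangentSpace I x) : ℝ :=
  (1 / 2) * deriv (fun r : ℝ => deriv (fun s : ℝ => L ⟨x, w + r • u + s • v⟩) 0) 0

end Curves

section Finsler

variable {n : ℕ} {M : Type*} [TopologicalSpace M] [ChartedSpace (EuclideanSpace ℝ (Fin n)) M]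

/-- `F` is a Finsler metric on `M` : continuous on `TM`, smooth off the zero section, positive and
positively homogeneous of degree one, with positive definite fundamental tensor of `F²`. -/
structure IsFinslerMetric [IsManifold (𝓡 n) ∞ M] (F : TangentBundle (𝓡 n) M → ℝ) : Prop where
  continuous : Continuous F
  smooth : ContMDiffOn (𝓡 n).tangent 𝓘(ℝ, ℝ) ∞ F {p | p.2 ≠ 0}
  homogeneous : ∀ (x : M) (v : TangentSpace (𝓡 n) x) (c : ℝ), 0 < c →
    F ⟨x, c • v⟩ = c * F ⟨x, v⟩
  pos : ∀ (x : M) (v : TangentSpace (𝓡 n) x), v ≠ 0 → 0 < F ⟨x, v⟩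
  posDef : ∀ (x : M) (v u : TangentSpace (𝓡 n) x), v ≠ 0 → u ≠ 0 →
    0 < fundTensor (𝓡 n) (fun p => F p ^ 2) x v u u

/-- The optical Finsler metric `F / √Λ`. -/
def opticalMetric (F : TangentBundle (𝓡 n) M → ℝ) (Λ : M → ℝ) : TangentBundle (𝓡 n) M → ℝ :=
  fun p => F p / √(Λ p.1)

/-- The model with corners of the product manifold `ℝ × M`. -/
abbrev spacetimeModel (n : ℕ) :
    ModelWithCorners ℝ (ℝ × EuclideanSpace ℝ (Fin n))
      (ModelProd ℝ (EuclideanSpace ℝ (Fin n))) :=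
  𝓘(ℝ, ℝ).prod (𝓡 n)

/-- The quadratic Finsler function `L(τ, v) = -Λ τ² + F(v)²` of the standard static Finsler
spacetime `ℝ × M`. -/
def staticL (F : TangentBundle (𝓡 n) M → ℝ) (Λ : M → ℝ) :
    TangentBundle (spacetimeModel n) (ℝ × M) → ℝ :=
  fun p =>
    -Λ p.1.2 * (show ℝ × EuclideanSpace ℝ (Fin n) from p.2).1 ^ 2
      + F ⟨p.1.2, (show ℝ × EuclideanSpace ℝ (Fin n) from p.2).2⟩ ^ 2

/-- The vector `∂_t = (1, 0)` at a point of `ℝ × M`. -/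
def timeVector (q : ℝ × M) : TangentSpace (spacetimeModel n) q :=
  (show ℝ × EuclideanSpace ℝ (Fin n) from (1, 0))

/-- The line bundle spanned by `∂_t`. -/
def timeLine : Set (TangentBundle (spacetimeModel n) (ℝ × M)) :=
  {w | ∃ c : ℝ, w.2 = c • timeVector w.1}

/-- `w ∉ 𝒯` and `g_w(w, w) = 0`, where `g` is the vertical Hessian of `L / 2`. -/
def IsLightlike (F : TangentBundle (𝓡 n) M → ℝ) (Λ : M → ℝ)
    (w : TangentBundle (spacetimeModel n) (ℝ × M)) : Prop :=
  w ∉ timeLine ∧ fundTensor (spacetimeModel n) (staticL F Λ) w.1 w.2 w.2 w.2 = 0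

/-- `w` is a future-pointing causal vector: a positive multiple of `∂_t`, or a vector `w ∉ 𝒯` with
`g_w(w, w) ≤ 0` and `g_w(w, ∂_t) < 0`. -/
def IsFuturePointing (F : TangentBundle (𝓡 n) M → ℝ) (Λ : M → ℝ)
    (w : TangentBundle (spacetimeModel n) (ℝ × M)) : Prop :=
  (∃ c : ℝ, 0 < c ∧ w.2 = c • timeVector w.1) ∨
    (w ∉ timeLine ∧ fundTensor (spacetimeModel n) (staticL F Λ) w.1 w.2 w.2 w.2 ≤ 0 ∧
      fundTensor (spacetimeModel n) (staticL F Λ) w.1 w.2 w.2 (timeVector w.1) < 0)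

/-- All right velocities (on `[a, b)`) and all left velocities (on `(a, b]`) of `γ` are lightlike
and future-pointing. -/
def IsFutureLightlikeCurve (F : TangentBundle (𝓡 n) M → ℝ) (Λ : M → ℝ) (a b : ℝ)
    (γ : ℝ → ℝ × M) : Prop :=
  (∀ s ∈ Ico a b, IsLightlike F Λ (velocity (spacetimeModel n) γ (Icc s b) s) ∧
      IsFuturePointing F Λ (velocity (spacetimeModel n) γ (Icc s b) s)) ∧
    ∀ s ∈ Ioc a b, IsLightlike F Λ (velocity (spacetimeModel n) γ (Icc a s) s) ∧
      IsFuturePointing F Λ (velocity (spacetimeModel n) γ (Icc a s) s)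

end Finsler

end

/-! Write `B = F(v)/√Λ` for the optical speed, so that `L(τ, v) = Λ(B² - τ²)`. A velocity is
future-pointing lightlike exactly when `θ' = B > 0`, and invariance under time translation gives the
conservation law `Λθ' = k`. Together these yield conditions 2 and 3; what remains is to compare
critical points of the spacetime energy with those of the optical energy.

The comparison is a first variation computed without Euler–Lagrange equations. For a variation with
time speed `A`, optical speed `B` and weight `λ = Λ` along the varied curve, subtract from the
density `λ(B² - A²)` the density `λ₀B²`, whose weight is frozen along the base curve, and add the
null Lagrangian `2kA`, whose integral depends only on the end points. At `r = 0` the derivative of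
`-λA² + (λ - λ₀)B² + 2kA` is `λ'(B² - A²) - 2A'(λA - k)`, which vanishes because `A = B` and `λA =
k` on the base curve. So the energy and `½∫ Λ(σ)B²` have the same first variation
(`hasDerivAt_energy_sub`). If `φ' = κ Λ(σ ∘ φ)`, a change of variables turns this weighted energy
into `1/κ` times the optical energy of `σ ∘ φ` (`IsFinslerMetric.energy_comp`). Hence a lightlike
curve with conserved momentum is a geodesic exactly when `σ ∘ φ` is an optical geodesic
(`isGeodesic_comp_of_isGeodesic`, `isGeodesic_of_isGeodesic_comp`).

In the direct implication the conservation law comes from varying `θ` alone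
(`exists_conserved_momentum`), and `φ` is found by quadrature with `κ = 1`
(`exists_reparametrization`). A pregeodesic has to be `C¹`, so corners must be excluded: a corner
would violate the Weierstrass–Erdmann condition, since the fibre derivative of the squared metric is
strictly monotone (`IsFinslerMetric.contMDiffOn_of_isGeodesic`).

In the converse, `φ` is given. Optical geodesics have constant speed, by variations that only
reparametrize (`IsFinslerMetric.constant_speed`); combined with condition 2 this forces `φ' = κ Λ(σ
∘ φ)`. That `σ` is not constant serves to exclude `k = 0`. -/

/-! ### Piecewise properties of intervals -/

/-- The interval `[a, b]` is a finite (possibly empty) concatenation of intervals satisfying `Q`. -/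
inductive Piecewise (Q : ℝ → ℝ → Prop) : ℝ → ℝ → Prop
  | refl (a : ℝ) : Piecewise Q a a
  | piece {a b : ℝ} : a < b → Q a b → Piecewise Q a b
  | trans {a b c : ℝ} : Piecewise Q a b → Piecewise Q b c → Piecewise Q a c

/-- `Q` passes to nondegenerate subintervals. -/
def Hereditary (Q : ℝ → ℝ → Prop) : Prop :=
  ∀ ⦃a b c d : ℝ⦄, a ≤ c → c < d → d ≤ b → Q a b → Q c d

namespace Piecewise

variable {Q Q' : ℝ → ℝ → Prop} {a b c d : ℝ}

theorem le (h : Piecewise Q a b) : a ≤ b := by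
  induction h with
  | refl => exact le_rfl
  | piece h _ => exact h.le
  | trans _ _ h₁ h₂ => exact h₁.trans h₂

theorem of_subdivision {k : ℕ} {s : ℕ → ℝ} (hs : IsSubdivision a b k s)
    (h : ∀ j < k, Q (s j) (s (j + 1))) : Piecewise Q a b := by
  obtain ⟨rfl, rfl, hlt⟩ := hs
  have : ∀ m ≤ k, Piecewise Q (s 0) (s m) := by
    intro m
    induction m with
    | zero => exact fun _ => refl _
    | succ m ih => exact fun hm => (ih (by omega)).trans (piece (hlt m (by omega)) (h m (by omega)))
  exact this k le_rfl

theorem exists_subdivision (h : Piecewise Q a b) :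
    ∃ (k : ℕ) (s : ℕ → ℝ), IsSubdivision a b k s ∧ ∀ j < k, Q (s j) (s (j + 1)) := by
  induction h with
  | refl a => exact ⟨0, fun _ => a, ⟨rfl, rfl, by simp⟩, by simp⟩
  | @piece a b h hQ =>
    refine ⟨1, fun j => if j = 0 then a else b, ⟨by simp, by simp, ?_⟩, ?_⟩
    · intro j hj
      obtain rfl : j = 0 := by omega
      simpa using h
    · intro j hj
      obtain rfl : j = 0 := by omega
      simpa using hQ
  | trans _ _ h₁ h₂ =>
    obtain ⟨k, s, ⟨hs0, hsk, hs⟩, hQs⟩ := h₁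
    obtain ⟨l, t, ⟨ht0, htl, ht⟩, hQt⟩ := h₂
    -- Stated for an arbitrary relation so that the same index bookkeeping yields both the strict
    -- inequalities and `Q`.
    have key : ∀ R : ℝ → ℝ → Prop, (∀ j < k, R (s j) (s (j + 1))) →
        (∀ j < l, R (t j) (t (j + 1))) → ∀ j < k + l,
        R (if j ≤ k then s j else t (j - k)) (if j + 1 ≤ k then s (j + 1) else t (j + 1 - k)) := by
      intro R h1 h2 j hj
      rcases lt_trichotomy j k with hjk | rfl | hjk
      · simpa [hjk.le, Nat.succ_le_of_lt hjk] using h1 j hjk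
      · simpa [hsk, ← ht0] using h2 0 (by omega)
      · have := h2 (j - k) (by omega)
        rw [if_neg (by omega), if_neg (by omega)]
        rwa [show j - k + 1 = j + 1 - k by omega] at this
    refine ⟨k + l, fun j => if j ≤ k then s j else t (j - k), ⟨by simpa using hs0, ?_, ?_⟩, ?_⟩
    · rcases Nat.eq_zero_or_pos l with rfl | hl
      · simp only [add_zero, le_refl, if_true]
        rw [hsk, ← ht0, htl]
      · simp only [show ¬ k + l ≤ k by omega, if_false, Nat.add_sub_cancel_left]
        exact htl
    · exact key (· < ·) hs ht
    · exact key Q hQs hQt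

theorem mono (h : Piecewise Q a b)
    (H : ∀ c d, a ≤ c → c < d → d ≤ b → Q c d → Q' c d) : Piecewise Q' a b := by
  induction h with
  | refl => exact refl _
  | piece h hQ => exact piece h (H _ _ le_rfl h le_rfl hQ)
  | trans h₁ h₂ i₁ i₂ =>
    exact (i₁ fun c d hc hcd hd => H c d hc hcd (hd.trans h₂.le)).trans
      (i₂ fun c d hc hcd hd => H c d (h₁.le.trans hc) hcd hd)

theorem restrict (hQ : Hereditary Q) (h : Piecewise Q a b) (hc : a ≤ c) (hcd : c ≤ d)
    (hd : d ≤ b) : Piecewise Q c d := by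
  induction h generalizing c d with
  | refl a =>
    obtain rfl : c = a := le_antisymm (hcd.trans hd) hc
    obtain rfl : d = c := le_antisymm hd hcd
    exact refl _
  | piece h hq =>
    rcases hcd.eq_or_lt with rfl | hcd
    · exact refl _
    · exact piece hcd (hQ hc hcd hd hq)
  | @trans a m b h₁ h₂ i₁ i₂ =>
    rcases le_total d m with hdm | hdm
    · exact i₁ hc hcd hdm
    · rcases le_total m c with hmc | hmc
      · exact i₂ hmc hcd hd
      · exact (i₁ hc hmc le_rfl).trans (i₂ le_rfl hdm hd)

/-- The induction passes to a common refinement of the two decompositions; heredity lets both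
properties survive it. -/
theorem and (hQ : Hereditary Q) (hQ' : Hereditary Q') (h : Piecewise Q a b)
    (h' : Piecewise Q' a b) : Piecewise (fun c d => Q c d ∧ Q' c d) a b := by
  induction h with
  | refl => exact refl _
  | piece h hq => exact h'.mono fun c d hc hcd hd hq' => ⟨hQ hc hcd hd hq, hq'⟩
  | trans h₁ h₂ i₁ i₂ =>
    exact (i₁ (h'.restrict hQ' le_rfl h₁.le h₂.le)).trans
      (i₂ (h'.restrict hQ' h₁.le h₂.le le_rfl))

theorem map (h : Piecewise Q a b) (S : ℝ → ℝ) (hS : StrictMonoOn S (Icc a b))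
    (H : ∀ c d, a ≤ c → c < d → d ≤ b → Q c d → Q' (S c) (S d)) :
    Piecewise Q' (S a) (S b) := by
  induction h with
  | refl => exact refl _
  | piece h hQ =>
    exact piece (hS (left_mem_Icc.2 h.le) (right_mem_Icc.2 h.le) h) (H _ _ le_rfl h le_rfl hQ)
  | trans h₁ h₂ i₁ i₂ =>
    exact (i₁ (hS.mono (Icc_subset_Icc_right h₂.le))
        fun c d hc hcd hd => H c d hc hcd (hd.trans h₂.le)).trans
      (i₂ (hS.mono (Icc_subset_Icc_left h₁.le))
        fun c d hc hcd hd => H c d (h₁.le.trans hc) hcd hd)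

/-- Induction over nondegenerate intervals only: empty pieces produced by `refl` are discarded, so
`P` need not hold on a single point. -/
theorem induction_of_lt {P : ℝ → ℝ → Prop} (h : Piecewise Q a b) (hab : a < b)
    (piece : ∀ c d, a ≤ c → c < d → d ≤ b → Q c d → P c d)
    (trans : ∀ c m d, a ≤ c → c < m → m < d → d ≤ b → P c m → P m d → P c d) : P a b := by
  induction h with
  | refl => exact absurd hab (lt_irrefl _)
  | piece h hQ => exact piece _ _ le_rfl h le_rfl hQ
  | @trans a m b h₁ h₂ i₁ i₂ =>
    rcases h₁.le.eq_or_lt with rfl | ham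
    · exact i₂ hab piece trans
    · rcases h₂.le.eq_or_lt with rfl | hmb
      · exact i₁ hab piece trans
      · exact trans _ m _ le_rfl ham hmb le_rfl
          (i₁ ham (fun c d hc hcd hd => piece c d hc hcd (hd.trans hmb.le))
            fun c x d hc h h' hd => trans c x d hc h h' (hd.trans hmb.le))
          (i₂ hmb (fun c d hc hcd hd => piece c d (ham.le.trans hc) hcd hd)
            fun c x d hc h h' hd => trans c x d (ham.le.trans hc) h h' hd)

theorem exists_right (hQ : Hereditary Q) (h : Piecewise Q a b) {s : ℝ} (hs : s ∈ Ico a b) :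
    ∃ d ∈ Ioc s b, Q s d := by
  induction h with
  | refl => exact absurd hs (by simp)
  | piece h hq => exact ⟨_, ⟨hs.2, le_rfl⟩, hQ hs.1 hs.2 le_rfl hq⟩
  | @trans a m b h₁ h₂ i₁ i₂ =>
    rcases lt_or_ge s m with hsm | hsm
    · obtain ⟨d, hd, h⟩ := i₁ ⟨hs.1, hsm⟩
      exact ⟨d, ⟨hd.1, hd.2.trans h₂.le⟩, h⟩
    · exact i₂ ⟨hsm, hs.2⟩

theorem exists_left (hQ : Hereditary Q) (h : Piecewise Q a b) {s : ℝ} (hs : s ∈ Ioc a b) :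
    ∃ c ∈ Ico a s, Q c s := by
  induction h with
  | refl => exact absurd hs (by simp)
  | piece h hq => exact ⟨_, ⟨le_rfl, hs.1⟩, hQ le_rfl hs.1 hs.2 hq⟩
  | @trans a m b h₁ h₂ i₁ i₂ =>
    rcases le_or_gt s m with hsm | hsm
    · exact i₁ ⟨hs.1, hsm⟩
    · obtain ⟨c, hc, h⟩ := i₂ ⟨hsm, hs.2⟩
      exact ⟨c, ⟨h₁.le.trans hc.1, hc.2⟩, h⟩

/-- Feeds almost-everywhere arguments: off a finite, hence null, set each point is interior to a
piece. -/
theorem exists_finite (h : Piecewise Q a b) :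
    ∃ D : Set ℝ, D.Finite ∧ ∀ s ∈ Icc a b \ D, ∃ c d, a ≤ c ∧ d ≤ b ∧ s ∈ Ioo c d ∧ Q c d := by
  induction h with
  | refl a => exact ⟨{a}, finite_singleton a, by simp⟩
  | @piece a b h hq =>
    refine ⟨{a, b}, by simp, fun s hs => ⟨a, b, le_rfl, le_rfl, ?_, hq⟩⟩
    simp only [mem_sdiff, mem_insert_iff, mem_singleton_iff, not_or] at hs
    exact ⟨lt_of_le_of_ne hs.1.1 (Ne.symm hs.2.1), lt_of_le_of_ne hs.1.2 hs.2.2⟩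
  | @trans a m b h₁ h₂ i₁ i₂ =>
    obtain ⟨D, hD, h⟩ := i₁
    obtain ⟨D', hD', h'⟩ := i₂
    refine ⟨D ∪ D', hD.union hD', fun s hs => ?_⟩
    rcases le_total s m with hsm | hsm
    · obtain ⟨c, d, hc, hd, H⟩ := h s ⟨⟨hs.1.1, hsm⟩, fun hx => hs.2 (Or.inl hx)⟩
      exact ⟨c, d, hc, hd.trans h₂.le, H⟩
    · obtain ⟨c, d, hc, hd, H⟩ := h' s ⟨⟨hsm, hs.1.2⟩, fun hx => hs.2 (Or.inr hx)⟩
      exact ⟨c, d, h₁.le.trans hc, hd, H⟩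

end Piecewise

/-! ### Velocities, piecewise smooth curves and variations -/

section Velocity

variable {E : Type*} [NormedAddCommGroup E] [NormedSpace ℝ E]
  {H : Type*} [TopologicalSpace H] {I : ModelWithCorners ℝ E H}
  {N : Type*} [TopologicalSpace N] [ChartedSpace H N]
  {V : Type*} [NormedAddCommGroup V] [NormedSpace ℝ V]

theorem contMDiffOn_tangentMapWithin_const [IsManifold I 1 N] {f : V → N} {s : Set V}
    {m n : WithTop ℕ∞} (hf : ContMDiffOn 𝓘(ℝ, V) I n f s) (hmn : m + 1 ≤ n)
    (hs : UniqueDiffOn ℝ s) (e : V) :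
    ContMDiffOn 𝓘(ℝ, V) I.tangent m
      (fun x => tangentMapWithin 𝓘(ℝ, V) I f s (⟨x, e⟩ : TangentBundle 𝓘(ℝ, V) V)) s := by
  have h1 := hf.contMDiffOn_tangentMapWithin hmn hs.uniqueMDiffOn
  have h2 : ContMDiffOn 𝓘(ℝ, V) 𝓘(ℝ, V).tangent m
      (fun x => (⟨x, e⟩ : TangentBundle 𝓘(ℝ, V) V)) s :=
    (contMDiffOn_vectorSpace_iff_contDiffOn (V := fun _ => e)).2 contDiffOn_const
  exact h1.comp h2 fun x hx => hx

theorem velocity_congr {γ γ' : ℝ → N} {S : Set ℝ} (h : EqOn γ γ' S) {s : ℝ} (hs : s ∈ S) :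
    velocity I γ S s = velocity I γ' S s :=
  tangentMapWithin_congr h (⟨s, (1 : ℝ)⟩ : TangentBundle 𝓘(ℝ, ℝ) ℝ) hs

theorem velocity_congr_set (γ : ℝ → N) {S T : Set ℝ} {s : ℝ} (h : S =ᶠ[nhds s] T) :
    velocity I γ S s = velocity I γ T s := by
  unfold velocity
  rw [mfderivWithin_congr_set h]

/-- Derivatives are local, so integrands over `[a, b]` can be computed piece by piece; only the
break points, a null set, are lost. -/
theorem velocity_Icc_of_mem_Ioo (γ : ℝ → N) {a b c d s : ℝ} (hc : a ≤ c) (hd : d ≤ b)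
    (hs : s ∈ Ioo c d) : velocity I γ (Icc a b) s = velocity I γ (Icc c d) s := by
  apply velocity_congr_set
  have h1 : Icc a b ∈ nhds s := Icc_mem_nhds (hc.trans_lt hs.1) (hs.2.trans_le hd)
  have h2 : Icc c d ∈ nhds s := Icc_mem_nhds hs.1 hs.2
  filter_upwards [h1, h2] with x hx hx'
  exact propext ⟨fun _ => hx', fun _ => hx⟩

theorem velocity_mono {γ : ℝ → N} {S T : Set ℝ} {s : ℝ} (hST : S ⊆ T)
    (hS : UniqueDiffWithinAt ℝ S s) (h : MDifferentiableWithinAt 𝓘(ℝ, ℝ) I γ T s) :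
    velocity I γ S s = velocity I γ T s := by
  unfold velocity
  rw [mfderivWithin_subset hST hS.uniqueMDiffWithinAt h]

theorem velocity_comp {γ : ℝ → N} {φ : ℝ → ℝ} {S T : Set ℝ} {u φ' : ℝ}
    (hφ : HasDerivWithinAt φ φ' S u) (hST : MapsTo φ S T) (hS : UniqueDiffWithinAt ℝ S u)
    (hγ : MDifferentiableWithinAt 𝓘(ℝ, ℝ) I γ T (φ u)) :
    velocity I (γ ∘ φ) S u =
      ⟨γ (φ u), φ' • mfderivWithin 𝓘(ℝ, ℝ) I γ T (φ u) (1 : ℝ)⟩ := by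
  have h : HasMFDerivWithinAt 𝓘(ℝ, ℝ) 𝓘(ℝ, ℝ) φ S u (ContinuousLinearMap.toSpanSingleton ℝ φ') :=
    hφ.hasFDerivWithinAt.hasMFDerivWithinAt
  unfold velocity
  rw [(hγ.hasMFDerivWithinAt.comp u h hST).mfderivWithin hS.uniqueMDiffWithinAt]
  congr 1
  change mfderivWithin 𝓘(ℝ, ℝ) I γ T (φ u) ((1 : ℝ) • φ') = _
  let A : ℝ →L[ℝ] E := mfderivWithin 𝓘(ℝ, ℝ) I γ T (φ u)
  have hA : A ((1 : ℝ) • φ') = φ' • A 1 := by rw [one_smul, ← A.map_smul, smul_eq_mul, mul_one]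
  exact hA

theorem velocity_comp_vector {g : V → N} {x : ℝ → V} {S : Set ℝ} {T : Set V} {s : ℝ} {x' : V}
    (hx : HasDerivWithinAt x x' S s) (hST : MapsTo x S T) (hS : UniqueDiffWithinAt ℝ S s)
    (hg : MDifferentiableWithinAt 𝓘(ℝ, V) I g T (x s)) :
    velocity I (g ∘ x) S s =
      tangentMapWithin 𝓘(ℝ, V) I g T (⟨x s, x'⟩ : TangentBundle 𝓘(ℝ, V) V) := by
  have h : HasMFDerivWithinAt 𝓘(ℝ, ℝ) 𝓘(ℝ, V) x S s (ContinuousLinearMap.toSpanSingleton ℝ x') :=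
    hx.hasFDerivWithinAt.hasMFDerivWithinAt
  unfold velocity tangentMapWithin
  rw [(hg.hasMFDerivWithinAt.comp s h hST).mfderivWithin hS.uniqueMDiffWithinAt]
  congr 1
  change mfderivWithin 𝓘(ℝ, V) I g T (x s) ((1 : ℝ) • x') = _
  rw [one_smul]

/-- Expressing the slice velocity through the tangent map of the two-parameter map is what gives
smoothness jointly in `(r, s)`. -/
theorem velocity_uncurry {ψ : ℝ → ℝ → N} {U S : Set ℝ} {r s : ℝ} (hr : r ∈ U)
    (hS : UniqueDiffWithinAt ℝ S s)
    (hψ : MDifferentiableWithinAt 𝓘(ℝ, ℝ × ℝ) I (Function.uncurry ψ) (U ×ˢ S) (r, s)) :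
    velocity I (ψ r) S s = tangentMapWithin 𝓘(ℝ, ℝ × ℝ) I (Function.uncurry ψ) (U ×ˢ S)
      (⟨(r, s), (0, 1)⟩ : TangentBundle 𝓘(ℝ, ℝ × ℝ) (ℝ × ℝ)) :=
  velocity_comp_vector (g := Function.uncurry ψ) (x := fun s => (r, s))
    ((hasDerivWithinAt_const s S r).prodMk (hasDerivWithinAt_id s S))
    (fun _ ht => ⟨hr, ht⟩) hS hψ

theorem contMDiffOn_velocity_uncurry [IsManifold I 1 N] {ψ : ℝ → ℝ → N} {ε c d : ℝ} (hcd : c < d)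
    (hψ : ContMDiffOn 𝓘(ℝ, ℝ × ℝ) I ∞ (Function.uncurry ψ) (Ioo (-ε) ε ×ˢ Icc c d)) :
    ContMDiffOn 𝓘(ℝ, ℝ × ℝ) I.tangent ∞
      (fun p : ℝ × ℝ => velocity I (ψ p.1) (Icc c d) p.2) (Ioo (-ε) ε ×ˢ Icc c d) := by
  refine (contMDiffOn_tangentMapWithin_const hψ (m := ∞) le_rfl
    ((uniqueDiffOn_Ioo _ _).prod (uniqueDiffOn_Icc hcd)) (0, 1)).congr fun p hp => ?_
  exact velocity_uncurry hp.1 (uniqueDiffOn_Icc hcd _ hp.2)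
    ((hψ p hp).mdifferentiableWithinAt (by simp))

theorem contMDiffOn_velocity [IsManifold I 1 N] {γ : ℝ → N} {c d : ℝ} (hcd : c < d)
    {m n : WithTop ℕ∞} (hmn : m + 1 ≤ n)
    (hγ : ContMDiffOn 𝓘(ℝ, ℝ) I n γ (Icc c d)) :
    ContMDiffOn 𝓘(ℝ, ℝ) I.tangent m (fun s => velocity I γ (Icc c d) s) (Icc c d) :=
  contMDiffOn_tangentMapWithin_const hγ hmn (uniqueDiffOn_Icc hcd) (1 : ℝ)

theorem ContMDiffOn.slice {ψ : ℝ → ℝ → N} {U S : Set ℝ} {n : WithTop ℕ∞}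
    (hψ : ContMDiffOn 𝓘(ℝ, ℝ × ℝ) I n (Function.uncurry ψ) (U ×ˢ S)) {r : ℝ} (hr : r ∈ U) :
    ContMDiffOn 𝓘(ℝ, ℝ) I n (ψ r) S :=
  hψ.comp (contDiff_prodMk_right r).contMDiff.contMDiffOn fun _ hs => ⟨hr, hs⟩

theorem hereditary_contMDiffOn {n : WithTop ℕ∞} (γ : ℝ → N) :
    Hereditary fun c d => ContMDiffOn 𝓘(ℝ, ℝ) I n γ (Icc c d) :=
  fun _ _ _ _ hc _ hd h => h.mono (Icc_subset_Icc hc hd)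

theorem hereditary_contMDiffOn_prod {n : WithTop ℕ∞} (ψ : ℝ × ℝ → N) (U : Set ℝ) :
    Hereditary fun c d => ContMDiffOn 𝓘(ℝ, ℝ × ℝ) I n ψ (U ×ˢ Icc c d) :=
  fun _ _ _ _ hc _ hd h => h.mono (prod_mono le_rfl (Icc_subset_Icc hc hd))

theorem IsPiecewiseSmooth.piecewise {a b : ℝ} {γ : ℝ → N} (h : IsPiecewiseSmooth I a b γ) :
    Piecewise (fun c d => ContMDiffOn 𝓘(ℝ, ℝ) I ∞ γ (Icc c d)) a b := by
  obtain ⟨-, k, s, hs, h⟩ := h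
  exact Piecewise.of_subdivision hs h

theorem isPiecewiseSmooth_of_piecewise {a b : ℝ} {γ : ℝ → N} (hab : a < b)
    (h : Piecewise (fun c d => ContMDiffOn 𝓘(ℝ, ℝ) I ∞ γ (Icc c d)) a b) :
    IsPiecewiseSmooth I a b γ := by
  refine ⟨?_, h.exists_subdivision⟩
  refine h.induction_of_lt (P := fun c d => ContinuousOn γ (Icc c d)) hab
    (fun c d _ _ _ h => h.continuousOn) fun c m d _ hcm hmd _ h h' => ?_
  rw [← Icc_union_Icc_eq_Icc hcm.le hmd.le]
  exact h.union_of_isClosed h' isClosed_Icc isClosed_Icc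

theorem IsProperVariation.piecewise {a b ε : ℝ} {γ : ℝ → N} {ψ : ℝ → ℝ → N}
    (h : IsProperVariation I a b γ ε ψ) :
    Piecewise (fun c d => ContMDiffOn 𝓘(ℝ, ℝ × ℝ) I ∞ (Function.uncurry ψ)
      (Ioo (-ε) ε ×ˢ Icc c d)) a b := by
  obtain ⟨k, s, hs, h⟩ := h.piecewise_smooth
  exact Piecewise.of_subdivision hs h

theorem isProperVariation_of_piecewise {a b ε : ℝ} {γ : ℝ → N} {ψ : ℝ → ℝ → N} (hab : a < b)
    (hε : 0 < ε)
    (h : Piecewise (fun c d => ContMDiffOn 𝓘(ℝ, ℝ × ℝ) I ∞ (Function.uncurry ψ)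
      (Ioo (-ε) ε ×ˢ Icc c d)) a b)
    (base : ∀ s ∈ Icc a b, ψ 0 s = γ s) (left : ∀ r ∈ Ioo (-ε) ε, ψ r a = γ a)
    (right : ∀ r ∈ Ioo (-ε) ε, ψ r b = γ b) : IsProperVariation I a b γ ε ψ := by
  refine ⟨hε, ?_, h.exists_subdivision, base, left, right⟩
  refine h.induction_of_lt
    (P := fun c d => ContinuousOn (Function.uncurry ψ) (Ioo (-ε) ε ×ˢ Icc c d)) hab
    (fun c d _ _ _ h => h.continuousOn) fun c m d _ hcm hmd _ h h' => ?_
  intro p hp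
  rw [← Icc_union_Icc_eq_Icc hcm.le hmd.le, prod_union]
  -- A point off a closed strip is not in its closure, and continuity within the strip is vacuous
  -- there.
  have key : ∀ c d, ContinuousOn (Function.uncurry ψ) (Ioo (-ε) ε ×ˢ Icc c d) →
      ContinuousWithinAt (Function.uncurry ψ) (Ioo (-ε) ε ×ˢ Icc c d) p := by
    intro c d hcont
    by_cases hpS : p.2 ∈ Icc c d
    · exact hcont p ⟨hp.1, hpS⟩
    · refine continuousWithinAt_of_notMem_closure fun hcl => hpS ?_
      have : closure (Ioo (-ε) ε ×ˢ Icc c d) ⊆ univ ×ˢ Icc c d :=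
        closure_minimal (prod_mono (subset_univ _) le_rfl) (isClosed_univ.prod isClosed_Icc)
      exact (this hcl).2
  exact (key c m h).union (key m d h')

theorem IsProperVariation.piecewise_slice {a b ε : ℝ} {γ : ℝ → N} {ψ : ℝ → ℝ → N}
    (h : IsProperVariation I a b γ ε ψ) {r : ℝ} (hr : r ∈ Ioo (-ε) ε) :
    Piecewise (fun c d => ContMDiffOn 𝓘(ℝ, ℝ) I ∞ (ψ r) (Icc c d)) a b :=
  h.piecewise.mono fun _ _ _ _ _ h => h.slice hr

/-- Functions which coincide, piece by piece, with continuous ones are interval integrable. -/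
theorem Piecewise.intervalIntegrable {f : ℝ → ℝ} {a b : ℝ}
    (h : Piecewise (fun c d => ∃ g, ContinuousOn g (Icc c d) ∧ EqOn f g (Ioo c d)) a b) :
    IntervalIntegrable f volume a b := by
  induction h with
  | refl => exact IntervalIntegrable.refl
  | piece hab h =>
    obtain ⟨g, hg, hfg⟩ := h
    refine (hg.intervalIntegrable_of_Icc hab.le).congr_uIoo ?_
    rw [uIoo_of_le hab.le]
    exact hfg.symm
  | trans _ _ i₁ i₂ => exact i₁.trans i₂

theorem intervalIntegrable_velocity [IsManifold I 1 N] {G : TangentBundle I N → ℝ}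
    (hG : Continuous G) {w : ℝ → ℝ} {γ : ℝ → N} {a b : ℝ} (hw : ContinuousOn w (Icc a b))
    (h : Piecewise (fun c d => ContMDiffOn 𝓘(ℝ, ℝ) I ∞ γ (Icc c d)) a b) :
    IntervalIntegrable (fun s => w s * G (velocity I γ (Icc a b) s)) volume a b := by
  refine Piecewise.intervalIntegrable (h.mono fun c d hc hcd hd hγ => ?_)
  refine ⟨fun s => w s * G (velocity I γ (Icc c d) s), ?_, fun s hs => ?_⟩
  · exact (hw.mono (Icc_subset_Icc hc hd)).mul
      (hG.comp_continuousOn (contMDiffOn_velocity hcd (m := ∞) le_rfl hγ).continuousOn)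
  · simp only [velocity_Icc_of_mem_Ioo γ hc hd hs]

theorem energy_congr {L : TangentBundle I N → ℝ} {a b : ℝ} (hab : a ≤ b) {γ γ' : ℝ → N}
    (h : EqOn γ γ' (Icc a b)) : energy I L a b γ = energy I L a b γ' := by
  unfold energy
  congr 1
  refine intervalIntegral.integral_congr fun s hs => ?_
  rw [uIcc_of_le hab] at hs
  simp only [velocity_congr (I := I) h hs]

theorem energy_eq_integral_subinterval {L : TangentBundle I N → ℝ} {a b c d : ℝ} (hc : a ≤ c)
    (hcd : c ≤ d) (hd : d ≤ b) (γ : ℝ → N) :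
    energy I L c d γ = (1 / 2) * ∫ s in c..d, L (velocity I γ (Icc a b) s) := by
  unfold energy
  congr 1
  refine intervalIntegral.integral_congr_Ioo_of_le hcd fun s hs => ?_
  simp only [velocity_Icc_of_mem_Ioo γ hc hd hs]

end Velocity

/-! ### Uniformity in the variation parameter and differentiation under the integral -/

section ParametricIntegral

/-- Tube lemma: an open condition valid on the compact slice `r = 0` persists for small `r`,
uniformly in `s`. It keeps varied curves in a chart and their velocities away from zero. -/
theorem exists_pos_forall_mem_of_continuousOn {X : Type*} [TopologicalSpace X] {f : ℝ × ℝ → X}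
    {ε c d : ℝ} (hε : 0 < ε) (hf : ContinuousOn f (Ioo (-ε) ε ×ˢ Icc c d)) {U : Set X}
    (hU : IsOpen U) (h0 : ∀ s ∈ Icc c d, f (0, s) ∈ U) :
    ∃ δ, 0 < δ ∧ δ ≤ ε ∧ ∀ r ∈ Ioo (-δ) δ, ∀ s ∈ Icc c d, f (r, s) ∈ U := by
  obtain ⟨O, hO, hOU⟩ := continuousOn_iff'.1 hf U hU
  have hsub : ({0} : Set ℝ) ×ˢ Icc c d ⊆ O := by
    rintro ⟨r, s⟩ ⟨hr, hs⟩
    obtain rfl : r = 0 := hr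
    have : ((0 : ℝ), s) ∈ f ⁻¹' U ∩ (Ioo (-ε) ε ×ˢ Icc c d) :=
      ⟨h0 s hs, ⟨by simpa using hε, hs⟩⟩
    rw [hOU] at this
    exact this.1
  obtain ⟨u, v, hu, -, h0u, hv, huv⟩ := generalized_tube_lemma isCompact_singleton isCompact_Icc
    hO hsub
  obtain ⟨δ, hδ, hball⟩ := Metric.isOpen_iff.1 hu 0 (h0u rfl)
  refine ⟨min δ ε, lt_min hδ hε, min_le_right _ _, fun r hr s hs => ?_⟩
  have hrδ : r ∈ Metric.ball (0 : ℝ) δ := by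
    rw [Real.ball_eq_Ioo]
    exact ⟨by linarith [hr.1, min_le_left δ ε], by linarith [hr.2, min_le_left δ ε]⟩
  have hrε : r ∈ Ioo (-ε) ε :=
    ⟨by linarith [hr.1, min_le_right δ ε], by linarith [hr.2, min_le_right δ ε]⟩
  have : (r, s) ∈ O ∩ (Ioo (-ε) ε ×ˢ Icc c d) := ⟨huv ⟨hball hrδ, hv hs⟩, hrε, hs⟩
  rw [← hOU] at this
  exact this.1

/-- Differentiation under the integral sign over a compact interval. -/
theorem hasDerivAt_integral_of_contDiffOn {H : ℝ → ℝ → ℝ} {ε c d : ℝ} (hε : 0 < ε) (hcd : c < d)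
    (hH : ContDiffOn ℝ 1 (Function.uncurry H) (Ioo (-ε) ε ×ˢ Icc c d)) :
    HasDerivAt (fun r => ∫ s in c..d, H r s) (∫ s in c..d, deriv (fun r => H r s) 0) 0 := by
  set S : Set (ℝ × ℝ) := Ioo (-ε) ε ×ˢ Icc c d with hS
  have hSu : UniqueDiffOn ℝ S := (uniqueDiffOn_Ioo _ _).prod (uniqueDiffOn_Icc hcd)
  set F' : ℝ → ℝ → ℝ := fun r s => fderivWithin ℝ (Function.uncurry H) S (r, s) (1, 0) with hF'
  have hF'c : ContinuousOn (Function.uncurry F') S :=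
    (hH.continuousOn_fderivWithin hSu le_rfl).clm_apply continuousOn_const
  have hder : ∀ r ∈ Ioo (-ε) ε, ∀ s ∈ Icc c d, HasDerivAt (fun r => H r s) (F' r s) r := by
    intro r hr s hs
    have h1 := ((hH.differentiableOn one_ne_zero) (r, s) ⟨hr, hs⟩).hasFDerivWithinAt
    have h2 : HasDerivWithinAt (fun r : ℝ => (r, s)) ((1 : ℝ), (0 : ℝ)) (Ioo (-ε) ε) r :=
      (hasDerivWithinAt_id r _).prodMk (hasDerivWithinAt_const r _ s)
    exact (h1.comp_hasDerivWithinAt r h2 fun x hx => mk_mem_prod hx hs).hasDerivAt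
      (isOpen_Ioo.mem_nhds hr)
  have h0 : (0 : ℝ) ∈ Ioo (-ε) ε := by simpa using hε
  have hslice : ∀ r ∈ Ioo (-ε) ε, ContinuousOn (H r) (Icc c d) := fun r hr =>
    hH.continuousOn.comp (by fun_prop : ContinuousOn (fun s : ℝ => (r, s)) (Icc c d))
      fun s hs => ⟨hr, hs⟩
  -- On the closed half strip compactness bounds the `r`-derivative by a constant, which serves as
  -- the dominating function.
  have hsub : Icc (-(ε / 2)) (ε / 2) ⊆ Ioo (-ε) ε := fun r hr =>
    ⟨by linarith [hr.1], by linarith [hr.2]⟩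
  obtain ⟨C, hC⟩ := (isCompact_Icc.prod isCompact_Icc).exists_bound_of_continuousOn
    (hF'c.mono (prod_mono hsub Subset.rfl))
  have key := intervalIntegral.hasDerivAt_integral_of_dominated_loc_of_deriv_le
    (μ := volume) (a := c) (b := d) (F := H) (F' := F') (x₀ := 0) (s := Icc (-(ε / 2)) (ε / 2))
    (bound := fun _ => C) (Icc_mem_nhds (by linarith) (by linarith)) ?_
    ((hslice 0 h0).intervalIntegrable_of_Icc hcd.le) ?_ ?_ intervalIntegrable_const ?_
  · convert! key.2 using 1
    refine intervalIntegral.integral_congr fun s hs => ?_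
    rw [uIcc_of_le hcd.le] at hs
    exact (hder 0 h0 s hs).deriv
  · filter_upwards [isOpen_Ioo.mem_nhds h0] with r hr
    rw [uIoc_of_le hcd.le]
    exact ((hslice r hr).mono Ioc_subset_Icc_self).aestronglyMeasurable measurableSet_Ioc
  · rw [uIoc_of_le hcd.le]
    refine ContinuousOn.aestronglyMeasurable (fun s hs => ?_) measurableSet_Ioc
    exact ((hF'c.comp (by fun_prop : ContinuousOn (fun s : ℝ => ((0 : ℝ), s)) (Icc c d))
      fun s hs => ⟨h0, hs⟩).mono Ioc_subset_Icc_self) s hs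
  · refine Filter.Eventually.of_forall fun s hs r hr => ?_
    rw [uIoc_of_le hcd.le] at hs
    exact hC (r, s) ⟨hr, Ioc_subset_Icc_self hs⟩
  · refine Filter.Eventually.of_forall fun s hs r hr => ?_
    rw [uIoc_of_le hcd.le] at hs
    exact hder r (hsub hr) s (Ioc_subset_Icc_self hs)

end ParametricIntegral

/-! ### Restriction of geodesics to subintervals -/

section Restrict

/-- Extend a variation of the restriction of `γ` to `[c, d]` by `γ`. -/
noncomputable def extendVariation {N : Type*} (γ : ℝ → N) (c d : ℝ) (ψ : ℝ → ℝ → N) : ℝ → ℝ → N :=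
  fun r s => if s ∈ Icc c d then ψ r s else γ s

theorem extendVariation_of_mem {N : Type*} {γ : ℝ → N} {c d : ℝ} {ψ : ℝ → ℝ → N} {r s : ℝ}
    (hs : s ∈ Icc c d) : extendVariation γ c d ψ r s = ψ r s := if_pos hs

variable {E : Type*} [NormedAddCommGroup E] [NormedSpace ℝ E]
  {H : Type*} [TopologicalSpace H] {I : ModelWithCorners ℝ E H}
  {N : Type*} [TopologicalSpace N] [ChartedSpace H N]

/-- The end points `c` and `d` are included because a proper variation is fixed there; this is why
the extension by `γ` has no jump. -/
theorem IsProperVariation.extendVariation_of_notMem {γ : ℝ → N} {c d ε : ℝ} {ψ : ℝ → ℝ → N}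
    (h : IsProperVariation I c d γ ε ψ) {r s : ℝ} (hr : r ∈ Ioo (-ε) ε) (hs : s ∉ Ioo c d) :
    extendVariation γ c d ψ r s = γ s := by
  by_cases hs' : s ∈ Icc c d
  · rw [extendVariation_of_mem hs']
    rcases hs'.1.eq_or_lt with rfl | h1
    · exact h.left r hr
    · rcases hs'.2.eq_or_lt with rfl | h2
      · exact h.right r hr
      · exact absurd ⟨h1, h2⟩ hs
  · exact if_neg hs'

theorem IsProperVariation.extend {γ : ℝ → N} {a b c d ε : ℝ} {ψ : ℝ → ℝ → N}
    (hγ : Piecewise (fun c d => ContMDiffOn 𝓘(ℝ, ℝ) I ∞ γ (Icc c d)) a b)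
    (hab : a < b) (hc : a ≤ c) (hcd : c ≤ d) (hd : d ≤ b) (h : IsProperVariation I c d γ ε ψ) :
    IsProperVariation I a b γ ε (extendVariation γ c d ψ) := by
  have out : ∀ a' b', a ≤ a' → a' ≤ b' → b' ≤ b → (∀ s ∈ Icc a' b', s ∉ Ioo c d) →
      Piecewise (fun c' d' => ContMDiffOn 𝓘(ℝ, ℝ × ℝ) I ∞
        (Function.uncurry (extendVariation γ c d ψ)) (Ioo (-ε) ε ×ˢ Icc c' d')) a' b' := by
    intro a' b' ha hab' hb hout
    refine (hγ.restrict (hereditary_contMDiffOn γ) ha hab' hb).mono fun p q hp _ hq hs => ?_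
    refine (hs.comp (contDiff_snd (𝕜 := ℝ) (E := ℝ) (F := ℝ)).contMDiff.contMDiffOn
      fun x (hx : x ∈ Ioo (-ε) ε ×ˢ Icc p q) => hx.2).congr fun x hx => ?_
    exact h.extendVariation_of_notMem hx.1 (hout _ ⟨hp.trans hx.2.1, hx.2.2.trans hq⟩)
  refine isProperVariation_of_piecewise hab h.pos
    (((out a c le_rfl hc (hcd.trans hd) fun s hs hs' => ?_).trans ?_).trans
      (out d b (hc.trans hcd) hd le_rfl fun s hs hs' => ?_)) ?_ ?_ ?_
  · exact absurd hs'.1 (not_lt.2 hs.2)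
  · refine h.piecewise.mono fun p q hp _ hq hs => hs.congr fun x hx => ?_
    exact extendVariation_of_mem ⟨hp.trans hx.2.1, hx.2.2.trans hq⟩
  · exact absurd hs'.2 (not_lt.2 hs.1)
  · intro s hs
    by_cases hs' : s ∈ Icc c d
    · rw [extendVariation_of_mem hs', h.base s hs']
    · exact if_neg hs'
  · exact fun r hr => h.extendVariation_of_notMem hr fun hs => absurd hs.1 (not_lt.2 hc)
  · exact fun r hr => h.extendVariation_of_notMem hr fun hs => absurd hs.2 (not_lt.2 hd)

/-- The restriction of a geodesic to a subinterval is a geodesic. -/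
theorem IsGeodesic.restrict [IsManifold I 1 N] {L : TangentBundle I N → ℝ} (hL : Continuous L)
    {a b c d : ℝ} {γ : ℝ → N} (h : IsGeodesic I L a b γ) (hc : a ≤ c) (hcd : c < d) (hd : d ≤ b) :
    IsGeodesic I L c d γ := by
  have hγ := h.1.piecewise
  have hab : a < b := hc.trans_lt (hcd.trans_le hd)
  refine ⟨isPiecewiseSmooth_of_piecewise hcd
    (hγ.restrict (hereditary_contMDiffOn γ) hc hcd.le hd), fun ε ψ hψ => ?_⟩
  have hext := hψ.extend hγ hab hc hcd.le hd
  have key := h.2 ε _ hext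
  -- Only the middle term depends on `r`, so the two energies have the same derivative.
  have heq : ∀ r ∈ Ioo (-ε) ε, energy I L a b (extendVariation γ c d ψ r)
      = energy I L a c γ + energy I L c d (ψ r) + energy I L d b γ := by
    intro r hr
    -- Continuity of `L` enters only here, as integrability, without which the integral could not be
    -- split.
    have hint := intervalIntegrable_velocity hL (w := fun _ => 1) continuousOn_const
      (hext.piecewise_slice hr)
    simp only [one_mul] at hint
    have e1 : energy I L a c γ = energy I L a c (extendVariation γ c d ψ r) :=
      energy_congr hc fun s hs => (hψ.extendVariation_of_notMem hr
        fun hs' => absurd hs'.1 (not_lt.2 hs.2)).symm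
    have e2 : energy I L c d (ψ r) = energy I L c d (extendVariation γ c d ψ r) :=
      energy_congr hcd.le fun s hs => (extendVariation_of_mem hs).symm
    have e3 : energy I L d b γ = energy I L d b (extendVariation γ c d ψ r) :=
      energy_congr hd fun s hs => (hψ.extendVariation_of_notMem hr
        fun hs' => absurd hs'.2 (not_lt.2 hs.1)).symm
    rw [e1, e2, e3, energy_eq_integral_subinterval le_rfl hc (hcd.le.trans hd),
      energy_eq_integral_subinterval hc hcd.le hd,
      energy_eq_integral_subinterval (hc.trans hcd.le) hd le_rfl, energy]
    have sub : ∀ x y, a ≤ x → x ≤ y → y ≤ b → IntervalIntegrable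
        (fun s => L (velocity I (extendVariation γ c d ψ r) (Icc a b) s)) volume x y :=
      fun x y hx hxy hy => hint.mono_set (by
        rw [uIcc_of_le hxy, uIcc_of_le hab.le]; exact Icc_subset_Icc hx hy)
    rw [← intervalIntegral.integral_add_adjacent_intervals (sub a d le_rfl (hc.trans hcd.le) hd)
      (sub d b (hc.trans hcd.le) hd le_rfl),
      ← intervalIntegral.integral_add_adjacent_intervals (sub a c le_rfl hc (hcd.le.trans hd))
      (sub c d hc hcd.le hd)]
    ring
  have hnear : ∀ᶠ r in nhds (0 : ℝ), energy I L c d (ψ r) =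
      energy I L a b (extendVariation γ c d ψ r) - (energy I L a c γ + energy I L d b γ) := by
    filter_upwards [Ioo_mem_nhds (neg_lt_zero.2 hψ.pos) hψ.pos] with r hr
    rw [heq r hr]; ring
  exact (key.sub_const _).congr_of_eventuallyEq hnear

end Restrict

/-! ### Finsler metrics and conservation of speed -/

section FinslerMetric

variable {n : ℕ} {M : Type*} [TopologicalSpace M] [ChartedSpace (EuclideanSpace ℝ (Fin n)) M]
  [IsManifold (𝓡 n) ∞ M] {F : TangentBundle (𝓡 n) M → ℝ}

namespace IsFinslerMetric

theorem map_zero (hF : IsFinslerMetric F) (x : M) : F ⟨x, 0⟩ = 0 := by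
  have h := hF.homogeneous x 0 2 two_pos
  rw [smul_zero] at h
  linarith

theorem nonneg (hF : IsFinslerMetric F) (p : TangentBundle (𝓡 n) M) : 0 ≤ F p := by
  obtain ⟨x, v⟩ := p
  by_cases hv : v = 0
  · subst hv; exact (hF.map_zero x).ge
  · exact (hF.pos x v hv).le

theorem pos_iff (hF : IsFinslerMetric F) {p : TangentBundle (𝓡 n) M} : 0 < F p ↔ p.2 ≠ 0 := by
  obtain ⟨x, v⟩ := p
  refine ⟨fun h hv => ?_, hF.pos x v⟩
  obtain rfl : v = 0 := hv
  rw [hF.map_zero x] at h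
  exact lt_irrefl _ h

theorem contMDiffAt (hF : IsFinslerMetric F) {p : TangentBundle (𝓡 n) M} (hp : 0 < F p) :
    ContMDiffAt (𝓡 n).tangent 𝓘(ℝ, ℝ) ∞ F p := by
  have h : {p : TangentBundle (𝓡 n) M | p.2 ≠ 0} = F ⁻¹' Ioi 0 := by
    ext p; exact hF.pos_iff.symm
  have := hF.smooth
  rw [h] at this
  exact this.contMDiffAt ((isOpen_Ioi.preimage hF.continuous).mem_nhds hp)

theorem contDiffOn_comp (hF : IsFinslerMetric F) {V : Type*} [NormedAddCommGroup V]
    [NormedSpace ℝ V] {f : V → TangentBundle (𝓡 n) M} {S : Set V}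
    (hf : ContMDiffOn 𝓘(ℝ, V) (𝓡 n).tangent ∞ f S) (hpos : ∀ p ∈ S, 0 < F (f p)) :
    ContDiffOn ℝ ∞ (fun p => F (f p)) S := by
  rw [← contMDiffOn_iff_contDiffOn]
  exact fun p hp => (hF.contMDiffAt (hpos p hp)).comp_contMDiffWithinAt p (hf p hp)

theorem continuous_sq (hF : IsFinslerMetric F) : Continuous fun p => F p ^ 2 :=
  hF.continuous.pow 2

theorem velocity_comp (hF : IsFinslerMetric F) {γ : ℝ → M} {φ : ℝ → ℝ} {S T : Set ℝ} {u φ' : ℝ}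
    (hφ : HasDerivWithinAt φ φ' S u) (hφ' : 0 < φ') (hST : MapsTo φ S T)
    (hS : UniqueDiffWithinAt ℝ S u) (hγ : MDifferentiableWithinAt 𝓘(ℝ, ℝ) (𝓡 n) γ T (φ u)) :
    F (velocity (𝓡 n) (γ ∘ φ) S u) = φ' * F (velocity (𝓡 n) γ T (φ u)) := by
  rw [_root_.velocity_comp hφ hST hS hγ, hF.homogeneous _ _ _ hφ']
  rfl

/-- Conservation of energy along a smooth regular geodesic. -/
theorem constant_speed (hF : IsFinslerMetric F) {ρ : ℝ → M} {c d : ℝ} (hcd : c < d)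
    (hρ : ContMDiffOn 𝓘(ℝ, ℝ) (𝓡 n) ∞ ρ (Icc c d))
    (hgeo : IsGeodesic (𝓡 n) (fun p => F p ^ 2) c d ρ)
    (hpos : ∀ u ∈ Icc c d, 0 < F (velocity (𝓡 n) ρ (Icc c d) u)) :
    ∀ u ∈ Icc c d, ∀ v ∈ Icc c d,
      F (velocity (𝓡 n) ρ (Icc c d) u) = F (velocity (𝓡 n) ρ (Icc c d) v) := by
  have hU := uniqueDiffOn_Icc hcd
  set f : ℝ → ℝ := fun u => F (velocity (𝓡 n) ρ (Icc c d) u) ^ 2 with hfdef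
  have hf : ContDiffOn ℝ ∞ f (Icc c d) :=
    (hF.contDiffOn_comp (contMDiffOn_velocity hcd (m := ∞) le_rfl hρ) hpos).pow 2
  set f' := derivWithin f (Icc c d) with hf'def
  have hf' : ContDiffOn ℝ ∞ f' (Icc c d) := hf.derivWithin hU (by simp)
  -- The variation slides points along the curve, `u ↦ u + r h(u)`. With this `h`, criticality will
  -- read `∫ f'² (u - c)(d - u) = 0`; the quadratic factor fixes the end points.
  set h : ℝ → ℝ := fun u => f' u * ((u - c) * (d - u)) with hhdef
  have hh : ContDiffOn ℝ ∞ h (Icc c d) := hf'.mul (by fun_prop)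
  set h' := derivWithin h (Icc c d) with hh'def
  have hh' : ContDiffOn ℝ ∞ h' (Icc c d) := hh.derivWithin hU (by simp)
  obtain ⟨C, hC⟩ := isCompact_Icc.exists_bound_of_continuousOn hf'.continuousOn
  obtain ⟨C', hC'⟩ := isCompact_Icc.exists_bound_of_continuousOn hh'.continuousOn
  have hC0 : 0 ≤ C := (norm_nonneg _).trans (hC c (left_mem_Icc.2 hcd.le))
  have hC0' : 0 ≤ C' := (norm_nonneg _).trans (hC' c (left_mem_Icc.2 hcd.le))
  -- The first bound keeps `u + r h(u)` in `[c, d]`; the second keeps its derivative `1 + r h'(u)`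
  -- positive, as positive homogeneity requires.
  obtain ⟨ε, hε, hε1, hε2⟩ : ∃ ε : ℝ, 0 < ε ∧ ε * (C * (d - c)) ≤ 1 ∧ ε * C' < 1 := by
    have h1 : 0 ≤ C * (d - c) := mul_nonneg hC0 (by linarith)
    refine ⟨1 / (C * (d - c) + C' + 1), by positivity, ?_, ?_⟩
    · rw [one_div, inv_mul_le_iff₀ (by positivity)]; linarith
    · rw [one_div, inv_mul_lt_iff₀ (by positivity)]; linarith
  have hmaps : ∀ r ∈ Ioo (-ε) ε, ∀ u ∈ Icc c d, u + r * h u ∈ Icc c d := by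
    intro r hr u hu
    have hr' : |r| ≤ ε := abs_le.2 ⟨hr.1.le, hr.2.le⟩
    have hrf : |r * f' u| * (d - c) ≤ 1 := by
      rw [abs_mul]
      calc |r| * |f' u| * (d - c) ≤ ε * C * (d - c) :=
            mul_le_mul_of_nonneg_right
              (mul_le_mul hr' (hC u hu) (abs_nonneg _) hε.le) (by linarith)
        _ ≤ 1 := by linarith
    have h1 := le_abs_self (r * f' u)
    have h2 := neg_abs_le (r * f' u)
    have e : r * h u = (r * f' u) * ((u - c) * (d - u)) := by simp only [hhdef]; ring
    rw [e]
    set y := r * f' u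
    have hu1 : 0 ≤ u - c := by linarith [hu.1]
    have hu2 : 0 ≤ d - u := by linarith [hu.2]
    have k1 : |y| * (d - u) ≤ 1 := le_trans (by gcongr; exact hu.1) hrf
    have k2 : |y| * (u - c) ≤ 1 := le_trans (by gcongr; exact hu.2) hrf
    have k3 : -y * (d - u) ≤ 1 := le_trans (mul_le_mul_of_nonneg_right (by linarith) hu2) k1
    have k4 : y * (u - c) ≤ 1 := le_trans (mul_le_mul_of_nonneg_right h1 hu1) k2
    constructor
    · nlinarith [mul_nonneg hu1 (sub_nonneg.2 k3)]
    · nlinarith [mul_nonneg hu2 (sub_nonneg.2 k4)]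
  set ψ : ℝ → ℝ → M := fun r u => ρ (u + r * h u) with hψdef
  have hφ : ContDiffOn ℝ ∞ (fun p : ℝ × ℝ => p.2 + p.1 * h p.2) (Ioo (-ε) ε ×ˢ Icc c d) :=
    contDiff_snd.contDiffOn.add (contDiff_fst.contDiffOn.mul
      (hh.comp contDiff_snd.contDiffOn fun x hx => hx.2))
  have hψ : IsProperVariation (𝓡 n) c d ρ ε ψ := by
    refine isProperVariation_of_piecewise hcd hε (Piecewise.piece hcd ?_) ?_ ?_ ?_
    · exact hρ.comp hφ.contMDiffOn fun p hp => hmaps p.1 hp.1 p.2 hp.2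
    · intro s _; simp [hψdef]
    · intro r _; simp [hψdef, hhdef]
    · intro r _; simp [hψdef, hhdef]
  set H : ℝ → ℝ → ℝ := fun r u => (1 + r * h' u) ^ 2 * f (u + r * h u) with hHdef
  have hH : ContDiffOn ℝ 1 (Function.uncurry H) (Ioo (-ε) ε ×ˢ Icc c d) := by
    have h1 : ContDiffOn ℝ ∞ (Function.uncurry H) (Ioo (-ε) ε ×ˢ Icc c d) :=
      ((contDiffOn_const.add (contDiff_fst.contDiffOn.mul
        (hh'.comp contDiff_snd.contDiffOn fun x hx => hx.2))).pow 2).mul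
        (hf.comp hφ fun p hp => hmaps p.1 hp.1 p.2 hp.2)
    exact h1.of_le (by simp)
  have henergy : ∀ r ∈ Ioo (-ε) ε, energy (𝓡 n) (fun p => F p ^ 2) c d (ψ r)
      = (1 / 2) * ∫ u in c..d, H r u := by
    intro r hr
    unfold energy
    congr 1
    refine intervalIntegral.integral_congr fun u hu => ?_
    rw [uIcc_of_le hcd.le] at hu
    have hder : HasDerivWithinAt (fun u => u + r * h u) (1 + r * h' u) (Icc c d) u :=
      (hasDerivWithinAt_id u _).add
        (((hh.differentiableOn (by simp)) u hu).hasDerivWithinAt.const_mul r)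
    have hpos' : 0 < 1 + r * h' u := by
      have h1 : |r * h' u| < 1 := by
        rw [abs_mul]
        exact lt_of_le_of_lt (mul_le_mul (abs_le.2 ⟨hr.1.le, hr.2.le⟩) (hC' u hu) (abs_nonneg _)
          hε.le) hε2
      linarith [neg_abs_le (r * h' u)]
    have hvel := hF.velocity_comp hder hpos' (fun u hu => hmaps r hr u hu) (hU u hu)
      ((hρ _ (hmaps r hr u hu)).mdifferentiableWithinAt (by simp))
    change F (velocity (𝓡 n) (ρ ∘ fun u => u + r * h u) (Icc c d) u) ^ 2 = _
    rw [hvel, mul_pow]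
  have h0 : (0 : ℝ) ∈ Ioo (-ε) ε := by simpa using hε
  have hderiv : ∀ u ∈ Icc c d, deriv (fun r => H r u) 0 = 2 * h' u * f u + f' u * h u := by
    intro u hu
    have h1 : HasDerivAt (fun r : ℝ => (1 + r * h' u) ^ 2) (2 * h' u) 0 := by
      have := (((hasDerivAt_id (0 : ℝ)).mul_const (h' u)).const_add 1).pow 2
      convert! this using 1
      simp
    have h2 : HasDerivAt (fun r : ℝ => u + r * h u) (h u) 0 := by
      simpa using ((hasDerivAt_id (0 : ℝ)).mul_const (h u)).const_add u
    have h3 : HasDerivWithinAt f (f' u) (Icc c d) (u + 0 * h u) := by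
      rw [zero_mul, add_zero]
      exact ((hf.differentiableOn (by simp)) u hu).hasDerivWithinAt
    have h4 := (h3.comp (0 : ℝ) (h2.hasDerivWithinAt (s := Ioo (-ε) ε))
      fun r hr => hmaps r hr u hu).hasDerivAt (isOpen_Ioo.mem_nhds h0)
    have h5 := (h1.mul h4).deriv
    simp only [zero_mul, add_zero, one_pow, Function.comp_apply, one_mul] at h5
    exact h5
  have hzero : ∫ u in c..d, (2 * h' u * f u + f' u * h u) = 0 := by
    have h1 := (hasDerivAt_integral_of_contDiffOn hε hcd hH).const_mul (1 / 2)
    have h2 : HasDerivAt (fun r => (1 / 2) * ∫ u in c..d, H r u) 0 0 :=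
      (hgeo.2 ε ψ hψ).congr_of_eventuallyEq (by
        filter_upwards [isOpen_Ioo.mem_nhds h0] with r hr using (henergy r hr).symm)
    have h3 := h1.unique h2
    have h4 : ∫ u in c..d, deriv (fun r => H r u) 0
        = ∫ u in c..d, (2 * h' u * f u + f' u * h u) := by
      refine intervalIntegral.integral_congr fun u hu => ?_
      rw [uIcc_of_le hcd.le] at hu
      exact hderiv u hu
    rw [h4] at h3
    linarith
  have hparts : ∫ u in c..d, (h' u * f u + h u * f' u) = 0 := by
    rw [intervalIntegral.integral_eq_sub_of_hasDerivAt_of_le hcd.le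
      (f := fun u => h u * f u) (hh.continuousOn.mul hf.continuousOn)]
    · simp [hhdef]
    · intro u hu
      have hu' := Ioo_subset_Icc_self hu
      have hn := Icc_mem_nhds hu.1 hu.2
      exact (((hh.differentiableOn (by simp)) u hu').hasDerivWithinAt.hasDerivAt hn).mul
        (((hf.differentiableOn (by simp)) u hu').hasDerivWithinAt.hasDerivAt hn)
    · exact ((hh'.continuousOn.mul hf.continuousOn).add
        (hh.continuousOn.mul hf'.continuousOn)).intervalIntegrable_of_Icc hcd.le
  -- Twice the integrated product rule minus the first variation leaves exactly `∫ f' h`.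
  have hsq : ∫ u in c..d, f' u * h u = 0 := by
    have i1 : IntervalIntegrable (fun u => 2 * h' u * f u + f' u * h u) volume c d :=
      (((continuousOn_const.mul hh'.continuousOn).mul hf.continuousOn).add
        (hf'.continuousOn.mul hh.continuousOn)).intervalIntegrable_of_Icc hcd.le
    have i2 : IntervalIntegrable (fun u => 2 * (h' u * f u + h u * f' u)) volume c d :=
      (continuousOn_const.mul ((hh'.continuousOn.mul hf.continuousOn).add
        (hh.continuousOn.mul hf'.continuousOn))).intervalIntegrable_of_Icc hcd.le
    have h1 := intervalIntegral.integral_sub i2 i1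
    rw [intervalIntegral.integral_const_mul, hparts, hzero] at h1
    rw [show (2 : ℝ) * 0 - 0 = 0 by norm_num] at h1
    rw [← h1]
    congr 1; ext u; ring
  have hf'0 : ∀ u ∈ Ioo c d, f' u = 0 := by
    intro u hu
    by_contra hne
    have : 0 < ∫ u in c..d, f' u * h u := by
      refine intervalIntegral.integral_pos hcd (hf'.continuousOn.mul hh.continuousOn) ?_
        ⟨u, Ioo_subset_Icc_self hu, ?_⟩
      · intro v hv
        have h1 : 0 ≤ v - c := by linarith [hv.1]
        have h2 : 0 ≤ d - v := by linarith [hv.2]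
        have : f' v * h v = f' v ^ 2 * ((v - c) * (d - v)) := by simp only [hhdef]; ring
        rw [this]; positivity
      · have h1 : 0 < u - c := by linarith [hu.1]
        have h2 : 0 < d - u := by linarith [hu.2]
        have : f' u * h u = f' u ^ 2 * ((u - c) * (d - u)) := by simp only [hhdef]; ring
        rw [this]; positivity
    exact this.ne' hsq
  have hlt : ∀ u ∈ Icc c d, ∀ v ∈ Icc c d, u < v → f u = f v := by
    intro u hu v hv huv
    have hs : Icc u v ⊆ Icc c d := Icc_subset_Icc hu.1 hv.2
    have hd : ∀ x ∈ Ioo u v, HasDerivAt f 0 x := by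
      intro x hx
      have hx' : x ∈ Ioo c d := ⟨hu.1.trans_lt hx.1, hx.2.trans_le hv.2⟩
      rw [← hf'0 x hx']
      exact ((hf.differentiableOn (by simp)) x (Ioo_subset_Icc_self hx')).hasDerivWithinAt.hasDerivAt
        (Icc_mem_nhds hx'.1 hx'.2)
    obtain ⟨ξ, -, hξ⟩ := exists_hasDerivAt_eq_slope f (fun _ => 0) huv (hf.continuousOn.mono hs) hd
    rw [eq_comm, div_eq_zero_iff] at hξ
    rcases hξ with h | h
    · linarith
    · linarith
  intro u hu v hv
  have heq : f u = f v := by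
    rcases lt_trichotomy u v with h | rfl | h
    · exact hlt u hu v hv h
    · rfl
    · exact (hlt v hv u hu h).symm
  exact (pow_left_inj₀ (hpos u hu).le (hpos v hv).le two_ne_zero).1 heq

end IsFinslerMetric

end FinslerMetric

/-! ### The squared metric in a chart: Euler's identity and fibrewise convexity -/

section ChartLagrangian

theorem contMDiff_tangentBundle_mk {V : Type*} [NormedAddCommGroup V] [NormedSpace ℝ V] :
    ContMDiff 𝓘(ℝ, V × V) 𝓘(ℝ, V).tangent ∞
      (fun p : V × V => (⟨p.1, p.2⟩ : TangentBundle 𝓘(ℝ, V) V)) := by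
  intro p
  apply Bundle.contMDiffAt_totalSpace.2
  refine ⟨contDiff_fst.contMDiff.contMDiffAt, ?_⟩
  convert! (contDiff_snd (𝕜 := ℝ) (E := V) (F := V) (n := ∞)).contMDiff.contMDiffAt with y
  simp
  rfl

variable {n : ℕ} {M : Type*} [TopologicalSpace M] [ChartedSpace (EuclideanSpace ℝ (Fin n)) M]

variable (n) in
/-- The parametrization of the tangent bundle induced by the chart at `x`. -/
noncomputable def chartVector (x : M) (p : EuclideanSpace ℝ (Fin n) × EuclideanSpace ℝ (Fin n)) :
    TangentBundle (𝓡 n) M :=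
  tangentMapWithin 𝓘(ℝ, EuclideanSpace ℝ (Fin n)) (𝓡 n) (extChartAt (𝓡 n) x).symm
    (extChartAt (𝓡 n) x).target
    (⟨p.1, p.2⟩ : TangentBundle 𝓘(ℝ, EuclideanSpace ℝ (Fin n)) (EuclideanSpace ℝ (Fin n)))

/-- The derivative of the inverse of the chart at `x`. -/
noncomputable def chartDeriv (x : M) (y : EuclideanSpace ℝ (Fin n)) :
    EuclideanSpace ℝ (Fin n) →L[ℝ] TangentSpace (𝓡 n) ((extChartAt (𝓡 n) x).symm y) :=
  mfderivWithin 𝓘(ℝ, EuclideanSpace ℝ (Fin n)) (𝓡 n) (extChartAt (𝓡 n) x).symm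
    (extChartAt (𝓡 n) x).target y

theorem chartVector_eq (x : M) (y v : EuclideanSpace ℝ (Fin n)) :
    chartVector n x (y, v) = ⟨(extChartAt (𝓡 n) x).symm y, chartDeriv x y v⟩ := rfl

/-- The square of a Finsler metric, read in the chart at `x`. -/
noncomputable def chartLagrangian (F : TangentBundle (𝓡 n) M → ℝ) (x : M)
    (p : EuclideanSpace ℝ (Fin n) × EuclideanSpace ℝ (Fin n)) : ℝ :=
  F (chartVector n x p) ^ 2

/-- The domain on which `chartLagrangian` is smooth. -/
def chartDomain (n : ℕ) {M : Type*} [TopologicalSpace M]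
    [ChartedSpace (EuclideanSpace ℝ (Fin n)) M] (x : M) :
    Set (EuclideanSpace ℝ (Fin n) × EuclideanSpace ℝ (Fin n)) :=
  (extChartAt (𝓡 n) x).target ×ˢ {0}ᶜ

theorem isOpen_chartDomain (x : M) : IsOpen (chartDomain n x) :=
  (isOpen_extChartAt_target x).prod isOpen_compl_singleton

variable [IsManifold (𝓡 n) ∞ M] {F : TangentBundle (𝓡 n) M → ℝ}

theorem contMDiffOn_chartVector (x : M) :
    ContMDiffOn 𝓘(ℝ, EuclideanSpace ℝ (Fin n) × EuclideanSpace ℝ (Fin n)) (𝓡 n).tangent ∞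
      (chartVector n x) ((extChartAt (𝓡 n) x).target ×ˢ univ) := by
  have h1 := (contMDiffOn_extChartAt_symm (I := 𝓡 n) (n := ∞) x).contMDiffOn_tangentMapWithin
    (m := ∞) le_rfl (isOpen_extChartAt_target x).uniqueMDiffOn
  exact h1.comp contMDiff_tangentBundle_mk.contMDiffOn fun p hp => hp.1

/-- The inverse chart has invertible derivative; hence `chartDomain` lands off the zero section,
where `F` is smooth. -/
theorem chartDeriv_ne_zero (x : M) {y v : EuclideanSpace ℝ (Fin n)}
    (hy : y ∈ (extChartAt (𝓡 n) x).target) (hv : v ≠ 0) : chartDeriv x y v ≠ 0 := by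
  have h1 : chartDeriv x y = mfderivWithin 𝓘(ℝ, EuclideanSpace ℝ (Fin n)) (𝓡 n)
      (extChartAt (𝓡 n) x).symm (range (𝓡 n)) y :=
    mfderivWithin_subset (extChartAt_target_subset_range x)
      ((isOpen_extChartAt_target x).uniqueMDiffWithinAt hy)
      (mdifferentiableWithinAt_extChartAt_symm hy)
  have hinv := isInvertible_mfderivWithin_extChartAt_symm (I := 𝓡 n) hy
  rw [← h1] at hinv
  intro h
  exact hv (hinv.injective (h.trans (chartDeriv x y).map_zero.symm))

namespace IsFinslerMetric

theorem pos_chartVector (hF : IsFinslerMetric F) {x : M}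
    {p : EuclideanSpace ℝ (Fin n) × EuclideanSpace ℝ (Fin n)} (hp : p ∈ chartDomain n x) :
    0 < F (chartVector n x p) :=
  hF.pos_iff.2 (chartDeriv_ne_zero x hp.1 hp.2)

theorem contDiffOn_chartLagrangian (hF : IsFinslerMetric F) (x : M) :
    ContDiffOn ℝ ∞ (chartLagrangian F x) (chartDomain n x) :=
  (hF.contDiffOn_comp ((contMDiffOn_chartVector x).mono (prod_mono Subset.rfl (subset_univ _)))
    fun _ hp => hF.pos_chartVector hp).pow 2

theorem hasFDerivAt_chartLagrangian (hF : IsFinslerMetric F) {x : M}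
    {p : EuclideanSpace ℝ (Fin n) × EuclideanSpace ℝ (Fin n)} (hp : p ∈ chartDomain n x) :
    HasFDerivAt (chartLagrangian F x) (fderiv ℝ (chartLagrangian F x) p) p :=
  (((hF.contDiffOn_chartLagrangian x).differentiableOn (by simp)).differentiableAt
    ((isOpen_chartDomain x).mem_nhds hp)).hasFDerivAt

theorem hasDerivAt_chartLagrangian_line (hF : IsFinslerMetric F) {x : M}
    {y v w : EuclideanSpace ℝ (Fin n)} {t : ℝ} (hp : (y, v + t • w) ∈ chartDomain n x) :
    HasDerivAt (fun t : ℝ => chartLagrangian F x (y, v + t • w))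
      (fderiv ℝ (chartLagrangian F x) (y, v + t • w) (0, w)) t := by
  have h1 : HasDerivAt (fun t : ℝ => (y, v + t • w)) (0, w) t := by
    refine (hasDerivAt_const t y).prodMk ?_
    simpa using ((hasDerivAt_id t).smul_const w).const_add v
  exact (hF.hasFDerivAt_chartLagrangian hp).comp_hasDerivAt t h1

/-- Euler's identity in degree two: near `t = 0`, the value at `(1 + t)v` is `(1 + t)²` times the
value at `v`. -/
theorem fderiv_chartLagrangian_self (hF : IsFinslerMetric F) {x : M}
    {y v : EuclideanSpace ℝ (Fin n)} (hp : (y, v) ∈ chartDomain n x) :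
    fderiv ℝ (chartLagrangian F x) (y, v) (0, v) = 2 * chartLagrangian F x (y, v) := by
  have h1 := hF.hasDerivAt_chartLagrangian_line (x := x) (y := y) (v := v) (w := v) (t := 0)
    (by simpa using hp)
  rw [zero_smul, add_zero] at h1
  refine h1.unique ?_
  have h2 : HasDerivAt (fun t : ℝ => (1 + t) ^ 2 * chartLagrangian F x (y, v))
      (2 * chartLagrangian F x (y, v)) 0 := by
    have := (((hasDerivAt_id (0 : ℝ)).const_add 1).pow 2).mul_const (chartLagrangian F x (y, v))
    convert! this using 1
    simp
  refine h2.congr_of_eventuallyEq ?_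
  filter_upwards [Ioi_mem_nhds (show (-1 : ℝ) < 0 by norm_num)] with t ht
  have ht' : 0 < 1 + t := by linarith [mem_Ioi.1 ht]
  simp only [chartLagrangian, chartVector_eq]
  rw [show v + t • v = (1 + t) • v by rw [add_smul, one_smul], (chartDeriv x y).map_smul,
    hF.homogeneous _ _ _ ht', mul_pow]

/-- The inverse chart acts linearly on fibres, so this second derivative is twice the fundamental
tensor in the direction `w`. -/
theorem deriv_deriv_chartLagrangian_pos (hF : IsFinslerMetric F) {x : M}
    {y v w : EuclideanSpace ℝ (Fin n)} {t : ℝ} (hw : w ≠ 0)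
    (hp : (y, v + t • w) ∈ chartDomain n x) :
    0 < deriv (deriv fun t : ℝ => chartLagrangian F x (y, v + t • w)) t := by
  set q : ℝ → ℝ := fun t => chartLagrangian F x (y, v + t • w) with hq
  have h := hF.posDef _ (chartDeriv x y (v + t • w)) (chartDeriv x y w)
    (chartDeriv_ne_zero x hp.1 hp.2) (chartDeriv_ne_zero x hp.1 hw)
  unfold fundTensor at h
  have h1 : ∀ r s : ℝ, F ⟨(extChartAt (𝓡 n) x).symm y,
      chartDeriv x y (v + t • w) + r • chartDeriv x y w + s • chartDeriv x y w⟩ ^ 2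
      = q ((t + r) + s) := by
    intro r s
    simp only [hq, chartLagrangian, chartVector_eq]
    rw [← (chartDeriv x y).map_smul, ← (chartDeriv x y).map_smul, ← (chartDeriv x y).map_add,
      ← (chartDeriv x y).map_add,
      show v + (t + r + s) • w = v + t • w + r • w + s • w by module]
  simp only [h1, deriv_comp_const_add, add_zero] at h
  linarith

/-- Strict monotonicity of the fibre derivative. -/
theorem fderiv_chartLagrangian_lt (hF : IsFinslerMetric F) {x : M}
    {y p q : EuclideanSpace ℝ (Fin n)} (hp : (y, p) ∈ chartDomain n x)
    (hq : (y, q) ∈ chartDomain n x) (hpq : p ≠ q) :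
    fderiv ℝ (chartLagrangian F x) (y, p) (0, q - p)
      < fderiv ℝ (chartLagrangian F x) (y, q) (0, q - p) := by
  have hw : q - p ≠ 0 := sub_ne_zero.2 hpq.symm
  -- Positive definiteness is available only off zero. If the segment from `p` to `q` avoids zero,
  -- the directional derivative strictly increases along it. Otherwise `p` and `q` are multiples of
  -- `q - p` of opposite signs, and Euler's identity makes the left side negative and the right side
  -- positive.
  by_cases H : ∀ t ∈ Icc (0 : ℝ) 1, p + t • (q - p) ≠ 0
  · set f : ℝ → ℝ := fun t => chartLagrangian F x (y, p + t • (q - p)) with hf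
    have hdom : ∀ t ∈ Icc (0 : ℝ) 1, (y, p + t • (q - p)) ∈ chartDomain n x :=
      fun t ht => ⟨hp.1, H t ht⟩
    have hmono : StrictMonoOn (deriv f) (Icc 0 1) := by
      refine strictMonoOn_of_deriv_pos (convex_Icc 0 1) ?_ ?_
      · have hT : IsOpen ((fun t : ℝ => (y, p + t • (q - p))) ⁻¹' chartDomain n x) :=
          (isOpen_chartDomain x).preimage (by fun_prop)
        have hfT : ContDiffOn ℝ ∞ f ((fun t : ℝ => (y, p + t • (q - p))) ⁻¹' chartDomain n x) :=
          (hF.contDiffOn_chartLagrangian x).comp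
            ((by fun_prop : ContDiff ℝ ∞ fun t : ℝ => (y, p + t • (q - p))).contDiffOn)
            fun t ht => ht
        exact (hfT.continuousOn_deriv_of_isOpen hT (by simp)).mono hdom
      · intro t ht
        exact hF.deriv_deriv_chartLagrangian_pos hw (hdom t (interior_subset ht))
    have h01 := hmono (left_mem_Icc.2 zero_le_one) (right_mem_Icc.2 zero_le_one) zero_lt_one
    have e0 := (hF.hasDerivAt_chartLagrangian_line (hdom 0 (left_mem_Icc.2 zero_le_one))).deriv
    have e1 := (hF.hasDerivAt_chartLagrangian_line (hdom 1 (right_mem_Icc.2 zero_le_one))).deriv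
    rw [← hf] at e0 e1
    rw [e0, e1] at h01
    simpa using h01
  · push Not at H
    obtain ⟨t, ht, h0⟩ := H
    have ht0 : t ≠ 0 := by
      rintro rfl
      rw [zero_smul, add_zero] at h0
      exact hp.2 h0
    have ht1 : t ≠ 1 := by
      rintro rfl
      rw [one_smul, add_sub_cancel] at h0
      exact hq.2 h0
    have htpos : 0 < t := lt_of_le_of_ne ht.1 ht0.symm
    have htlt : t < 1 := lt_of_le_of_ne ht.2 ht1
    have hlp : 0 < chartLagrangian F x (y, p) := pow_pos (hF.pos_chartVector hp) 2
    have hlq : 0 < chartLagrangian F x (y, q) := pow_pos (hF.pos_chartVector hq) 2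
    have hp' : p = (-t) • (q - p) := by
      rw [neg_smul]; exact eq_neg_of_add_eq_zero_left h0
    have hq' : q = (1 - t) • (q - p) := by
      rw [sub_smul, one_smul]
      have : q = p + (q - p) := by abel
      rw [eq_sub_iff_add_eq, ← sub_eq_zero]
      rw [← h0]; abel
    have kp : fderiv ℝ (chartLagrangian F x) (y, p) (0, q - p) * (-t)
        = 2 * chartLagrangian F x (y, p) := by
      rw [← hF.fderiv_chartLagrangian_self hp, mul_comm, ← smul_eq_mul, ← map_smul]
      congr 1
      rw [Prod.smul_mk, smul_zero, ← hp']
    have kq : fderiv ℝ (chartLagrangian F x) (y, q) (0, q - p) * (1 - t)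
        = 2 * chartLagrangian F x (y, q) := by
      rw [← hF.fderiv_chartLagrangian_self hq, mul_comm, ← smul_eq_mul, ← map_smul]
      congr 1
      rw [Prod.smul_mk, smul_zero, ← hq']
    have n1 : fderiv ℝ (chartLagrangian F x) (y, p) (0, q - p) < 0 := by
      by_contra hcon
      nlinarith [mul_nonneg (not_lt.1 hcon) htpos.le]
    have n2 : 0 < fderiv ℝ (chartLagrangian F x) (y, q) (0, q - p) := by
      by_contra hcon
      nlinarith [mul_nonneg (neg_nonneg.2 (not_lt.1 hcon)) (sub_nonneg.2 htlt.le)]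
    exact n1.trans n2

end IsFinslerMetric

end ChartLagrangian

/-! ### Regular geodesics have no corners -/

/-- Equality of the one-sided derivatives is all that `C¹` regularity lacks at a break point: the
two derivatives then paste to a continuous one. -/
theorem ContDiffOn.Icc_union_of_derivWithin_eq {V : Type*} [NormedAddCommGroup V]
    [NormedSpace ℝ V] {f : ℝ → V} {a m b : ℝ} (ham : a < m) (hmb : m < b)
    (h₁ : ContDiffOn ℝ 1 f (Icc a m)) (h₂ : ContDiffOn ℝ 1 f (Icc m b))
    (h : derivWithin f (Icc a m) m = derivWithin f (Icc m b) m) :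
    ContDiffOn ℝ 1 f (Icc a b) := by
  classical
  set g : ℝ → V := fun s => if s ≤ m then derivWithin f (Icc a m) s else derivWithin f (Icc m b) s
    with hg
  have g₁ : ∀ s ∈ Icc a m, g s = derivWithin f (Icc a m) s := fun s hs => if_pos hs.2
  have g₂ : ∀ s ∈ Icc m b, g s = derivWithin f (Icc m b) s := by
    intro s hs
    rcases hs.1.eq_or_lt with rfl | hlt
    · rw [← h]; exact if_pos le_rfl
    · exact if_neg (not_le.2 hlt)
  have key : ∀ c d, c < d → ContDiffOn ℝ 1 f (Icc c d) →
      (∀ s ∈ Icc c d, g s = derivWithin f (Icc c d) s) → ∀ s,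
      HasDerivWithinAt f (g s) (Icc c d) s := by
    intro c d _ hf hgs s
    by_cases hs : s ∈ Icc c d
    · rw [hgs s hs]
      exact ((hf.differentiableOn one_ne_zero) s hs).hasDerivWithinAt
    · exact HasFDerivWithinAt.of_notMem_closure (by rwa [isClosed_Icc.closure_eq])
  have hunion := Icc_union_Icc_eq_Icc ham.le hmb.le
  have hder : ∀ s ∈ Icc a b, HasDerivWithinAt f (g s) (Icc a b) s := by
    intro s _
    rw [← hunion]
    exact (key a m ham h₁ g₁ s).union (key m b hmb h₂ g₂ s)
  have hU := uniqueDiffOn_Icc (ham.trans hmb)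
  rw [contDiffOn_one_iff_derivWithin hU]
  refine ⟨fun s hs => (hder s hs).differentiableWithinAt, ?_⟩
  have hgc : ContinuousOn g (Icc a b) := by
    rw [← hunion]
    refine ContinuousOn.union_of_isClosed ?_ ?_ isClosed_Icc isClosed_Icc
    · exact (h₁.continuousOn_derivWithin (uniqueDiffOn_Icc ham) le_rfl).congr g₁
    · exact (h₂.continuousOn_derivWithin (uniqueDiffOn_Icc hmb) le_rfl).congr g₂
  exact hgc.congr fun s hs => (hder s hs).derivWithin (hU s hs)

section NoCorner

variable {n : ℕ} {M : Type*} [TopologicalSpace M] [ChartedSpace (EuclideanSpace ℝ (Fin n)) M]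

theorem hereditary_regular (F : TangentBundle (𝓡 n) M → ℝ) (ρ : ℝ → M) :
    Hereditary fun c d => ContMDiffOn 𝓘(ℝ, ℝ) (𝓡 n) ∞ ρ (Icc c d) ∧
      ∀ u ∈ Icc c d, 0 < F (velocity (𝓡 n) ρ (Icc c d) u) := by
  intro a b c d hc hcd hd h
  have hsub : Icc c d ⊆ Icc a b := Icc_subset_Icc hc hd
  refine ⟨h.1.mono hsub, fun u hu => ?_⟩
  rw [velocity_mono hsub (uniqueDiffOn_Icc hcd u hu)
    ((h.1 u (hsub hu)).mdifferentiableWithinAt (by simp))]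
  exact h.2 u (hsub hu)

variable [IsManifold (𝓡 n) ∞ M] {F : TangentBundle (𝓡 n) M → ℝ}

theorem velocity_extChartAt_symm_comp (x : M) {z : ℝ → EuclideanSpace ℝ (Fin n)} {S : Set ℝ}
    {s : ℝ} {z' : EuclideanSpace ℝ (Fin n)} (hz : HasDerivWithinAt z z' S s)
    (hS : UniqueDiffWithinAt ℝ S s) (hmaps : MapsTo z S (extChartAt (𝓡 n) x).target)
    (hs : s ∈ S) :
    velocity (𝓡 n) ((extChartAt (𝓡 n) x).symm ∘ z) S s = chartVector n x (z s, z') :=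
  velocity_comp_vector hz hmaps hS (mdifferentiableOn_extChartAt_symm _ (hmaps hs))

namespace IsFinslerMetric

/-- First variation in a chart, left without integration by parts. Since `chartDomain` is open, for
small `r` the varied curve stays in the chart with nonzero velocity, where the Lagrangian is smooth.
-/
theorem hasDerivAt_integral_chart_variation (hF : IsFinslerMetric F) (x : M) {c d : ℝ}
    (hcd : c < d) {z η : ℝ → EuclideanSpace ℝ (Fin n)} (hz : ContDiffOn ℝ ∞ z (Icc c d))
    (hdom : ∀ s ∈ Icc c d, (z s, derivWithin z (Icc c d) s) ∈ chartDomain n x)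
    (hη : ContDiffOn ℝ ∞ η (Icc c d)) :
    ∃ ε : ℝ, 0 < ε ∧ (∀ r ∈ Ioo (-ε) ε, ∀ s ∈ Icc c d,
        z s + r • η s ∈ (extChartAt (𝓡 n) x).target) ∧
      HasDerivAt (fun r : ℝ => ∫ s in c..d, F (velocity (𝓡 n)
          ((extChartAt (𝓡 n) x).symm ∘ fun s => z s + r • η s) (Icc c d) s) ^ 2)
        (∫ s in c..d, fderiv ℝ (chartLagrangian F x) (z s, derivWithin z (Icc c d) s)
          (η s, derivWithin η (Icc c d) s)) 0 := by
  have hU := uniqueDiffOn_Icc hcd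
  set z' := derivWithin z (Icc c d) with hz'def
  set η' := derivWithin η (Icc c d) with hη'def
  have hz' : ContDiffOn ℝ ∞ z' (Icc c d) := hz.derivWithin hU (by simp)
  have hη' : ContDiffOn ℝ ∞ η' (Icc c d) := hη.derivWithin hU (by simp)
  set Y : ℝ × ℝ → EuclideanSpace ℝ (Fin n) × EuclideanSpace ℝ (Fin n) :=
    fun p => (z p.2 + p.1 • η p.2, z' p.2 + p.1 • η' p.2) with hYdef
  have hmaps : MapsTo (Prod.snd : ℝ × ℝ → ℝ) (univ ×ˢ Icc c d) (Icc c d) := fun p hp => hp.2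
  have hY : ContDiffOn ℝ ∞ Y (univ ×ˢ Icc c d) :=
    ((hz.comp contDiff_snd.contDiffOn hmaps).add
      (contDiff_fst.contDiffOn.smul (hη.comp contDiff_snd.contDiffOn hmaps))).prodMk
    ((hz'.comp contDiff_snd.contDiffOn hmaps).add
      (contDiff_fst.contDiffOn.smul (hη'.comp contDiff_snd.contDiffOn hmaps)))
  obtain ⟨ε, hε, -, hεU⟩ := exists_pos_forall_mem_of_continuousOn one_pos
    (hY.continuousOn.mono (prod_mono (subset_univ _) Subset.rfl)) (isOpen_chartDomain x)
    (fun s hs => by simpa [hYdef] using hdom s hs)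
  refine ⟨ε, hε, fun r hr s hs => (hεU r hr s hs).1, ?_⟩
  have hH : ContDiffOn ℝ 1 (Function.uncurry fun r s => chartLagrangian F x (Y (r, s)))
      (Ioo (-ε) ε ×ˢ Icc c d) :=
    ((hF.contDiffOn_chartLagrangian x).comp (hY.mono (prod_mono (subset_univ _) Subset.rfl))
      fun p hp => hεU p.1 hp.1 p.2 hp.2).of_le (by simp)
  have hD := hasDerivAt_integral_of_contDiffOn hε hcd hH
  have h0 : (0 : ℝ) ∈ Ioo (-ε) ε := by simpa using hε
  have e1 : ∫ s in c..d, deriv (fun r => chartLagrangian F x (Y (r, s))) 0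
      = ∫ s in c..d, fderiv ℝ (chartLagrangian F x) (z s, z' s) (η s, η' s) := by
    refine intervalIntegral.integral_congr fun s hs => ?_
    rw [uIcc_of_le hcd.le] at hs
    have h1 : HasDerivAt (fun r => Y (r, s)) (η s, η' s) 0 := by
      have k1 : HasDerivAt (fun r : ℝ => z s + r • η s) (η s) 0 := by
        simpa using ((hasDerivAt_id (0 : ℝ)).smul_const (η s)).const_add (z s)
      have k2 : HasDerivAt (fun r : ℝ => z' s + r • η' s) (η' s) 0 := by
        simpa using ((hasDerivAt_id (0 : ℝ)).smul_const (η' s)).const_add (z' s)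
      exact k1.prodMk k2
    have h2 : HasFDerivAt (chartLagrangian F x)
        (fderiv ℝ (chartLagrangian F x) (z s, z' s)) (Y (0, s)) := by
      simpa [hYdef] using hF.hasFDerivAt_chartLagrangian (hdom s hs)
    exact (h2.comp_hasDerivAt 0 h1).deriv
  rw [e1] at hD
  refine hD.congr_of_eventuallyEq ?_
  filter_upwards [isOpen_Ioo.mem_nhds h0] with r hr
  refine intervalIntegral.integral_congr fun s hs => ?_
  rw [uIcc_of_le hcd.le] at hs
  have hder : HasDerivWithinAt (fun s => z s + r • η s) (z' s + r • η' s) (Icc c d) s :=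
    ((hz.differentiableOn (by simp)) s hs).hasDerivWithinAt.add
      (((hη.differentiableOn (by simp)) s hs).hasDerivWithinAt.const_smul r)
  simp only [velocity_extChartAt_symm_comp x hder (hU s hs)
    (fun u hu => (hεU r hr u hu).1) hs]
  rfl

/-- A geodesic contained in a chart domain has no corner. -/
theorem contMDiffOn_of_isGeodesic_of_mem_source (hF : IsFinslerMetric F) {ρ : ℝ → M} {a m b : ℝ}
    (ham : a < m) (hmb : m < b) (h₁ : ContMDiffOn 𝓘(ℝ, ℝ) (𝓡 n) ∞ ρ (Icc a m))
    (h₂ : ContMDiffOn 𝓘(ℝ, ℝ) (𝓡 n) ∞ ρ (Icc m b))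
    (pos₁ : ∀ u ∈ Icc a m, 0 < F (velocity (𝓡 n) ρ (Icc a m) u))
    (pos₂ : ∀ u ∈ Icc m b, 0 < F (velocity (𝓡 n) ρ (Icc m b) u))
    (hgeo : IsGeodesic (𝓡 n) (fun p => F p ^ 2) a b ρ) (x : M)
    (hsrc : ∀ u ∈ Icc a b, ρ u ∈ (extChartAt (𝓡 n) x).source) :
    ContMDiffOn 𝓘(ℝ, ℝ) (𝓡 n) 1 ρ (Icc a b) := by
  set e := extChartAt (𝓡 n) x with he
  set z : ℝ → EuclideanSpace ℝ (Fin n) := fun u => e (ρ u) with hzdef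
  have hsrc' : ∀ u ∈ Icc a b, ρ u ∈ (chartAt (EuclideanSpace ℝ (Fin n)) x).source := by
    intro u hu
    rw [← extChartAt_source (𝓡 n)]; exact hsrc u hu
  have hzc : ∀ c d, Icc c d ⊆ Icc a b → ContMDiffOn 𝓘(ℝ, ℝ) (𝓡 n) ∞ ρ (Icc c d) →
      ContDiffOn ℝ ∞ z (Icc c d) := by
    intro c d hsub h
    rw [← contMDiffOn_iff_contDiffOn]
    exact (contMDiffOn_extChartAt (I := 𝓡 n) (n := ∞) (x := x)).comp h
      fun u hu => hsrc' u (hsub hu)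
  have hs₁ : Icc a m ⊆ Icc a b := Icc_subset_Icc_right hmb.le
  have hs₂ : Icc m b ⊆ Icc a b := Icc_subset_Icc_left ham.le
  have hz₁ := hzc a m hs₁ h₁
  have hz₂ := hzc m b hs₂ h₂
  have hρz : ∀ u ∈ Icc a b, ρ u = (e.symm ∘ z) u := fun u hu => (e.left_inv (hsrc u hu)).symm
  have htar : ∀ u ∈ Icc a b, z u ∈ e.target := fun u hu => e.map_source (hsrc u hu)
  have hdom : ∀ c d, c < d → Icc c d ⊆ Icc a b → ContDiffOn ℝ ∞ z (Icc c d) →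
      (∀ u ∈ Icc c d, 0 < F (velocity (𝓡 n) ρ (Icc c d) u)) →
      ∀ u ∈ Icc c d, (z u, derivWithin z (Icc c d) u) ∈ chartDomain n x := by
    intro c d hcd hsub hz hpos u hu
    refine ⟨htar u (hsub hu), fun h0 => ?_⟩
    have h0' : derivWithin z (Icc c d) u = 0 := h0
    have hv : velocity (𝓡 n) ρ (Icc c d) u = chartVector n x (z u, derivWithin z (Icc c d) u) := by
      rw [velocity_congr (I := 𝓡 n) (fun s hs => hρz s (hsub hs)) hu]
      exact velocity_extChartAt_symm_comp x
        ((hz.differentiableOn (by simp)) u hu).hasDerivWithinAt (uniqueDiffOn_Icc hcd u hu)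
        (fun s hs => htar s (hsub hs)) hu
    have := hpos u hu
    rw [hv, h0', chartVector_eq, ContinuousLinearMap.map_zero, hF.map_zero] at this
    exact lt_irrefl _ this
  have hd₁ := hdom a m ham hs₁ hz₁ pos₁
  have hd₂ := hdom m b hmb hs₂ hz₂ pos₂
  suffices hpq : derivWithin z (Icc a m) m = derivWithin z (Icc m b) m by
    have hz : ContDiffOn ℝ 1 z (Icc a b) :=
      ContDiffOn.Icc_union_of_derivWithin_eq ham hmb (hz₁.of_le (by simp)) (hz₂.of_le (by simp)) hpq
    exact (((contMDiffOn_extChartAt_symm (I := 𝓡 n) (n := 1) x).comp hz.contMDiffOn htar)).congr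
      hρz
  by_contra hpq
  have hmem₁ : m ∈ Icc a m := right_mem_Icc.2 ham.le
  have hmem₂ : m ∈ Icc m b := left_mem_Icc.2 hmb.le
  -- Weierstrass–Erdmann: if the velocity jumps by `w`, the momentum paired with `w` jumps strictly
  -- upwards. The numbers `α < β` are placed inside this gap.
  have hlt := hF.fderiv_chartLagrangian_lt (hd₁ m hmem₁) (hd₂ m hmem₂) hpq
  set w := derivWithin z (Icc m b) m - derivWithin z (Icc a m) m with hw
  obtain ⟨α, hα, hα'⟩ := exists_between hlt
  obtain ⟨β, hαβ, hβ⟩ := exists_between hα'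
  set Dl := fderiv ℝ (chartLagrangian F x) with hDl
  have hDlc : ContinuousOn Dl (chartDomain n x) :=
    (hF.contDiffOn_chartLagrangian x).continuousOn_fderiv_of_isOpen (isOpen_chartDomain x) (by simp)
  have hΓ : ∀ c d, c < d → ContDiffOn ℝ ∞ z (Icc c d) →
      (∀ u ∈ Icc c d, (z u, derivWithin z (Icc c d) u) ∈ chartDomain n x) →
      ContinuousOn (fun p : ℝ × ℝ => Dl (z p.2, derivWithin z (Icc c d) p.2) (p.1 • w, w))
        (Ioo (-1) 1 ×ˢ Icc c d) := by
    intro c d hcd hz hd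
    have hz' := hz.continuousOn_derivWithin (uniqueDiffOn_Icc hcd) (by simp)
    refine ContinuousOn.clm_apply (hDlc.comp (ContinuousOn.prodMk
      (hz.continuousOn.comp continuousOn_snd fun p hp => hp.2)
      (hz'.comp continuousOn_snd fun p hp => hp.2)) fun p hp => hd p.2 hp.2) ?_
    fun_prop
  -- Continuity carries the bounds by `α` and `β` to instants near `m`, and allows a small position
  -- component `t • w`, since the variation below also moves points.
  have hnear : ∀ c d, c < d → ContDiffOn ℝ ∞ z (Icc c d) → m ∈ Icc c d →
      (∀ u ∈ Icc c d, (z u, derivWithin z (Icc c d) u) ∈ chartDomain n x) →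
      ∀ U : Set ℝ, IsOpen U → Dl (z m, derivWithin z (Icc c d) m) (0, w) ∈ U →
      ∃ δ > 0, ∀ s ∈ Icc c d, |s - m| ≤ δ → ∀ t, |t| ≤ δ →
        Dl (z s, derivWithin z (Icc c d) s) (t • w, w) ∈ U := by
    intro c d hcd hz hm hd U hU hmU
    have h1 := (hΓ c d hcd hz hd) (0, m) ⟨by simp, hm⟩
    have h2 := h1.preimage_mem_nhdsWithin (t := U) (hU.mem_nhds (by simpa using hmU))
    obtain ⟨δ, hδ, hsub⟩ := Metric.mem_nhdsWithin_iff.1 h2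
    refine ⟨min (δ / 2) (1 / 2), by positivity, fun s hs hsm t ht => ?_⟩
    have hm1 := min_le_left (δ / 2) (1 / 2)
    have hm2 := min_le_right (δ / 2) (1 / 2)
    refine hsub (a := (t, s)) ⟨?_, ?_, hs⟩
    · rw [Metric.mem_ball, Prod.dist_eq, max_lt_iff, Real.dist_eq, Real.dist_eq, sub_zero]
      exact ⟨by linarith, by linarith⟩
    · have := abs_le.1 ht
      exact ⟨by linarith, by linarith⟩
  obtain ⟨δ₁, hδ₁, H₁⟩ := hnear a m ham hz₁ hmem₁ hd₁ (Iio α) isOpen_Iio hα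
  obtain ⟨δ₂, hδ₂, H₂⟩ := hnear m b hmb hz₂ hmem₂ hd₂ (Ioi β) isOpen_Ioi hβ
  obtain ⟨δ, hδ, hδ1, hδ2, hδa, hδb⟩ : ∃ δ > 0, δ ≤ δ₁ ∧ δ ≤ δ₂ ∧ δ ≤ m - a ∧ δ ≤ b - m := by
    refine ⟨min (min δ₁ δ₂) (min (m - a) (b - m)), ?_, ?_, ?_, ?_, ?_⟩
    · exact lt_min (lt_min hδ₁ hδ₂) (lt_min (by linarith) (by linarith))
    · exact (min_le_left _ _).trans (min_le_left _ _)
    · exact (min_le_left _ _).trans (min_le_right _ _)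
    · exact (min_le_right _ _).trans (min_le_left _ _)
    · exact (min_le_right _ _).trans (min_le_right _ _)
  set c := m - δ with hc
  set d := m + δ with hd
  have hac : a ≤ c := by linarith
  have hcm : c < m := by linarith
  have hmd : m < d := by linarith
  have hdb : d ≤ b := by linarith
  have hsub₁ : Icc c m ⊆ Icc a m := Icc_subset_Icc_left hac
  have hsub₂ : Icc m d ⊆ Icc m b := Icc_subset_Icc_right hdb
  have hdw₁ : ∀ s ∈ Icc c m, derivWithin z (Icc c m) s = derivWithin z (Icc a m) s := fun s hs =>
    derivWithin_subset hsub₁ (uniqueDiffOn_Icc hcm s hs) ((hz₁.differentiableOn (by simp)) s (hsub₁ hs))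
  have hdw₂ : ∀ s ∈ Icc m d, derivWithin z (Icc m d) s = derivWithin z (Icc m b) s := fun s hs =>
    derivWithin_subset hsub₂ (uniqueDiffOn_Icc hmd s hs) ((hz₂.differentiableOn (by simp)) s (hsub₂ hs))
  set η₁ : ℝ → EuclideanSpace ℝ (Fin n) := fun s => (s - c) • w with hη₁
  set η₂ : ℝ → EuclideanSpace ℝ (Fin n) := fun s => (d - s) • w with hη₂
  have hη₁c : ContDiff ℝ ∞ η₁ := by fun_prop
  have hη₂c : ContDiff ℝ ∞ η₂ := by fun_prop
  have hη₁' : ∀ s ∈ Icc c m, derivWithin η₁ (Icc c m) s = w := by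
    intro s hs
    have h : HasDerivAt η₁ ((1 : ℝ) • w) s := ((hasDerivAt_id s).sub_const c).smul_const w
    rw [h.hasDerivWithinAt.derivWithin (uniqueDiffOn_Icc hcm s hs), one_smul]
  have hη₂' : ∀ s ∈ Icc m d, derivWithin η₂ (Icc m d) s = -w := by
    intro s hs
    have h : HasDerivAt η₂ ((-1 : ℝ) • w) s := ((hasDerivAt_id s).const_sub d).smul_const w
    rw [h.hasDerivWithinAt.derivWithin (uniqueDiffOn_Icc hmd s hs), neg_one_smul]
  obtain ⟨ε₁, hε₁, htar₁, hder₁⟩ := hF.hasDerivAt_integral_chart_variation x hcm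
    (hz₁.mono hsub₁) (fun s hs => by rw [hdw₁ s hs]; exact hd₁ s (hsub₁ hs)) hη₁c.contDiffOn
  obtain ⟨ε₂, hε₂, htar₂, hder₂⟩ := hF.hasDerivAt_integral_chart_variation x hmd
    (hz₂.mono hsub₂) (fun s hs => by rw [hdw₂ s hs]; exact hd₂ s (hsub₂ hs)) hη₂c.contDiffOn
  -- A tent with vertex at the corner: its derivative is `w` before `m` and `-w` after, so the
  -- variation cuts the corner and lowers the energy to first order.
  set η : ℝ → EuclideanSpace ℝ (Fin n) := fun s => (δ - |s - m|) • w with hη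
  have hηη₁ : ∀ s ∈ Icc c m, η s = η₁ s := by
    intro s hs
    simp only [hη, hη₁]
    rw [abs_of_nonpos (by linarith [hs.2])]
    congr 1; rw [hc]; ring
  have hηη₂ : ∀ s ∈ Icc m d, η s = η₂ s := by
    intro s hs
    simp only [hη, hη₂]
    rw [abs_of_nonneg (by linarith [hs.1])]
    congr 1; rw [hd]; ring
  set ψ : ℝ → ℝ → M := fun r => e.symm ∘ fun s => z s + r • η s with hψ
  have hψ₁ : ∀ r, ∀ s ∈ Icc c m, ψ r s = (e.symm ∘ fun s => z s + r • η₁ s) s := by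
    intro r s hs; simp only [hψ, Function.comp_apply, hηη₁ s hs]
  have hψ₂ : ∀ r, ∀ s ∈ Icc m d, ψ r s = (e.symm ∘ fun s => z s + r • η₂ s) s := by
    intro r s hs; simp only [hψ, Function.comp_apply, hηη₂ s hs]
  have hsm : ∀ p q ε (κ : ℝ → EuclideanSpace ℝ (Fin n)), ContDiffOn ℝ ∞ z (Icc p q) →
      ContDiff ℝ ∞ κ → (∀ r ∈ Ioo (-ε) ε, ∀ s ∈ Icc p q, z s + r • κ s ∈ e.target) →
      ContMDiffOn 𝓘(ℝ, ℝ × ℝ) (𝓡 n) ∞ (fun p : ℝ × ℝ => e.symm (z p.2 + p.1 • κ p.2))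
        (Ioo (-ε) ε ×ˢ Icc p q) := by
    intro p q ε κ hz hκ ht
    have h1 : ContDiffOn ℝ ∞ (fun p : ℝ × ℝ => z p.2 + p.1 • κ p.2) (Ioo (-ε) ε ×ˢ Icc p q) :=
      (hz.comp contDiff_snd.contDiffOn fun x hx => hx.2).add
        (contDiff_fst.contDiffOn.smul (hκ.comp contDiff_snd).contDiffOn)
    exact (contMDiffOn_extChartAt_symm (I := 𝓡 n) (n := ∞) x).comp h1.contMDiffOn
      fun p hp => ht p.1 hp.1 p.2 hp.2
  set ε := min ε₁ ε₂ with hεdef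
  have hε : 0 < ε := lt_min hε₁ hε₂
  have hI₁ : Ioo (-ε) ε ⊆ Ioo (-ε₁) ε₁ :=
    Ioo_subset_Ioo (neg_le_neg (min_le_left _ _)) (min_le_left _ _)
  have hI₂ : Ioo (-ε) ε ⊆ Ioo (-ε₂) ε₂ :=
    Ioo_subset_Ioo (neg_le_neg (min_le_right _ _)) (min_le_right _ _)
  have hvar : IsProperVariation (𝓡 n) c d ρ ε ψ := by
    refine isProperVariation_of_piecewise (hcm.trans hmd) hε
      ((Piecewise.piece hcm ?_).trans (Piecewise.piece hmd ?_)) ?_ ?_ ?_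
    · exact ((hsm c m ε₁ η₁ (hz₁.mono hsub₁) hη₁c htar₁).mono (prod_mono hI₁ Subset.rfl)).congr
        fun p hp => hψ₁ p.1 p.2 hp.2
    · exact ((hsm m d ε₂ η₂ (hz₂.mono hsub₂) hη₂c htar₂).mono (prod_mono hI₂ Subset.rfl)).congr
        fun p hp => hψ₂ p.1 p.2 hp.2
    · intro s hs
      rw [hρz s ⟨hac.trans hs.1, hs.2.trans hdb⟩]
      simp [hψ]
    · intro r _
      rw [hψ₁ r c (left_mem_Icc.2 hcm.le), hρz c ⟨hac, by linarith⟩]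
      simp [hη₁]
    · intro r _
      rw [hψ₂ r d (right_mem_Icc.2 hmd.le), hρz d ⟨by linarith, hdb⟩]
      simp [hη₂]
  have hcrit := (hgeo.restrict hF.continuous_sq hac (hcm.trans hmd) hdb).2 ε ψ hvar
  have hsum := (hder₁.add hder₂).const_mul (1 / 2)
  have heq := hcrit.unique (hsum.congr_of_eventuallyEq (by
    filter_upwards [Ioo_mem_nhds (neg_lt_zero.2 hε) hε] with r hr
    have hint := intervalIntegrable_velocity hF.continuous_sq (w := fun _ => 1) continuousOn_const
      (hvar.piecewise_slice hr)
    simp only [one_mul] at hint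
    have sub : ∀ x y, c ≤ x → x ≤ y → y ≤ d → IntervalIntegrable
        (fun s => F (velocity (𝓡 n) (ψ r) (Icc c d) s) ^ 2) volume x y :=
      fun x y hx hxy hy => hint.mono_set (by
        rw [uIcc_of_le hxy, uIcc_of_le (hcm.trans hmd).le]; exact Icc_subset_Icc hx hy)
    unfold energy
    rw [← intervalIntegral.integral_add_adjacent_intervals (sub c m le_rfl hcm.le hmd.le)
      (sub m d hcm.le hmd.le le_rfl)]
    congr 2
    · refine intervalIntegral.integral_congr_Ioo_of_le hcm.le fun s hs => ?_
      simp only [velocity_Icc_of_mem_Ioo (ψ r) le_rfl hmd.le hs,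
        velocity_congr (I := 𝓡 n) (hψ₁ r) (Ioo_subset_Icc_self hs)]
      rfl
    · refine intervalIntegral.integral_congr_Ioo_of_le hmd.le fun s hs => ?_
      simp only [velocity_Icc_of_mem_Ioo (ψ r) hcm.le le_rfl hs,
        velocity_congr (I := 𝓡 n) (hψ₂ r) (Ioo_subset_Icc_self hs)]
      rfl))
  have hcont : ∀ p q (κ κ' : ℝ → EuclideanSpace ℝ (Fin n)) (z' : ℝ → EuclideanSpace ℝ (Fin n)),
      ContinuousOn z (Icc p q) → ContinuousOn z' (Icc p q) → ContinuousOn κ (Icc p q) →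
      ContinuousOn κ' (Icc p q) → (∀ s ∈ Icc p q, (z s, z' s) ∈ chartDomain n x) →
      ContinuousOn (fun s => Dl (z s, z' s) (κ s, κ' s)) (Icc p q) := by
    intro p q κ κ' z' hz hz' hκ hκ' hdm
    exact (hDlc.comp (hz.prodMk hz') hdm).clm_apply (hκ.prodMk hκ')
  have b₁ : ∫ s in c..m, Dl (z s, derivWithin z (Icc c m) s) (η₁ s, derivWithin η₁ (Icc c m) s)
      ≤ α * δ := by
    calc _ ≤ ∫ s in c..m, α := by
          refine intervalIntegral.integral_mono_on hcm.le ?_ intervalIntegrable_const ?_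
          · refine (hcont c m _ _ _ (hz₁.continuousOn.mono hsub₁) ?_ hη₁c.continuous.continuousOn ?_
              fun s hs => ?_).intervalIntegrable_of_Icc hcm.le
            · exact (hz₁.mono hsub₁).continuousOn_derivWithin (uniqueDiffOn_Icc hcm) (by simp)
            · exact continuousOn_const.congr hη₁'
            · rw [hdw₁ s hs]; exact hd₁ s (hsub₁ hs)
          · intro s hs
            rw [hη₁' s hs, hdw₁ s hs]
            refine le_of_lt (H₁ s (hsub₁ hs) ?_ (s - c) ?_)
            · rw [abs_le]; constructor <;> linarith [hs.1, hs.2]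
            · rw [abs_le]; constructor <;> linarith [hs.1, hs.2]
      _ = α * δ := by
          rw [intervalIntegral.integral_const, smul_eq_mul, hc]; ring
  have b₂ : ∫ s in m..d, Dl (z s, derivWithin z (Icc m d) s) (η₂ s, derivWithin η₂ (Icc m d) s)
      ≤ -β * δ := by
    calc _ ≤ ∫ s in m..d, -β := by
          refine intervalIntegral.integral_mono_on hmd.le ?_ intervalIntegrable_const ?_
          · refine (hcont m d _ _ _ (hz₂.continuousOn.mono hsub₂) ?_ hη₂c.continuous.continuousOn ?_
              fun s hs => ?_).intervalIntegrable_of_Icc hmd.le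
            · exact (hz₂.mono hsub₂).continuousOn_derivWithin (uniqueDiffOn_Icc hmd) (by simp)
            · exact continuousOn_const.congr hη₂'
            · rw [hdw₂ s hs]; exact hd₂ s (hsub₂ hs)
          · intro s hs
            rw [hη₂' s hs, hdw₂ s hs]
            -- The value `t = -(d - s)` makes the direction here the negative of `(η₂ s, -w)`.
            have h1 : β < Dl (z s, derivWithin z (Icc m b) s) ((-(d - s)) • w, w) := by
              refine H₂ s (hsub₂ hs) ?_ (-(d - s)) ?_
              · rw [abs_le]; constructor <;> linarith [hs.1, hs.2]
              · rw [abs_le]; constructor <;> linarith [hs.1, hs.2]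
            have h2 : (η₂ s, -w) = -((-(d - s)) • w, w) := by
              rw [Prod.neg_mk, neg_smul, neg_neg]
            rw [h2, map_neg]
            linarith
      _ = -β * δ := by
          rw [intervalIntegral.integral_const, smul_eq_mul, hd]; ring
  have : (α - β) * δ < 0 := mul_neg_of_neg_of_pos (by linarith) hδ
  linarith

/-- Piecewise smooth geodesics of a Finsler metric with nowhere vanishing one-sided velocities
are continuously differentiable. -/
theorem contMDiffOn_of_isGeodesic (hF : IsFinslerMetric F) {ρ : ℝ → M} {a b : ℝ} (hab : a < b)
    (h : Piecewise (fun c d => ContMDiffOn 𝓘(ℝ, ℝ) (𝓡 n) ∞ ρ (Icc c d) ∧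
      ∀ u ∈ Icc c d, 0 < F (velocity (𝓡 n) ρ (Icc c d) u)) a b)
    (hgeo : IsGeodesic (𝓡 n) (fun p => F p ^ 2) a b ρ) :
    ContMDiffOn 𝓘(ℝ, ℝ) (𝓡 n) 1 ρ (Icc a b) := by
  have hQ := hereditary_regular F ρ
  intro m hm
  rcases hm.1.eq_or_lt with rfl | ham
  · obtain ⟨d, hd, hs⟩ := h.exists_right hQ ⟨le_rfl, hab⟩
    refine ((hs.1 a (left_mem_Icc.2 hd.1.le)).of_le (by simp)).mono_of_mem_nhdsWithin ?_
    exact mem_nhdsWithin.2 ⟨Iio d, isOpen_Iio, hd.1, fun x hx => ⟨hx.2.1, (mem_Iio.1 hx.1).le⟩⟩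
  rcases hm.2.eq_or_lt with rfl | hmb
  · obtain ⟨c, hc, hs⟩ := h.exists_left hQ ⟨hab, le_rfl⟩
    refine ((hs.1 m (right_mem_Icc.2 hc.2.le)).of_le (by simp)).mono_of_mem_nhdsWithin ?_
    exact mem_nhdsWithin.2 ⟨Ioi c, isOpen_Ioi, hc.2, fun x hx => ⟨(mem_Ioi.1 hx.1).le, hx.2.2⟩⟩
  obtain ⟨c, hc, hsc⟩ := h.exists_left hQ ⟨ham, hmb.le⟩
  obtain ⟨d, hd, hsd⟩ := h.exists_right hQ ⟨ham.le, hmb⟩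
  have hopen : (extChartAt (𝓡 n) (ρ m)).source ∈ nhds (ρ m) := extChartAt_source_mem_nhds (ρ m)
  have hcont := hgeo.1.1.continuousAt (Icc_mem_nhds ham hmb)
  obtain ⟨δ, hδ, hball⟩ := Metric.mem_nhds_iff.1 (hcont.preimage_mem_nhds hopen)
  -- The two pieces adjacent to `m` are shrunk until their image lies in a single chart domain.
  set p := max c (m - δ / 2) with hp
  set q := min d (m + δ / 2) with hq
  have hcp : c ≤ p := le_max_left _ _
  have hqd : q ≤ d := min_le_left _ _
  have hpm : p < m := max_lt hc.2 (by linarith)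
  have hmq : m < q := lt_min hd.1 (by linarith)
  have h₁ := hQ hcp hpm le_rfl hsc
  have h₂ := hQ le_rfl hmq hqd hsd
  have hpq := hF.contMDiffOn_of_isGeodesic_of_mem_source hpm hmq h₁.1 h₂.1 h₁.2 h₂.2
    (hgeo.restrict hF.continuous_sq (hc.1.trans hcp) (hpm.trans hmq) (hqd.trans hd.2)) (ρ m)
    fun u hu => hball (by
      have h1 : m - δ / 2 ≤ u := (le_max_right _ _).trans hu.1
      have h2 : u ≤ m + δ / 2 := hu.2.trans (min_le_right _ _)
      rw [Metric.mem_ball, Real.dist_eq, abs_lt]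
      constructor <;> linarith)
  exact (hpq m ⟨hpm.le, hmq.le⟩).mono_of_mem_nhdsWithin
    (mem_nhdsWithin_of_mem_nhds (Icc_mem_nhds hpm hmq))

end IsFinslerMetric

end NoCorner

/-! ### Lightlike vectors and the optical metric -/

section StaticSpacetime

variable {n : ℕ} {M : Type*} [TopologicalSpace M] [ChartedSpace (EuclideanSpace ℝ (Fin n)) M]

theorem opticalMetric_sq (F : TangentBundle (𝓡 n) M → ℝ) {Λ : M → ℝ} (hΛpos : ∀ x, 0 < Λ x)
    (p : TangentBundle (𝓡 n) M) : opticalMetric F Λ p ^ 2 = (Λ p.1)⁻¹ * F p ^ 2 := by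
  rw [opticalMetric, div_pow, Real.sq_sqrt (hΛpos _).le, div_eq_inv_mul]

theorem mul_opticalMetric_sq (F : TangentBundle (𝓡 n) M → ℝ) {Λ : M → ℝ} (hΛpos : ∀ x, 0 < Λ x)
    (p : TangentBundle (𝓡 n) M) : Λ p.1 * opticalMetric F Λ p ^ 2 = F p ^ 2 := by
  rw [opticalMetric_sq F hΛpos, mul_inv_cancel_left₀ (hΛpos _).ne']

/-- The tangent vector `(t, v)` of `ℝ × M` at `q`. -/
def spacetimeVector (q : ℝ × M) (t : ℝ) (v : TangentSpace (𝓡 n) q.2) :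
    TangentSpace (spacetimeModel n) q :=
  (show ℝ × EuclideanSpace ℝ (Fin n) from (t, v))

theorem staticL_spacetimeVector (F : TangentBundle (𝓡 n) M → ℝ) (Λ : M → ℝ) (q : ℝ × M) (t : ℝ)
    (v : TangentSpace (𝓡 n) q.2) :
    staticL F Λ ⟨q, spacetimeVector q t v⟩ = -Λ q.2 * t ^ 2 + F ⟨q.2, v⟩ ^ 2 := rfl

theorem smul_spacetimeVector (q : ℝ × M) (c t : ℝ) (v : TangentSpace (𝓡 n) q.2) :
    c • spacetimeVector q t v = spacetimeVector q (c * t) (c • v) := rfl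

theorem add_spacetimeVector (q : ℝ × M) (t t' : ℝ) (v v' : TangentSpace (𝓡 n) q.2) :
    spacetimeVector q t v + spacetimeVector q t' v' = spacetimeVector q (t + t') (v + v') := rfl

theorem timeVector_eq (q : ℝ × M) :
    (timeVector q : TangentSpace (spacetimeModel n) q) = spacetimeVector q 1 0 := rfl

theorem spacetimeVector_inj {q : ℝ × M} {t t' : ℝ} {v v' : TangentSpace (𝓡 n) q.2} :
    spacetimeVector q t v = spacetimeVector q t' v' ↔ t = t' ∧ v = v' :=
  Prod.mk_inj (α := ℝ) (β := EuclideanSpace ℝ (Fin n))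

theorem velocity_prodMk {θ : ℝ → ℝ} {σ : ℝ → M}
    {S : Set ℝ} {s : ℝ} (hS : UniqueDiffWithinAt ℝ S s) (hθ : DifferentiableWithinAt ℝ θ S s)
    (hσ : MDifferentiableWithinAt 𝓘(ℝ, ℝ) (𝓡 n) σ S s) :
    velocity (spacetimeModel n) (fun s => (θ s, σ s)) S s =
      ⟨(θ s, σ s), spacetimeVector (θ s, σ s) (derivWithin θ S s)
        (mfderivWithin 𝓘(ℝ, ℝ) (𝓡 n) σ S s (1 : ℝ))⟩ := by
  unfold velocity
  rw [mfderivWithin_prodMk hθ.mdifferentiableWithinAt hσ hS.uniqueMDiffWithinAt]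
  congr 1
  rw [mfderivWithin_eq_fderivWithin]
  rfl

theorem staticL_velocity (F : TangentBundle (𝓡 n) M → ℝ) (Λ : M → ℝ) {θ : ℝ → ℝ} {σ : ℝ → M}
    {S : Set ℝ} {s : ℝ} (hS : UniqueDiffWithinAt ℝ S s) (hθ : DifferentiableWithinAt ℝ θ S s)
    (hσ : MDifferentiableWithinAt 𝓘(ℝ, ℝ) (𝓡 n) σ S s) :
    staticL F Λ (velocity (spacetimeModel n) (fun s => (θ s, σ s)) S s) =
      -Λ (σ s) * derivWithin θ S s ^ 2 + F (velocity (𝓡 n) σ S s) ^ 2 := by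
  rw [velocity_prodMk hS hθ hσ]
  rfl

/-- Moving in the direction `∂_t` leaves the space component fixed, so the inner derivative sees
only `-Λτ²`; no smoothness of `F` is involved. -/
theorem fundTensor_staticL_timeVector (F : TangentBundle (𝓡 n) M → ℝ) (Λ : M → ℝ) (q : ℝ × M)
    (t : ℝ) (v : TangentSpace (𝓡 n) q.2) :
    fundTensor (spacetimeModel n) (staticL F Λ) q (spacetimeVector q t v)
      (spacetimeVector q t v) (timeVector q) = -Λ q.2 * t := by
  unfold fundTensor
  have h1 : ∀ r : ℝ, HasDerivAt (fun s : ℝ => -Λ q.2 * ((t + r * t) + s * 1) ^ 2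
      + F ⟨q.2, v + r • v + s • (0 : TangentSpace (𝓡 n) q.2)⟩ ^ 2)
      (-Λ q.2 * (2 * (t + r * t))) 0 := by
    intro r
    have := (((((hasDerivAt_id (0 : ℝ)).mul_const 1).const_add (t + r * t)).pow 2).const_mul
      (-Λ q.2)).add_const (F ⟨q.2, v + r • v⟩ ^ 2)
    simpa using this
  have h2 : HasDerivAt (fun r : ℝ => -Λ q.2 * (2 * (t + r * t))) (-Λ q.2 * (2 * t)) 0 := by
    have := ((((hasDerivAt_id (0 : ℝ)).mul_const t).const_add t).const_mul 2).const_mul (-Λ q.2)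
    simpa using this
  simp only [timeVector_eq, smul_spacetimeVector, add_spacetimeVector, staticL_spacetimeVector,
    fun r => (h1 r).deriv, h2.deriv]
  ring

variable [IsManifold (𝓡 n) ∞ M] {F : TangentBundle (𝓡 n) M → ℝ} {Λ : M → ℝ}

/-- On each fibre the optical metric is a positive multiple of `F`, with a factor smooth on `M`; so
all results on Finsler metrics apply to it. -/
theorem IsFinslerMetric.opticalMetric (hF : IsFinslerMetric F)
    (hΛ : ContMDiff (𝓡 n) 𝓘(ℝ, ℝ) ∞ Λ) (hΛpos : ∀ x, 0 < Λ x) :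
    IsFinslerMetric (opticalMetric F Λ) where
  continuous := hF.continuous.div
    (Real.continuous_sqrt.comp (hΛ.continuous.comp (FiberBundle.continuous_proj _ _)))
    fun p => (Real.sqrt_pos.2 (hΛpos p.1)).ne'
  smooth := by
    have h1 : ContMDiff (𝓡 n) 𝓘(ℝ, ℝ) ∞ fun x => (√(Λ x))⁻¹ := by
      intro x
      have h2 : ContDiffAt ℝ ∞ (fun y : ℝ => (√y)⁻¹) (Λ x) :=
        (Real.contDiffAt_sqrt (hΛpos x).ne').inv (Real.sqrt_pos.2 (hΛpos x)).ne'
      exact h2.contMDiffAt.comp x (hΛ x)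
    have h3 : ContMDiff (𝓡 n).tangent 𝓘(ℝ, ℝ) ∞
        fun p : TangentBundle (𝓡 n) M => (√(Λ p.1))⁻¹ :=
      h1.comp (Bundle.contMDiff_proj _)
    exact hF.smooth.mul h3.contMDiffOn
  homogeneous x v c hc := by
    rw [_root_.opticalMetric, _root_.opticalMetric, hF.homogeneous x v c hc, mul_div_assoc]
  pos x v hv := div_pos (hF.pos x v hv) (Real.sqrt_pos.2 (hΛpos x))
  posDef x v u hv hu := by
    have h := hF.posDef x v u hv hu
    have hinv := inv_pos.2 (hΛpos x)
    unfold fundTensor at h ⊢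
    simp only [opticalMetric_sq F hΛpos, deriv_const_mul_field]
    nlinarith

theorem staticL_smul (hF : IsFinslerMetric F) (q : ℝ × M)
    (w : TangentSpace (spacetimeModel n) q) {c : ℝ} (hc : 0 < c) :
    staticL F Λ ⟨q, c • w⟩ = c ^ 2 * staticL F Λ ⟨q, w⟩ := by
  obtain ⟨t, v, rfl⟩ : ∃ t v, w = spacetimeVector q t v := ⟨w.1, w.2, rfl⟩
  rw [smul_spacetimeVector, staticL_spacetimeVector, staticL_spacetimeVector, hF.homogeneous _ _ _ hc]
  ring

/-- Homogeneity alone suffices: `L((1 + r + s)w) = (1 + r + s)² L(w)` for small `r` and `s`. No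
differentiability of `L` at `w` is needed. -/
theorem fundTensor_staticL_self (hF : IsFinslerMetric F) (q : ℝ × M)
    (w : TangentSpace (spacetimeModel n) q) :
    fundTensor (spacetimeModel n) (staticL F Λ) q w w w = staticL F Λ ⟨q, w⟩ := by
  unfold fundTensor
  have h1 : ∀ᶠ r in nhds (0 : ℝ),
      deriv (fun s : ℝ => staticL F Λ ⟨q, w + r • w + s • w⟩) 0
        = 2 * (1 + r) * staticL F Λ ⟨q, w⟩ := by
    filter_upwards [Ioi_mem_nhds (show (-1 : ℝ) < 0 by norm_num)] with r hr
    have hd : HasDerivAt (fun s : ℝ => (1 + r + s) ^ 2 * staticL F Λ ⟨q, w⟩)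
        (2 * (1 + r) * staticL F Λ ⟨q, w⟩) 0 := by
      have := (((hasDerivAt_id (0 : ℝ)).const_add (1 + r)).pow 2).mul_const (staticL F Λ ⟨q, w⟩)
      convert! this using 1
      simp
    refine (hd.congr_of_eventuallyEq ?_).deriv
    have hr' : -(1 + r) < 0 := by linarith [mem_Ioi.1 hr]
    filter_upwards [Ioi_mem_nhds hr'] with s hs
    have hs' : 0 < 1 + r + s := by linarith [mem_Ioi.1 hs]
    rw [← staticL_smul hF q w hs']
    congr 2
    rw [add_smul, add_smul, one_smul]
  have h2 : HasDerivAt (fun r : ℝ => 2 * (1 + r) * staticL F Λ ⟨q, w⟩)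
      (2 * staticL F Λ ⟨q, w⟩) 0 := by
    have := (((hasDerivAt_id (0 : ℝ)).const_add 1).const_mul 2).mul_const (staticL F Λ ⟨q, w⟩)
    simpa using this
  rw [(h2.congr_of_eventuallyEq h1).deriv]
  ring

/-- Future-pointing lightlike vectors are the graph of the optical metric off the zero section. -/
theorem isLightlike_and_isFuturePointing_iff (hF : IsFinslerMetric F) (hΛpos : ∀ x, 0 < Λ x)
    (q : ℝ × M) (t : ℝ) (v : TangentSpace (𝓡 n) q.2) :
    (IsLightlike F Λ ⟨q, spacetimeVector q t v⟩ ∧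
      IsFuturePointing F Λ ⟨q, spacetimeVector q t v⟩) ↔
      0 < F ⟨q.2, v⟩ ∧ t = opticalMetric F Λ ⟨q.2, v⟩ := by
  have htime : (⟨q, spacetimeVector q t v⟩ :
      TangentBundle (spacetimeModel n) (ℝ × M)) ∈ timeLine ↔ v = 0 := by
    have h : ∀ c : ℝ, c • timeVector q = spacetimeVector q c (0 : TangentSpace (𝓡 n) q.2) := by
      intro c
      rw [timeVector_eq, smul_spacetimeVector, mul_one, smul_zero]
    constructor
    · rintro ⟨c, hc⟩
      exact (spacetimeVector_inj.1 (hc.trans (h c))).2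
    · rintro rfl
      exact ⟨t, (h t).symm⟩
  have hpos : 0 < F ⟨q.2, v⟩ ↔ ¬ v = 0 := hF.pos_iff
  have hself := fundTensor_staticL_self (Λ := Λ) hF q (spacetimeVector q t v)
  have hT := fundTensor_staticL_timeVector F Λ q t v
  have hL : staticL F Λ ⟨q, spacetimeVector q t v⟩
      = -Λ q.2 * t ^ 2 + F ⟨q.2, v⟩ ^ 2 := rfl
  have hO : Λ q.2 * opticalMetric F Λ ⟨q.2, v⟩ ^ 2 = F ⟨q.2, v⟩ ^ 2 :=
    mul_opticalMetric_sq F hΛpos ⟨q.2, v⟩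
  have hO0 : 0 ≤ opticalMetric F Λ ⟨q.2, v⟩ := div_nonneg (hF.nonneg _) (Real.sqrt_nonneg _)
  have hΛq := hΛpos q.2
  rw [hpos]
  constructor
  · rintro ⟨⟨hw, hl⟩, hf⟩
    have hv : ¬ v = 0 := fun h => hw (htime.2 h)
    refine ⟨hv, ?_⟩
    have hl' : -Λ q.2 * t ^ 2 + F ⟨q.2, v⟩ ^ 2 = 0 := by rw [← hL, ← hself]; exact hl
    -- Vanishing of `L` only gives `Λt² = F²`; the future condition selects the positive root.
    have ht : 0 < t := by
      rcases hf with ⟨c, -, hc⟩ | ⟨-, -, hf⟩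
      · exact absurd ⟨c, hc⟩ hw
      · have hf' : -Λ q.2 * t < 0 := by rw [← hT]; exact hf
        nlinarith
    refine (pow_left_inj₀ ht.le hO0 two_ne_zero).1 ?_
    exact mul_left_cancel₀ hΛq.ne' (by linarith)
  · rintro ⟨hv, ht⟩
    have hOpos : 0 < opticalMetric F Λ ⟨q.2, v⟩ :=
      div_pos (hpos.2 hv) (Real.sqrt_pos.2 hΛq)
    have hl : fundTensor (spacetimeModel n) (staticL F Λ) q
        (spacetimeVector q t v)
        (spacetimeVector q t v)
        (spacetimeVector q t v) = 0 := by
      refine hself.trans (hL.trans ?_)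
      rw [ht]
      linarith
    have hw := fun h => hv (htime.1 h)
    refine ⟨⟨hw, hl⟩, Or.inr ⟨hw, hl.le, ?_⟩⟩
    refine hT.trans_lt ?_
    rw [ht]
    nlinarith [mul_pos hΛq hOpos]

end StaticSpacetime

/-! ### First variation: spacetime energy against weighted optical energy -/

theorem Piecewise.intervalIntegrable_derivWithin {f : ℝ → ℝ} {a b : ℝ}
    (h : Piecewise (fun c d => ContDiffOn ℝ ∞ f (Icc c d)) a b) :
    IntervalIntegrable (derivWithin f (Icc a b)) volume a b := by
  refine Piecewise.intervalIntegrable (h.mono fun c d hc hcd hd hf => ?_)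
  refine ⟨derivWithin f (Icc c d), hf.continuousOn_derivWithin (uniqueDiffOn_Icc hcd) (by simp),
    fun s hs => ?_⟩
  rw [derivWithin_of_mem_nhds (Icc_mem_nhds hs.1 hs.2),
    derivWithin_of_mem_nhds (Icc_mem_nhds (hc.trans_lt hs.1) (hs.2.trans_le hd))]

/-- This makes `2kτ'` a null Lagrangian: across break points too, its integral depends only on the
end values, which a proper variation fixes. -/
theorem Piecewise.integral_derivWithin {f : ℝ → ℝ} {a b : ℝ} (hab : a < b)
    (h : Piecewise (fun c d => ContDiffOn ℝ ∞ f (Icc c d)) a b) :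
    ∫ s in a..b, derivWithin f (Icc a b) s = f b - f a := by
  have hint := h.intervalIntegrable_derivWithin
  have sub : ∀ x y, a ≤ x → x ≤ y → y ≤ b →
      IntervalIntegrable (derivWithin f (Icc a b)) volume x y :=
    fun x y hx hxy hy => hint.mono_set (by
      rw [uIcc_of_le hxy, uIcc_of_le hab.le]; exact Icc_subset_Icc hx hy)
  refine h.induction_of_lt
    (P := fun c d => ∫ s in c..d, derivWithin f (Icc a b) s = f d - f c) hab ?_ ?_
  · intro c d hc hcd hd hf
    refine intervalIntegral.integral_eq_sub_of_hasDerivAt_of_le hcd.le hf.continuousOn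
      (fun s hs => ?_) (sub c d hc hcd.le hd)
    have h1 := Icc_mem_nhds hs.1 hs.2
    have h2 := Icc_mem_nhds (hc.trans_lt hs.1) (hs.2.trans_le hd)
    rw [derivWithin_of_mem_nhds h2]
    exact (((hf.differentiableOn (by simp)) s (Ioo_subset_Icc_self hs)).differentiableAt
      h1).hasDerivAt
  · intro c m d hc hcm hmd hd h1 h2
    rw [← intervalIntegral.integral_add_adjacent_intervals (sub c m hc hcm.le (hmd.le.trans hd))
      (sub m d (hc.trans hcm.le) hmd.le hd), h1, h2]
    ring

theorem contDiffOn_derivWithin_uncurry {τ : ℝ → ℝ → ℝ} {ε c d : ℝ} (hcd : c < d)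
    (hτ : ContDiffOn ℝ ∞ (Function.uncurry τ) (Ioo (-ε) ε ×ˢ Icc c d)) :
    ContDiffOn ℝ ∞ (fun p : ℝ × ℝ => derivWithin (τ p.1) (Icc c d) p.2)
      (Ioo (-ε) ε ×ˢ Icc c d) := by
  have hU : UniqueDiffOn ℝ (Ioo (-ε) ε ×ˢ Icc c d) :=
    (uniqueDiffOn_Ioo _ _).prod (uniqueDiffOn_Icc hcd)
  refine ((hτ.fderivWithin hU (m := ∞) le_rfl).clm_apply
    (contDiffOn_const (c := ((0 : ℝ), (1 : ℝ))))).congr fun p hp => ?_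
  have h1 := ((hτ.differentiableOn (by simp)) p hp).hasFDerivWithinAt
  have h2 : HasDerivWithinAt (fun s : ℝ => (p.1, s)) ((0 : ℝ), (1 : ℝ)) (Icc c d) p.2 :=
    (hasDerivWithinAt_const p.2 _ p.1).prodMk (hasDerivWithinAt_id p.2 _)
  exact (h1.comp_hasDerivWithinAt p.2 h2 fun s hs => mk_mem_prod hp.1 hs).derivWithin
    (uniqueDiffOn_Icc hcd p.2 hp.2)

theorem hasDerivAt_slice {f : ℝ × ℝ → ℝ} {ε c d : ℝ} (hε : 0 < ε)
    (hf : ContDiffOn ℝ ∞ f (Ioo (-ε) ε ×ˢ Icc c d)) {s : ℝ} (hs : s ∈ Icc c d) :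
    HasDerivAt (fun r => f (r, s)) (deriv (fun r => f (r, s)) 0) 0 := by
  have h : ContDiffOn ℝ ∞ (fun r => f (r, s)) (Ioo (-ε) ε) :=
    hf.comp (by fun_prop : ContDiff ℝ ∞ fun r : ℝ => (r, s)).contDiffOn
      fun r hr => mk_mem_prod hr hs
  exact ((h.differentiableOn (by simp)).differentiableAt
    (Ioo_mem_nhds (neg_lt_zero.2 hε) hε)).hasDerivAt

section Variation

variable {n : ℕ} {M : Type*} [TopologicalSpace M] [ChartedSpace (EuclideanSpace ℝ (Fin n)) M]

theorem contMDiffOn_spacetime_iff {V : Type*} [NormedAddCommGroup V] [NormedSpace ℝ V]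
    {f : V → ℝ × M} {S : Set V} {m : WithTop ℕ∞} :
    ContMDiffOn 𝓘(ℝ, V) (spacetimeModel n) m f S ↔
      ContDiffOn ℝ m (fun x => (f x).1) S ∧
        ContMDiffOn 𝓘(ℝ, V) (𝓡 n) m (fun x => (f x).2) S := by
  rw [← contMDiffOn_iff_contDiffOn]
  exact ⟨fun h => ⟨contMDiff_fst.comp_contMDiffOn h, contMDiff_snd.comp_contMDiffOn h⟩,
    fun h => h.1.prodMk h.2⟩

/-- The integrand obtained from the energy density of a variation by subtracting the weighted
optical energy density and adding a null Lagrangian. -/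
noncomputable def reducedDensity (F : TangentBundle (𝓡 n) M → ℝ) (Λ : M → ℝ) (k : ℝ) (σ : ℝ → M)
    (c d : ℝ) (γ : ℝ → ℝ × M) (s : ℝ) : ℝ :=
  staticL F Λ (velocity (spacetimeModel n) γ (Icc c d) s)
    - Λ (σ s) * opticalMetric F Λ (velocity (𝓡 n) (fun s => (γ s).2) (Icc c d) s) ^ 2
    + 2 * k * derivWithin (fun s => (γ s).1) (Icc c d) s

theorem reducedDensity_of_mem_Ioo (F : TangentBundle (𝓡 n) M → ℝ) (Λ : M → ℝ) (k : ℝ) (σ : ℝ → M) {a b c d : ℝ} (hc : a ≤ c) (hd : d ≤ b)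
    (γ : ℝ → ℝ × M) {s : ℝ} (hs : s ∈ Ioo c d) :
    reducedDensity F Λ k σ a b γ s = reducedDensity F Λ k σ c d γ s := by
  unfold reducedDensity
  rw [velocity_Icc_of_mem_Ioo γ hc hd hs, velocity_Icc_of_mem_Ioo (fun s => (γ s).2) hc hd hs,
    derivWithin_of_mem_nhds (Icc_mem_nhds hs.1 hs.2),
    derivWithin_of_mem_nhds (Icc_mem_nhds (hc.trans_lt hs.1) (hs.2.trans_le hd))]

variable [IsManifold (𝓡 n) ∞ M] {F : TangentBundle (𝓡 n) M → ℝ} {Λ : M → ℝ}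

/-- The derivative of the density already vanishes pointwise: it equals `lam'(B² - A²) - 2A'(lam A -
k)`, and `A = B`, `lam A = k` at `r = 0`. The derivative of `B` drops out because its coefficient
contains `lam - lam₀`. No integration by parts occurs, so no boundary terms arise at break points.
-/
theorem hasDerivAt_integral_reducedDensity_piece (hF : IsFinslerMetric F)
    (hΛ : ContMDiff (𝓡 n) 𝓘(ℝ, ℝ) ∞ Λ) (hΛpos : ∀ x, 0 < Λ x) {c d k ε : ℝ} (hcd : c < d)
    (hε : 0 < ε) {θ : ℝ → ℝ} {σ : ℝ → M}
    (hreg : ∀ s ∈ Icc c d, 0 < F (velocity (𝓡 n) σ (Icc c d) s) ∧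
      derivWithin θ (Icc c d) s = opticalMetric F Λ (velocity (𝓡 n) σ (Icc c d) s) ∧
      Λ (σ s) * derivWithin θ (Icc c d) s = k)
    {ψ : ℝ → ℝ → ℝ × M}
    (hψ : ContMDiffOn 𝓘(ℝ, ℝ × ℝ) (spacetimeModel n) ∞ (Function.uncurry ψ)
      (Ioo (-ε) ε ×ˢ Icc c d))
    (hbase : ∀ s ∈ Icc c d, ψ 0 s = (θ s, σ s)) :
    HasDerivAt (fun r => ∫ s in c..d, reducedDensity F Λ k σ c d (ψ r) s) 0 0 := by
  obtain ⟨hτ, hς⟩ := contMDiffOn_spacetime_iff.1 hψ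
  set τ : ℝ → ℝ → ℝ := fun r s => (ψ r s).1 with hτdef
  set ς : ℝ → ℝ → M := fun r s => (ψ r s).2 with hςdef
  have hτ : ContDiffOn ℝ ∞ (Function.uncurry τ) (Ioo (-ε) ε ×ˢ Icc c d) := hτ
  have hς : ContMDiffOn 𝓘(ℝ, ℝ × ℝ) (𝓡 n) ∞ (Function.uncurry ς) (Ioo (-ε) ε ×ˢ Icc c d) := hς
  have hO := hF.opticalMetric hΛ hΛpos
  have hv := contMDiffOn_velocity_uncurry hcd hς
  have hτ0 : EqOn (τ 0) θ (Icc c d) := fun s hs => by simp only [hτdef, hbase s hs]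
  have hς0 : EqOn (ς 0) σ (Icc c d) := fun s hs => by simp only [hςdef, hbase s hs]
  -- The base velocity is nowhere zero; for small `r` this persists, and the optical speed `B` is
  -- smooth.
  obtain ⟨δ, hδ, hδε, hpos⟩ := exists_pos_forall_mem_of_continuousOn (U := Ioi 0) hε
    (hF.continuous.comp_continuousOn hv.continuousOn) isOpen_Ioi fun s hs => by
      have := (hreg s hs).1
      rwa [← velocity_congr (I := 𝓡 n) hς0 hs] at this
  have hsub : Ioo (-δ) δ ×ˢ Icc c d ⊆ Ioo (-ε) ε ×ˢ Icc c d :=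
    prod_mono (Ioo_subset_Ioo (neg_le_neg hδε) hδε) Subset.rfl
  set A : ℝ × ℝ → ℝ := fun p => derivWithin (τ p.1) (Icc c d) p.2 with hA
  set B : ℝ × ℝ → ℝ := fun p => opticalMetric F Λ (velocity (𝓡 n) (ς p.1) (Icc c d) p.2) with hB
  set lam : ℝ × ℝ → ℝ := fun p => Λ (ς p.1 p.2) with hlam
  have hAs : ContDiffOn ℝ ∞ A (Ioo (-δ) δ ×ˢ Icc c d) :=
    (contDiffOn_derivWithin_uncurry hcd hτ).mono hsub
  have hBs : ContDiffOn ℝ ∞ B (Ioo (-δ) δ ×ˢ Icc c d) :=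
    hO.contDiffOn_comp (hv.mono hsub) fun p hp =>
      div_pos (hpos p.1 hp.1 p.2 hp.2) (Real.sqrt_pos.2 (hΛpos _))
  have hls : ContDiffOn ℝ ∞ lam (Ioo (-δ) δ ×ˢ Icc c d) := by
    rw [← contMDiffOn_iff_contDiffOn]
    exact hΛ.comp_contMDiffOn (hς.mono hsub)
  have h0 : (0 : ℝ) ∈ Ioo (-δ) δ := by simpa using hδ
  have hl0s : ContDiffOn ℝ ∞ (fun p : ℝ × ℝ => lam (0, p.2)) (Ioo (-δ) δ ×ˢ Icc c d) :=
    hls.comp (by fun_prop : ContDiff ℝ ∞ fun p : ℝ × ℝ => ((0 : ℝ), p.2)).contDiffOn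
      fun p hp => mk_mem_prod h0 hp.2
  set H : ℝ → ℝ → ℝ := fun r s => -lam (r, s) * A (r, s) ^ 2
    + (lam (r, s) - lam (0, s)) * B (r, s) ^ 2 + 2 * k * A (r, s) with hH
  have hHs : ContDiffOn ℝ 1 (Function.uncurry H) (Ioo (-δ) δ ×ˢ Icc c d) := by
    have : ContDiffOn ℝ ∞ (Function.uncurry H) (Ioo (-δ) δ ×ˢ Icc c d) :=
      ((hls.neg.mul (hAs.pow 2)).add ((hls.sub hl0s).mul (hBs.pow 2))).add
        (contDiffOn_const.mul hAs)
    exact this.of_le (by simp)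
  have hmain := hasDerivAt_integral_of_contDiffOn hδ hcd hHs
  have hzero : ∫ s in c..d, deriv (fun r => H r s) 0 = 0 := by
    refine (intervalIntegral.integral_congr (g := fun _ => 0) fun s hs => ?_).trans
      intervalIntegral.integral_zero
    rw [uIcc_of_le hcd.le] at hs
    have dA := hasDerivAt_slice hδ hAs hs
    have dB := hasDerivAt_slice hδ hBs hs
    have dl := hasDerivAt_slice hδ hls hs
    have hd := ((dl.neg.mul (dA.pow 2)).add ((dl.sub_const (lam (0, s))).mul (dB.pow 2))).add
      (dA.const_mul (2 * k))
    obtain ⟨-, e1, e2⟩ := hreg s hs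
    have eA : A (0, s) = derivWithin θ (Icc c d) s := derivWithin_congr hτ0 (hτ0 hs)
    have eB : B (0, s) = derivWithin θ (Icc c d) s := by
      rw [e1]; simp only [hB, velocity_congr (I := 𝓡 n) hς0 hs]
    have el : lam (0, s) = Λ (σ s) := by simp only [hlam, hς0 hs]
    refine (hd.deriv).trans ?_
    simp only [Pi.neg_apply, Pi.pow_apply, eA, eB, el]
    rw [← e2]
    push_cast
    ring
  rw [hzero] at hmain
  refine hmain.congr_of_eventuallyEq ?_
  filter_upwards [Ioo_mem_nhds (neg_lt_zero.2 hδ) hδ] with r hr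
  refine intervalIntegral.integral_congr fun s hs => ?_
  rw [uIcc_of_le hcd.le] at hs
  have hrε : r ∈ Ioo (-ε) ε := (hsub (mk_mem_prod hr hs)).1
  have hτr : ContDiffOn ℝ ∞ (τ r) (Icc c d) :=
    contMDiffOn_iff_contDiffOn.1 ((contMDiffOn_iff_contDiffOn.2 hτ).slice hrε)
  have hL := staticL_velocity F Λ (uniqueDiffOn_Icc hcd s hs)
    ((hτr.differentiableOn (by simp)) s hs)
    (((hς.slice hrε) s hs).mdifferentiableWithinAt (by simp))
  change staticL F Λ (velocity (spacetimeModel n) (fun s => (τ r s, ς r s)) (Icc c d) s)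
    - Λ (σ s) * B (r, s) ^ 2 + 2 * k * A (r, s) = H r s
  rw [hL, ← mul_opticalMetric_sq F hΛpos (velocity (𝓡 n) (ς r) (Icc c d) s)]
  change -lam (r, s) * A (r, s) ^ 2 + lam (r, s) * B (r, s) ^ 2
    - Λ (σ s) * B (r, s) ^ 2 + 2 * k * A (r, s) = H r s
  have el : lam (0, s) = Λ (σ s) := by simp only [hlam, hς0 hs]
  simp only [hH, el]
  ring

theorem intervalIntegrable_staticL (hF : IsFinslerMetric F) (hΛ : Continuous Λ) {a b : ℝ}
    {γ : ℝ → ℝ × M}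
    (h : Piecewise (fun c d => ContMDiffOn 𝓘(ℝ, ℝ) (spacetimeModel n) ∞ γ (Icc c d)) a b) :
    IntervalIntegrable (fun s => staticL F Λ (velocity (spacetimeModel n) γ (Icc a b) s))
      volume a b := by
  refine Piecewise.intervalIntegrable (h.mono fun c d hc hcd hd hγ => ?_)
  obtain ⟨hθ, hσ⟩ := contMDiffOn_spacetime_iff.1 hγ
  have hU := uniqueDiffOn_Icc hcd
  refine ⟨fun s => -Λ (γ s).2 * derivWithin (fun s => (γ s).1) (Icc c d) s ^ 2
    + F (velocity (𝓡 n) (fun s => (γ s).2) (Icc c d) s) ^ 2, ?_, fun s hs => ?_⟩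
  · exact (((hΛ.comp_continuousOn hσ.continuousOn).neg).mul
      ((hθ.continuousOn_derivWithin hU (by simp)).pow 2)).add
      ((hF.continuous.comp_continuousOn
        (contMDiffOn_velocity hcd (m := ∞) le_rfl hσ).continuousOn).pow 2)
  · have hs' := Ioo_subset_Icc_self hs
    simp only [velocity_Icc_of_mem_Ioo γ hc hd hs]
    exact staticL_velocity F Λ (hU s hs') ((hθ.differentiableOn (by simp)) s hs')
      ((hσ s hs').mdifferentiableWithinAt (by simp))

/-- Along a curve in `ℝ × M` which is lightlike and satisfies the conservation law of `∂_t`, the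
first variations of the energy and of the weighted optical energy agree. -/
theorem hasDerivAt_energy_sub (hF : IsFinslerMetric F)
    (hΛ : ContMDiff (𝓡 n) 𝓘(ℝ, ℝ) ∞ Λ) (hΛpos : ∀ x, 0 < Λ x) {a b k ε : ℝ} (hab : a < b)
    {θ : ℝ → ℝ} {σ : ℝ → M} (hσ : ContinuousOn σ (Icc a b))
    (hreg : ∀ c d, a ≤ c → c < d → d ≤ b →
      ContMDiffOn 𝓘(ℝ, ℝ) (spacetimeModel n) ∞ (fun s => (θ s, σ s)) (Icc c d) →
      ∀ s ∈ Icc c d, 0 < F (velocity (𝓡 n) σ (Icc c d) s) ∧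
      derivWithin θ (Icc c d) s = opticalMetric F Λ (velocity (𝓡 n) σ (Icc c d) s) ∧
      Λ (σ s) * derivWithin θ (Icc c d) s = k)
    {ψ : ℝ → ℝ → ℝ × M}
    (hψ : IsProperVariation (spacetimeModel n) a b (fun s => (θ s, σ s)) ε ψ) :
    HasDerivAt (fun r => energy (spacetimeModel n) (staticL F Λ) a b (ψ r)
      - (1 / 2) * ∫ s in a..b, Λ (σ s) *
        opticalMetric F Λ (velocity (𝓡 n) (fun s => (ψ r s).2) (Icc a b) s) ^ 2) 0 0 := by
  have hε := hψ.pos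
  have h0 : (0 : ℝ) ∈ Ioo (-ε) ε := by simpa using hε
  have hO := hF.opticalMetric hΛ hΛpos
  have hcont : ContinuousOn (fun s => Λ (σ s)) (Icc a b) := hΛ.continuous.comp_continuousOn hσ
  have hfst : ∀ r ∈ Ioo (-ε) ε,
      Piecewise (fun c d => ContDiffOn ℝ ∞ (fun s => (ψ r s).1) (Icc c d)) a b := fun r hr =>
    (hψ.piecewise_slice hr).mono fun c d _ _ _ h => (contMDiffOn_spacetime_iff.1 h).1
  have hsnd : ∀ r ∈ Ioo (-ε) ε, Piecewise (fun c d =>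
      ContMDiffOn 𝓘(ℝ, ℝ) (𝓡 n) ∞ (fun s => (ψ r s).2) (Icc c d)) a b := fun r hr =>
    (hψ.piecewise_slice hr).mono fun c d _ _ _ h => (contMDiffOn_spacetime_iff.1 h).2
  have iL := fun r hr => intervalIntegrable_staticL (Λ := Λ) hF hΛ.continuous
    (hψ.piecewise_slice (r := r) hr)
  have iK := fun r hr => intervalIntegrable_velocity hO.continuous_sq hcont (hsnd r hr)
  have iA := fun r hr => ((hfst r hr).intervalIntegrable_derivWithin).const_mul (2 * k)
  have iR : ∀ r ∈ Ioo (-ε) ε, IntervalIntegrable (reducedDensity F Λ k σ a b (ψ r)) volume a b :=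
    fun r hr => ((iL r hr).sub (iK r hr)).add (iA r hr)
  have hR : HasDerivAt (fun r => ∫ s in a..b, reducedDensity F Λ k σ a b (ψ r) s) 0 0 := by
    refine hψ.piecewise.induction_of_lt (P := fun c d =>
      HasDerivAt (fun r => ∫ s in c..d, reducedDensity F Λ k σ a b (ψ r) s) 0 0) hab ?_ ?_
    · intro c d hc hcd hd hs
      have hbase : ∀ s ∈ Icc c d, ψ 0 s = (θ s, σ s) :=
        fun s hs => hψ.base s ⟨hc.trans hs.1, hs.2.trans hd⟩
      have hγ : ContMDiffOn 𝓘(ℝ, ℝ) (spacetimeModel n) ∞ (fun s => (θ s, σ s)) (Icc c d) :=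
        (hs.slice h0).congr fun s hs => (hbase s hs).symm
      refine (hasDerivAt_integral_reducedDensity_piece hF hΛ hΛpos hcd hε
        (hreg c d hc hcd hd hγ) hs hbase).congr_of_eventuallyEq ?_
      refine Filter.Eventually.of_forall fun r => ?_
      exact intervalIntegral.integral_congr_Ioo_of_le hcd.le fun s hs =>
        reducedDensity_of_mem_Ioo F Λ k σ hc hd (ψ r) hs
    · intro c m d hc hcm hmd hd h1 h2
      have h3 := h1.add h2
      rw [add_zero] at h3
      refine h3.congr_of_eventuallyEq ?_
      filter_upwards [isOpen_Ioo.mem_nhds h0] with r hr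
      have sub : ∀ x y, a ≤ x → x ≤ y → y ≤ b →
          IntervalIntegrable (reducedDensity F Λ k σ a b (ψ r)) volume x y :=
        fun x y hx hxy hy => (iR r hr).mono_set (by
          rw [uIcc_of_le hxy, uIcc_of_le hab.le]; exact Icc_subset_Icc hx hy)
      exact (intervalIntegral.integral_add_adjacent_intervals
        (sub c m hc hcm.le (hmd.le.trans hd)) (sub m d (hc.trans hcm.le) hmd.le hd)).symm
  -- The constant `k * (θ b - θ a)` is the contribution of the null Lagrangian, the same for every
  -- `r`.
  have hR' := (hR.const_mul (1 / 2)).sub_const (k * (θ b - θ a))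
  rw [mul_zero] at hR'
  refine hR'.congr_of_eventuallyEq ?_
  filter_upwards [isOpen_Ioo.mem_nhds h0] with r hr
  have e1 : ∫ s in a..b, reducedDensity F Λ k σ a b (ψ r) s
      = (∫ s in a..b, staticL F Λ (velocity (spacetimeModel n) (ψ r) (Icc a b) s))
        - (∫ s in a..b, Λ (σ s) *
          opticalMetric F Λ (velocity (𝓡 n) (fun s => (ψ r s).2) (Icc a b) s) ^ 2)
        + 2 * k * (θ b - θ a) := by
    have e2 := (hfst r hr).integral_derivWithin hab
    rw [hψ.left r hr, hψ.right r hr] at e2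
    change ∫ s in a..b, (staticL F Λ (velocity (spacetimeModel n) (ψ r) (Icc a b) s)
      - Λ (σ s) * opticalMetric F Λ (velocity (𝓡 n) (fun s => (ψ r s).2) (Icc a b) s) ^ 2
      + 2 * k * derivWithin (fun s => (ψ r s).1) (Icc a b) s) = _
    rw [intervalIntegral.integral_add ((iL r hr).sub (iK r hr)) (iA r hr),
      intervalIntegral.integral_sub (iL r hr) (iK r hr), intervalIntegral.integral_const_mul, e2]
  rw [e1]
  unfold energy
  ring

end Variation

/-! ### Reparametrization of curves and variations -/

/-- `φ : [a', b'] → [a, b]` and `S : [a, b] → [a', b']` are mutually inverse and increasing. -/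
structure IsReparametrization (a' b' a b : ℝ) (φ S : ℝ → ℝ) : Prop where
  strictMonoOn : StrictMonoOn φ (Icc a' b')
  strictMonoOn_inv : StrictMonoOn S (Icc a b)
  map_left : φ a' = a
  map_right : φ b' = b
  inv_left : S a = a'
  inv_right : S b = b'
  leftInv : ∀ u ∈ Icc a' b', S (φ u) = u
  rightInv : ∀ s ∈ Icc a b, φ (S s) = s

namespace IsReparametrization

variable {a' b' a b : ℝ} {φ S : ℝ → ℝ}

theorem symm (h : IsReparametrization a' b' a b φ S) : IsReparametrization a b a' b' S φ :=
  ⟨h.2, h.1, h.5, h.6, h.3, h.4, h.8, h.7⟩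

theorem mapsTo (h : IsReparametrization a' b' a b φ S) (hab : a' < b') :
    MapsTo φ (Icc a' b') (Icc a b) := by
  intro u hu
  rw [← h.map_left, ← h.map_right]
  exact ⟨h.strictMonoOn.monotoneOn (left_mem_Icc.2 hab.le) hu hu.1,
    h.strictMonoOn.monotoneOn hu (right_mem_Icc.2 hab.le) hu.2⟩

theorem image (h : IsReparametrization a' b' a b φ S) (hab' : a' < b') (hab : a < b) :
    φ '' Icc a' b' = Icc a b := by
  refine Subset.antisymm (h.mapsTo hab').image_subset fun s hs => ?_
  exact ⟨S s, h.symm.mapsTo hab hs, h.rightInv s hs⟩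

theorem mapsTo_piece (h : IsReparametrization a' b' a b φ S) (hab : a < b) {c d : ℝ}
    (hc : a ≤ c) (hcd : c < d) (hd : d ≤ b) : MapsTo φ (Icc (S c) (S d)) (Icc c d) := by
  have hc' : c ∈ Icc a b := ⟨hc, hcd.le.trans hd⟩
  have hd' : d ∈ Icc a b := ⟨hc.trans hcd.le, hd⟩
  have hSc := h.symm.mapsTo hab hc'
  have hSd := h.symm.mapsTo hab hd'
  intro u hu
  have hu' : u ∈ Icc a' b' := ⟨hSc.1.trans hu.1, hu.2.trans hSd.2⟩
  rw [← h.rightInv c hc', ← h.rightInv d hd']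
  exact ⟨h.strictMonoOn.monotoneOn hSc hu' hu.1, h.strictMonoOn.monotoneOn hu' hSd hu.2⟩

theorem of_strictMonoOn (hab' : a' < b') (hφ : StrictMonoOn φ (Icc a' b'))
    (hc : ContinuousOn φ (Icc a' b')) (ha : φ a' = a) (hb : φ b' = b) :
    ∃ S, IsReparametrization a' b' a b φ S := by
  have himg : SurjOn φ (Icc a' b') (Icc a b) := by
    rw [← ha, ← hb]
    exact intermediate_value_Icc hab'.le hc
  set S := Function.invFunOn φ (Icc a' b') with hS
  have hr : ∀ s ∈ Icc a b, φ (S s) = s := fun s hs => Function.invFunOn_eq (himg hs)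
  have hm : ∀ s ∈ Icc a b, S s ∈ Icc a' b' := fun s hs => Function.invFunOn_mem (himg hs)
  have hl : ∀ u ∈ Icc a' b', S (φ u) = u := fun u hu => hφ.injOn.leftInvOn_invFunOn hu
  refine ⟨S, hφ, ?_, ha, hb, ?_, ?_, hl, hr⟩
  · intro s hs t ht hst
    rw [← hφ.lt_iff_lt (hm s hs) (hm t ht), hr s hs, hr t ht]
    exact hst
  · rw [← ha]; exact hl a' (left_mem_Icc.2 hab'.le)
  · rw [← hb]; exact hl b' (right_mem_Icc.2 hab'.le)

/-- Smoothness of `φ` is indexed by pieces of `[a, b]`, not of `[a', b']`, so that one common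
refinement serves both `φ` and the curve to be composed with it. -/
theorem piecewise_and (h : IsReparametrization a' b' a b φ S)
    (hφ : Piecewise (fun c d => ContDiffOn ℝ ∞ φ (Icc (S c) (S d))) a b) {Q : ℝ → ℝ → Prop}
    (hQ : Hereditary Q) (hQab : Piecewise Q a b) :
    Piecewise (fun c d => ContDiffOn ℝ ∞ φ (Icc (S c) (S d)) ∧ Q c d) a b := by
  -- The bounds are carried along because heredity uses the monotonicity of `S`, which is known only
  -- on `[a, b]`.
  have hφ' : Piecewise (fun c d => a ≤ c ∧ d ≤ b ∧ ContDiffOn ℝ ∞ φ (Icc (S c) (S d))) a b :=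
    hφ.mono fun c d hc _ hd h => ⟨hc, hd, h⟩
  have her : Hereditary fun c d => a ≤ c ∧ d ≤ b ∧ ContDiffOn ℝ ∞ φ (Icc (S c) (S d)) := by
    intro p q c d hc hcd hd hh
    refine ⟨hh.1.trans hc, hd.trans hh.2.1, hh.2.2.mono (Icc_subset_Icc ?_ ?_)⟩
    · exact h.strictMonoOn_inv.monotoneOn ⟨hh.1, hc.trans (hcd.le.trans (hd.trans hh.2.1))⟩
        ⟨hh.1.trans hc, hcd.le.trans (hd.trans hh.2.1)⟩ hc
    · exact h.strictMonoOn_inv.monotoneOn ⟨hh.1.trans (hc.trans hcd.le), hd.trans hh.2.1⟩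
        ⟨hh.1.trans (hc.trans (hcd.le.trans hd)), hh.2.1⟩ hd
  exact (hφ'.and her hQ hQab).mono fun _ _ _ _ _ hh => ⟨hh.1.2.2, hh.2⟩

theorem piecewise_comp {E : Type*} [NormedAddCommGroup E] [NormedSpace ℝ E]
    {H : Type*} [TopologicalSpace H] {I : ModelWithCorners ℝ E H}
    {N : Type*} [TopologicalSpace N] [ChartedSpace H N]
    (h : IsReparametrization a' b' a b φ S) (hab : a < b)
    (hφ : Piecewise (fun c d => ContDiffOn ℝ ∞ φ (Icc (S c) (S d))) a b) {γ : ℝ → N}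
    (hγ : Piecewise (fun c d => ContMDiffOn 𝓘(ℝ, ℝ) I ∞ γ (Icc c d)) a b) :
    Piecewise (fun c d => ContMDiffOn 𝓘(ℝ, ℝ) I ∞ (γ ∘ φ) (Icc c d)) a' b' := by
  have hand := h.piecewise_and hφ (hereditary_contMDiffOn γ) hγ
  rw [← h.inv_left, ← h.inv_right]
  refine hand.map S h.strictMonoOn_inv fun c d hc hcd hd hh => ?_
  exact hh.2.comp hh.1.contMDiffOn (h.mapsTo_piece hab hc hcd hd)

/-- Reparametrization of a variation. -/
theorem isProperVariation_comp {E : Type*} [NormedAddCommGroup E] [NormedSpace ℝ E]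
    {H : Type*} [TopologicalSpace H] {I : ModelWithCorners ℝ E H}
    {N : Type*} [TopologicalSpace N] [ChartedSpace H N]
    (h : IsReparametrization a' b' a b φ S) (hab : a < b) (hab' : a' < b')
    (hφ : Piecewise (fun c d => ContDiffOn ℝ ∞ φ (Icc (S c) (S d))) a b) {γ : ℝ → N}
    {ε : ℝ} {ψ : ℝ → ℝ → N} (hψ : IsProperVariation I a b γ ε ψ) :
    IsProperVariation I a' b' (γ ∘ φ) ε (fun r => ψ r ∘ φ) := by
  have hand := h.piecewise_and hφ (hereditary_contMDiffOn_prod (Function.uncurry ψ) (Ioo (-ε) ε))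
    hψ.piecewise
  refine isProperVariation_of_piecewise hab' hψ.pos ?_ ?_ ?_ ?_
  · rw [← h.inv_left, ← h.inv_right]
    refine hand.map S h.strictMonoOn_inv fun c d hc hcd hd hh => ?_
    have h1 : ContDiffOn ℝ ∞ (fun p : ℝ × ℝ => (p.1, φ p.2)) (Ioo (-ε) ε ×ˢ Icc (S c) (S d)) :=
      contDiff_fst.contDiffOn.prodMk
        (hh.1.comp contDiff_snd.contDiffOn fun p (hp : p ∈ Ioo (-ε) ε ×ˢ Icc (S c) (S d)) => hp.2)
    exact hh.2.comp h1.contMDiffOn fun p hp =>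
      mk_mem_prod hp.1 (h.mapsTo_piece hab hc hcd hd hp.2)
  · exact fun u hu => hψ.base _ (h.mapsTo hab' hu)
  · intro r hr
    simp only [Function.comp_apply, h.map_left]
    exact hψ.left r hr
  · intro r hr
    simp only [Function.comp_apply, h.map_right]
    exact hψ.right r hr

/-- A solution of `φ' = w ∘ φ` is as smooth as `w`. -/
theorem contDiffOn_of_hasDerivWithinAt {φ w : ℝ → ℝ} {p q c d : ℝ} (hpq : p < q)
    (hw : ContDiffOn ℝ ∞ w (Icc c d)) (hmaps : MapsTo φ (Icc p q) (Icc c d))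
    (hφ : ∀ u ∈ Icc p q, HasDerivWithinAt φ (w (φ u)) (Icc p q) u) :
    ContDiffOn ℝ ∞ φ (Icc p q) := by
  have hU := uniqueDiffOn_Icc hpq
  have hd : DifferentiableOn ℝ φ (Icc p q) := fun u hu => (hφ u hu).differentiableWithinAt
  have heq : EqOn (derivWithin φ (Icc p q)) (w ∘ φ) (Icc p q) := fun u hu =>
    (hφ u hu).derivWithin (hU u hu)
  -- Bootstrap: if `φ` is `C^m`, so is `φ' = w ∘ φ`, and `φ` is `C^(m+1)`.
  have key : ∀ m : ℕ, ContDiffOn ℝ m φ (Icc p q) := by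
    intro m
    induction m with
    | zero => exact contDiffOn_zero.2 hd.continuousOn
    | succ m ih =>
      rw [Nat.cast_add, Nat.cast_one, contDiffOn_succ_iff_derivWithin hU]
      refine ⟨hd, by simp, ContDiffOn.congr ?_ heq⟩
      exact (hw.of_le (by exact_mod_cast le_top)).comp ih hmaps
  exact contDiffOn_infty.2 key

theorem piecewise_contDiffOn (h : IsReparametrization a' b' a b φ S) (hab : a < b) {w : ℝ → ℝ}
    (hw : Piecewise (fun c d => ContDiffOn ℝ ∞ w (Icc c d)) a b)
    (hφ : ∀ u ∈ Icc a' b', HasDerivWithinAt φ (w (φ u)) (Icc a' b') u) :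
    Piecewise (fun c d => ContDiffOn ℝ ∞ φ (Icc (S c) (S d))) a b := by
  refine hw.mono fun c d hc hcd hd hw => ?_
  have hc' : c ∈ Icc a b := ⟨hc, hcd.le.trans hd⟩
  have hd' : d ∈ Icc a b := ⟨hc.trans hcd.le, hd⟩
  have hsub : Icc (S c) (S d) ⊆ Icc a' b' :=
    Icc_subset_Icc (h.symm.mapsTo hab hc').1 (h.symm.mapsTo hab hd').2
  exact contDiffOn_of_hasDerivWithinAt (h.strictMonoOn_inv hc' hd' hcd) hw
    (h.mapsTo_piece hab hc hcd hd) fun u hu => (hφ u (hsub hu)).mono hsub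

theorem piecewise_symm (h : IsReparametrization a' b' a b φ S)
    (hS : Piecewise (fun c d => ContDiffOn ℝ ∞ S (Icc c d)) a b) :
    Piecewise (fun c d => ContDiffOn ℝ ∞ S (Icc (φ c) (φ d))) a' b' := by
  rw [← h.inv_left, ← h.inv_right]
  refine hS.map S h.strictMonoOn_inv fun c d hc hcd hd hs => ?_
  rw [h.rightInv c ⟨hc, hcd.le.trans hd⟩, h.rightInv d ⟨hc.trans hcd.le, hd⟩]
  exact hs

end IsReparametrization

/-! ### Energy under reparametrization -/

section ReparametrizedEnergy

variable {n : ℕ} {M : Type*} [TopologicalSpace M] [ChartedSpace (EuclideanSpace ℝ (Fin n)) M]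
  [IsManifold (𝓡 n) ∞ M] {F : TangentBundle (𝓡 n) M → ℝ}

/-- The energy of a reparametrized curve is a weighted energy of the curve. -/
theorem IsFinslerMetric.energy_comp (hF : IsFinslerMetric F) {a' b' a b κ : ℝ} {φ S w : ℝ → ℝ}
    (h : IsReparametrization a' b' a b φ S) (hab' : a' < b') (hab : a < b) (hκ : 0 < κ)
    (hw : ∀ s ∈ Icc a b, 0 < w s)
    (hφ : ∀ u ∈ Icc a' b', HasDerivWithinAt φ (κ * w (φ u)) (Icc a' b') u) {γ : ℝ → M}
    (hγ : Piecewise (fun c d => ContMDiffOn 𝓘(ℝ, ℝ) (𝓡 n) ∞ γ (Icc c d)) a b) :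
    energy (𝓡 n) (fun p => F p ^ 2) a' b' (γ ∘ φ) =
      κ * ((1 / 2) * ∫ s in a..b, w s * F (velocity (𝓡 n) γ (Icc a b) s) ^ 2) := by
  obtain ⟨D, hD, hDs⟩ := hγ.exists_finite
  -- By injectivity of `φ`, the break points of `γ` come from finitely many parameters, so the chain
  -- rule holds almost everywhere.
  have hfin : {u | u ∈ Icc a' b' ∧ φ u ∈ D}.Finite := by
    refine Set.Finite.of_finite_image (f := φ) (hD.subset ?_) ?_
    · rintro _ ⟨u, hu, rfl⟩; exact hu.2
    · exact h.strictMonoOn.injOn.mono fun u hu => hu.1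
  -- Of the two factors `φ'` in `F((γ ∘ φ)')² = φ'² F(γ')²`, one is the Jacobian and the other, `κ
  -- w(φ)`, remains as the weight.
  have hint : ∫ u in a'..b', F (velocity (𝓡 n) (γ ∘ φ) (Icc a' b') u) ^ 2
      = ∫ s in a..b, κ * (w s * F (velocity (𝓡 n) γ (Icc a b) s) ^ 2) := by
    rw [intervalIntegral.integral_of_le hab'.le, intervalIntegral.integral_of_le hab.le,
      ← integral_Icc_eq_integral_Ioc, ← integral_Icc_eq_integral_Ioc, ← h.image hab' hab,
      integral_image_eq_integral_abs_deriv_smul measurableSet_Icc hφ h.strictMonoOn.injOn]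
    refine setIntegral_congr_ae measurableSet_Icc ?_
    have hae : ∀ᵐ u : ℝ, u ∉ {u | u ∈ Icc a' b' ∧ φ u ∈ D} :=
      measure_eq_zero_iff_ae_notMem.1 (hfin.measure_zero volume)
    filter_upwards [hae] with u hu' hu
    have hφu := h.mapsTo hab' hu
    obtain ⟨c, d, hc, hd, hs, hsm⟩ := hDs (φ u) ⟨hφu, fun hx => hu' ⟨hu, hx⟩⟩
    have hmd : MDifferentiableWithinAt 𝓘(ℝ, ℝ) (𝓡 n) γ (Icc a b) (φ u) :=
      (((hsm _ (Ioo_subset_Icc_self hs)).mdifferentiableWithinAt (by simp)).mdifferentiableAt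
        (Icc_mem_nhds hs.1 hs.2)).mdifferentiableWithinAt
    have hpos : 0 < κ * w (φ u) := mul_pos hκ (hw _ hφu)
    rw [hF.velocity_comp (hφ u hu) hpos (h.mapsTo hab') (uniqueDiffOn_Icc hab' u hu) hmd,
      abs_of_pos hpos, smul_eq_mul, h.image hab' hab]
    ring
  unfold energy
  rw [hint, intervalIntegral.integral_const_mul]
  ring

end ReparametrizedEnergy

/-! ### Primitives and reparametrization by quadrature -/

theorem hasDerivWithinAt_integral_of_continuousOn {g : ℝ → ℝ} {c d : ℝ} (hcd : c < d)
    (hg : ContinuousOn g (Icc c d)) {s : ℝ} (hs : s ∈ Icc c d) :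
    HasDerivWithinAt (fun s => ∫ x in c..s, g x) (g s) (Icc c d) s := by
  set G := IccExtend hcd.le ((Icc c d).domRestrict g) with hG
  have hGc : Continuous G := (continuousOn_iff_continuous_domRestrict.1 hg).Icc_extend'
  have hGg : ∀ x ∈ Icc c d, G x = g x := fun x hx => IccExtend_of_mem _ _ hx
  have h := (hGc.integral_hasStrictDerivAt c s).hasDerivAt.hasDerivWithinAt (s := Icc c d)
  rw [hGg s hs] at h
  have key : ∀ t ∈ Icc c d, ∫ x in c..t, g x = ∫ x in c..t, G x := fun t ht =>
    intervalIntegral.integral_congr fun x hx => by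
      rw [uIcc_of_le ht.1] at hx
      exact (hGg x ⟨hx.1, hx.2.trans ht.2⟩).symm
  exact h.congr key (key s hs)

/-- Values of `g` at break points do not affect its primitive, whose one-sided derivatives there are
those of the continuous representative `g'`. -/
theorem hasDerivWithinAt_integral_piece {g g' : ℝ → ℝ} {a c d : ℝ}
    (hint : IntervalIntegrable g volume a d) (hac : a ≤ c) (hcd : c < d)
    (hg' : ContinuousOn g' (Icc c d)) (heq : EqOn g g' (Ioo c d)) {s : ℝ} (hs : s ∈ Icc c d) :
    HasDerivWithinAt (fun s => ∫ x in a..s, g x) (g' s) (Icc c d) s := by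
  have h := (hasDerivWithinAt_integral_of_continuousOn hcd hg' hs).const_add (∫ x in a..c, g x)
  have sub : ∀ x y, a ≤ x → x ≤ y → y ≤ d → IntervalIntegrable g volume x y :=
    fun x y hx hxy hy => hint.mono_set (by
      rw [uIcc_of_le hxy, uIcc_of_le (hac.trans hcd.le)]; exact Icc_subset_Icc hx hy)
  have key : ∀ t ∈ Icc c d, ∫ x in a..t, g x = (∫ x in a..c, g x) + ∫ x in c..t, g' x := by
    intro t ht
    rw [← intervalIntegral.integral_add_adjacent_intervals (sub a c le_rfl hac hcd.le)
      (sub c t hac ht.1 ht.2)]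
    congr 1
    exact intervalIntegral.integral_congr_Ioo_of_le ht.1 fun x hx => heq ⟨hx.1, hx.2.trans_le ht.2⟩
  exact h.congr key (key s hs)

theorem contDiffOn_infty_of_hasDerivWithinAt {f f' : ℝ → ℝ} {c d : ℝ} (hcd : c < d)
    (h : ∀ s ∈ Icc c d, HasDerivWithinAt f (f' s) (Icc c d) s) (hf' : ContDiffOn ℝ ∞ f' (Icc c d)) :
    ContDiffOn ℝ ∞ f (Icc c d) := by
  have hU := uniqueDiffOn_Icc hcd
  rw [contDiffOn_infty_iff_derivWithin hU]
  exact ⟨fun s hs => (h s hs).differentiableWithinAt,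
    hf'.congr fun s hs => (h s hs).derivWithin (hU s hs)⟩

theorem contDiffOn_one_of_hasDerivWithinAt {f f' : ℝ → ℝ} {c d : ℝ} (hcd : c < d)
    (h : ∀ s ∈ Icc c d, HasDerivWithinAt f (f' s) (Icc c d) s) (hf' : ContinuousOn f' (Icc c d)) :
    ContDiffOn ℝ 1 f (Icc c d) := by
  have hU := uniqueDiffOn_Icc hcd
  rw [contDiffOn_one_iff_derivWithin hU]
  exact ⟨fun s hs => (h s hs).differentiableWithinAt,
    hf'.congr fun s hs => (h s hs).derivWithin (hU s hs)⟩

/-- Solving `φ' = w ∘ φ` by quadrature. -/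
theorem exists_reparametrization {a b : ℝ} (hab : a < b) {w : ℝ → ℝ}
    (hw : ContinuousOn w (Icc a b)) (hpos : ∀ s ∈ Icc a b, 0 < w s) :
    ∃ (a' b' : ℝ) (φ S : ℝ → ℝ), a' < b' ∧ IsReparametrization a' b' a b φ S ∧
      (∀ u ∈ Icc a' b', HasDerivWithinAt φ (w (φ u)) (Icc a' b') u) ∧
      ∀ s ∈ Icc a b, HasDerivWithinAt S (w s)⁻¹ (Icc a b) s := by
  -- Extended by constants, `w` is continuous, positive and bounded by `C` on the whole line. Then
  -- `S = ∫ 1/W` has slope at least `1/C`, so it is an increasing bijection of `ℝ`, and `φ` is its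
  -- inverse.
  set W := IccExtend hab.le ((Icc a b).domRestrict w) with hW
  have hWc : Continuous W := (continuousOn_iff_continuous_domRestrict.1 hw).Icc_extend'
  have hWw : ∀ x ∈ Icc a b, W x = w x := fun x hx => IccExtend_of_mem _ _ hx
  have hWpos : ∀ x, 0 < W x := fun x => hpos _ (projIcc a b hab.le x).2
  obtain ⟨C, hC⟩ := isCompact_Icc.exists_bound_of_continuousOn hw
  have hWC : ∀ x, W x ≤ C := fun x => (le_abs_self _).trans (hC _ (projIcc a b hab.le x).2)
  have hC0 : 0 < C := (hWpos 0).trans_le (hWC 0)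
  have hinvc : Continuous fun x => (W x)⁻¹ := hWc.inv₀ fun x => (hWpos x).ne'
  set S : ℝ → ℝ := fun s => ∫ x in a..s, (W x)⁻¹ with hS
  have hSd : ∀ s, HasDerivAt S (W s)⁻¹ s := fun s => (hinvc.integral_hasStrictDerivAt a s).hasDerivAt
  have hSmono : StrictMono S := strictMono_of_deriv_pos fun s => by
    rw [(hSd s).deriv]; exact inv_pos.2 (hWpos s)
  have hScont : Continuous S := continuous_iff_continuousAt.2 fun s => (hSd s).continuousAt
  have hlin : Monotone fun s => S s - C⁻¹ * s := by
    have hd : ∀ s, HasDerivAt (fun s => S s - C⁻¹ * s) ((W s)⁻¹ - C⁻¹) s := fun s => by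
      have := (hSd s).sub ((hasDerivAt_id s).const_mul C⁻¹)
      rw [mul_one] at this
      exact this
    refine monotone_of_deriv_nonneg (fun s => (hd s).differentiableAt) fun s => ?_
    rw [(hd s).deriv, sub_nonneg]
    exact inv_anti₀ (hWpos s) (hWC s)
  have hSa : S a = 0 := intervalIntegral.integral_same
  have htop : Filter.Tendsto S Filter.atTop Filter.atTop := by
    refine Filter.tendsto_atTop_mono' _ (f₁ := fun s => C⁻¹ * s + (S a - C⁻¹ * a)) ?_
      (Filter.tendsto_atTop_add_const_right _ _
        (Filter.tendsto_id.const_mul_atTop (inv_pos.2 hC0)))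
    filter_upwards [Filter.eventually_ge_atTop a] with s hs
    have := hlin hs
    simp only at this
    linarith
  have hbot : Filter.Tendsto S Filter.atBot Filter.atBot := by
    refine Filter.tendsto_atBot_mono' _ (f₁ := fun s => C⁻¹ * s + (S a - C⁻¹ * a)) ?_
      (Filter.tendsto_atBot_add_const_right _ _
        (Filter.tendsto_id.const_mul_atBot (inv_pos.2 hC0)))
    filter_upwards [Filter.eventually_le_atBot a] with s hs
    have := hlin hs
    simp only at this
    linarith
  set e : ℝ ≃o ℝ := hSmono.orderIsoOfSurjective S (hScont.surjective htop hbot) with he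
  have heS : ∀ s, e s = S s := fun s => rfl
  have hleft : ∀ s, e.symm (S s) = s := fun s => e.symm_apply_apply s
  have hright : ∀ u, S (e.symm u) = u := fun u => e.apply_symm_apply u
  have hφd : ∀ u, HasDerivAt e.symm (W (e.symm u)) u := by
    intro u
    have := HasDerivAt.of_local_left_inverse e.symm.continuous.continuousAt (hSd (e.symm u))
      (inv_ne_zero (hWpos _).ne') (Filter.Eventually.of_forall hright)
    rwa [inv_inv] at this
  have hb' : 0 < S b := by rw [← hSa]; exact hSmono hab
  have hmem : ∀ u ∈ Icc 0 (S b), e.symm u ∈ Icc a b := by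
    intro u hu
    rw [← hSa] at hu
    have h1 := e.symm.monotone hu.1
    have h2 := e.symm.monotone hu.2
    rw [hleft] at h1 h2
    exact ⟨h1, h2⟩
  refine ⟨0, S b, e.symm, S, hb', ⟨e.symm.strictMono.strictMonoOn _, hSmono.strictMonoOn _, ?_,
    hleft b, hSa, rfl, fun u _ => hright u, fun s _ => hleft s⟩, ?_, ?_⟩
  · rw [← hSa]; exact hleft a
  · intro u hu
    rw [← hWw _ (hmem u hu)]
    exact (hφd u).hasDerivWithinAt
  · intro s hs
    rw [← hWw s hs]
    exact (hSd s).hasDerivWithinAt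

/-! ### One-sided velocities -/

section Velocities

variable {E : Type*} [NormedAddCommGroup E] [NormedSpace ℝ E]
  {H : Type*} [TopologicalSpace H] {I : ModelWithCorners ℝ E H}
  {N : Type*} [TopologicalSpace N] [ChartedSpace H N]

theorem velocity_right_eq {γ : ℝ → N} {b c d s : ℝ} (hcs : c ≤ s) (hsd : s < d) (hdb : d ≤ b)
    (h : MDifferentiableWithinAt 𝓘(ℝ, ℝ) I γ (Icc c d) s) :
    velocity I γ (Icc s b) s = velocity I γ (Icc c d) s := by
  rw [← velocity_mono (Icc_subset_Icc_left hcs) (uniqueDiffOn_Icc hsd s ⟨le_rfl, hsd.le⟩) h]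
  apply velocity_congr_set
  filter_upwards [Iio_mem_nhds hsd] with x hx
  exact propext ⟨fun hx' => ⟨hx'.1, (mem_Iio.1 hx).le⟩, fun hx' => ⟨hx'.1, hx'.2.trans hdb⟩⟩

theorem velocity_left_eq {γ : ℝ → N} {a c d s : ℝ} (hac : a ≤ c) (hcs : c < s) (hsd : s ≤ d)
    (h : MDifferentiableWithinAt 𝓘(ℝ, ℝ) I γ (Icc c d) s) :
    velocity I γ (Icc a s) s = velocity I γ (Icc c d) s := by
  rw [← velocity_mono (Icc_subset_Icc_right hsd) (uniqueDiffOn_Icc hcs s ⟨hcs.le, le_rfl⟩) h]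
  apply velocity_congr_set
  filter_upwards [Ioi_mem_nhds hcs] with x hx
  exact propext ⟨fun hx' => ⟨(mem_Ioi.1 hx).le, hx'.2⟩, fun hx' => ⟨hac.trans hx'.1, hx'.2⟩⟩

end Velocities

/-! ### The conserved momentum of time translation -/

section TimeVariation

variable {n : ℕ} {M : Type*} [TopologicalSpace M] [ChartedSpace (EuclideanSpace ℝ (Fin n)) M]
  [IsManifold (𝓡 n) ∞ M] {F : TangentBundle (𝓡 n) M → ℝ} {Λ : M → ℝ}

/-- The conservation law associated with the Killing field `∂_t`. -/
theorem exists_conserved_momentum (hF : IsFinslerMetric F)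
    (hΛ : ContMDiff (𝓡 n) 𝓘(ℝ, ℝ) ∞ Λ) {a b : ℝ} (hab : a < b)
    {θ : ℝ → ℝ} {σ : ℝ → M}
    (hgeo : IsGeodesic (spacetimeModel n) (staticL F Λ) a b (fun s => (θ s, σ s))) :
    ∃ k : ℝ, ∀ c d, a ≤ c → c < d → d ≤ b →
      ContMDiffOn 𝓘(ℝ, ℝ) (spacetimeModel n) ∞ (fun s => (θ s, σ s)) (Icc c d) →
      ∀ s ∈ Icc c d, Λ (σ s) * derivWithin θ (Icc c d) s = k := by
  have hγ := hgeo.1.piecewise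
  set g : ℝ → ℝ := fun s => Λ (σ s) * derivWithin θ (Icc a b) s with hg
  have hsm : ∀ c d, c < d → ContMDiffOn 𝓘(ℝ, ℝ) (spacetimeModel n) ∞ (fun s => (θ s, σ s)) (Icc c d) →
      ContDiffOn ℝ ∞ (fun s => Λ (σ s) * derivWithin θ (Icc c d) s) (Icc c d) := by
    intro c d hcd h
    obtain ⟨h1, h2⟩ := contMDiffOn_spacetime_iff.1 h
    exact (contMDiffOn_iff_contDiffOn.1 (hΛ.comp_contMDiffOn h2)).mul
      (h1.derivWithin (uniqueDiffOn_Icc hcd) (by simp))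
  have heq : ∀ c d, a ≤ c → d ≤ b →
      EqOn g (fun s => Λ (σ s) * derivWithin θ (Icc c d) s) (Ioo c d) := by
    intro c d hc hd s hs
    simp only [hg]
    rw [derivWithin_of_mem_nhds (Icc_mem_nhds hs.1 hs.2),
      derivWithin_of_mem_nhds (Icc_mem_nhds (hc.trans_lt hs.1) (hs.2.trans_le hd))]
  have ig : IntervalIntegrable g volume a b := Piecewise.intervalIntegrable
    (hγ.mono fun c d hc hcd hd h => ⟨_, (hsm c d hcd h).continuousOn, heq c d hc hd⟩)
  -- The argument of du Bois-Reymond: `k` is the mean of `g`, so the primitive `h` of `g - k`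
  -- vanishes at both ends and can be used to vary `θ`.
  set k : ℝ := (b - a)⁻¹ * ∫ s in a..b, g s with hk
  have ikc : IntervalIntegrable (fun _ : ℝ => k) volume a b := intervalIntegrable_const
  have igk : IntervalIntegrable (fun s => g s - k) volume a b := ig.sub ikc
  have hmean : ∫ s in a..b, (g s - k) = 0 := by
    have hne : b - a ≠ 0 := by linarith
    rw [intervalIntegral.integral_sub ig ikc, intervalIntegral.integral_const, smul_eq_mul, hk,
      mul_inv_cancel_left₀ hne, sub_self]
  set h : ℝ → ℝ := fun s => ∫ x in a..s, (g x - k) with hh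
  have hhd : ∀ c d, a ≤ c → c < d → d ≤ b →
      ContMDiffOn 𝓘(ℝ, ℝ) (spacetimeModel n) ∞ (fun s => (θ s, σ s)) (Icc c d) → ∀ s ∈ Icc c d,
      HasDerivWithinAt h (Λ (σ s) * derivWithin θ (Icc c d) s - k) (Icc c d) s := by
    intro c d hc hcd hd hs s hsI
    refine hasDerivWithinAt_integral_piece (g' := fun s => Λ (σ s) * derivWithin θ (Icc c d) s - k)
      (igk.mono_set ?_) hc hcd ((hsm c d hcd hs).continuousOn.sub continuousOn_const)
      (fun x hx => by simp only [heq c d hc hd hx]) hsI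
    rw [uIcc_of_le (hc.trans hcd.le), uIcc_of_le hab.le]
    exact Icc_subset_Icc_right hd
  have hhs : ∀ c d, a ≤ c → c < d → d ≤ b →
      ContMDiffOn 𝓘(ℝ, ℝ) (spacetimeModel n) ∞ (fun s => (θ s, σ s)) (Icc c d) →
      ContDiffOn ℝ ∞ h (Icc c d) := fun c d hc hcd hd hs =>
    contDiffOn_infty_of_hasDerivWithinAt hcd (hhd c d hc hcd hd hs)
      ((hsm c d hcd hs).sub contDiffOn_const)
  set ψ : ℝ → ℝ → ℝ × M := fun r s => (θ s + r * h s, σ s) with hψ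
  have hvar : IsProperVariation (spacetimeModel n) a b (fun s => (θ s, σ s)) 1 ψ := by
    refine isProperVariation_of_piecewise hab one_pos (hγ.mono fun c d hc hcd hd hs => ?_) ?_ ?_ ?_
    · obtain ⟨h1, h2⟩ := contMDiffOn_spacetime_iff.1 hs
      have hm : MapsTo (Prod.snd : ℝ × ℝ → ℝ) (Ioo (-1) 1 ×ˢ Icc c d) (Icc c d) := fun p hp => hp.2
      refine contMDiffOn_spacetime_iff.2 ⟨?_, ?_⟩
      · exact (h1.comp contDiff_snd.contDiffOn hm).add
          (contDiff_fst.contDiffOn.mul ((hhs c d hc hcd hd hs).comp contDiff_snd.contDiffOn hm))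
      · exact h2.comp (contDiff_snd (𝕜 := ℝ) (E := ℝ) (F := ℝ)).contMDiff.contMDiffOn hm
    · intro s _; simp [hψ]
    · intro r _; simp [hψ, hh]
    · intro r _; simp only [hψ, hh, hmean, mul_zero, add_zero]
  have iX : IntervalIntegrable (fun s => g s * (g s - k)) volume a b := by
    refine Piecewise.intervalIntegrable (hγ.mono fun c d hc hcd hd hs => ⟨_,
      (hsm c d hcd hs).continuousOn.mul ((hsm c d hcd hs).continuousOn.sub
        (continuousOn_const (c := k))), fun s hsI => ?_⟩)
    simp only [heq c d hc hd hsI, Pi.sub_apply, Pi.mul_apply]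
  have iY : IntervalIntegrable (fun s => Λ (σ s) * (g s - k) ^ 2) volume a b := by
    refine Piecewise.intervalIntegrable (hγ.mono fun c d hc hcd hd hs => ⟨_,
      (hΛ.continuous.comp_continuousOn (contMDiffOn_spacetime_iff.1 hs).2.continuousOn).mul
      (((hsm c d hcd hs).continuousOn.sub (continuousOn_const (c := k))).pow 2),
      fun s hsI => ?_⟩)
    simp only [heq c d hc hd hsI, Pi.sub_apply, Pi.mul_apply, Pi.pow_apply, Function.comp_apply]
  have iL := intervalIntegrable_staticL (Λ := Λ) hF hΛ.continuous hγ
  obtain ⟨D, hD, hDs⟩ := (hγ.mono (Q' := fun c d => a ≤ c ∧ d ≤ b ∧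
    ContMDiffOn 𝓘(ℝ, ℝ) (spacetimeModel n) ∞ (fun s => (θ s, σ s)) (Icc c d))
    fun c d hc _ hd hs => ⟨hc, hd, hs⟩).exists_finite
  have hae : ∀ᵐ s : ℝ, s ∉ D := measure_eq_zero_iff_ae_notMem.1 (hD.measure_zero volume)
  -- The space part is not varied, so the energy is exactly quadratic in `r`, and zeros of `σ'`,
  -- where `F` is not smooth, do no harm.
  have hen : ∀ r, energy (spacetimeModel n) (staticL F Λ) a b (ψ r) =
      energy (spacetimeModel n) (staticL F Λ) a b (fun s => (θ s, σ s))
        - r * (∫ s in a..b, g s * (g s - k))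
        - r ^ 2 * ((1 / 2) * ∫ s in a..b, Λ (σ s) * (g s - k) ^ 2) := by
    intro r
    have e1 : ∫ s in a..b, staticL F Λ (velocity (spacetimeModel n) (ψ r) (Icc a b) s)
        = ∫ s in a..b, (staticL F Λ (velocity (spacetimeModel n) (fun s => (θ s, σ s)) (Icc a b) s)
          - 2 * r * (g s * (g s - k)) - r ^ 2 * (Λ (σ s) * (g s - k) ^ 2)) := by
      refine intervalIntegral.integral_congr_ae ?_
      filter_upwards [hae] with s hsD hs
      rw [uIoc_of_le hab.le] at hs
      obtain ⟨c, d, -, -, hsI, hc, hd, hsm'⟩ := hDs s ⟨Ioc_subset_Icc_self hs, hsD⟩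
      have hcd : c < d := hsI.1.trans hsI.2
      have hsI' := Ioo_subset_Icc_self hsI
      obtain ⟨h1, h2⟩ := contMDiffOn_spacetime_iff.1 hsm'
      have hU := uniqueDiffOn_Icc hcd s hsI'
      have dθ := ((h1.differentiableOn (by simp)) s hsI').hasDerivWithinAt
      have dσ := (h2 s hsI').mdifferentiableWithinAt (by simp)
      have dψ := dθ.add ((hhd c d hc hcd hd hsm' s hsI').const_mul r)
      rw [velocity_Icc_of_mem_Ioo (ψ r) hc hd hsI,
        velocity_Icc_of_mem_Ioo (fun s => (θ s, σ s)) hc hd hsI,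
        staticL_velocity F Λ hU dθ.differentiableWithinAt dσ]
      change staticL F Λ (velocity (spacetimeModel n)
        (fun s => ((θ + fun s => r * h s) s, σ s)) (Icc c d) s) = _
      rw [staticL_velocity F Λ hU dψ.differentiableWithinAt dσ, dψ.derivWithin hU,
        heq c d hc hd hsI]
      ring
    unfold energy
    rw [e1, intervalIntegral.integral_sub (iL.sub (iX.const_mul (2 * r))) (iY.const_mul (r ^ 2)),
      intervalIntegral.integral_sub iL (iX.const_mul (2 * r)),
      intervalIntegral.integral_const_mul, intervalIntegral.integral_const_mul]
    ring
  have hX : ∫ s in a..b, g s * (g s - k) = 0 := by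
    have hd := hgeo.2 1 ψ hvar
    simp only [hen] at hd
    have hd' := (((hasDerivAt_id (0 : ℝ)).mul_const (∫ s in a..b, g s * (g s - k))).const_sub
      (energy (spacetimeModel n) (staticL F Λ) a b (fun s => (θ s, σ s)))).sub
      (((hasDerivAt_id (0 : ℝ)).pow 2).mul_const
        ((1 / 2) * ∫ s in a..b, Λ (σ s) * (g s - k) ^ 2))
    have := hd.unique hd'
    simpa using this
  have iS : IntervalIntegrable (fun s => (g s - k) ^ 2) volume a b := by
    have : (fun s => (g s - k) ^ 2) = fun s => g s * (g s - k) - k * (g s - k) := by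
      funext s; ring
    rw [this]
    exact iX.sub (igk.const_mul k)
  -- Subtract `k ∫ (g - k) = 0` from `∫ g (g - k) = 0`.
  have hsq : ∫ s in a..b, (g s - k) ^ 2 = 0 := by
    have : (fun s => (g s - k) ^ 2) = fun s => g s * (g s - k) - k * (g s - k) := by
      funext s; ring
    rw [this, intervalIntegral.integral_sub iX (igk.const_mul k), hX,
      intervalIntegral.integral_const_mul, hmean]
    ring
  refine ⟨k, fun c d hc hcd hd hs s hsI => ?_⟩
  by_contra hne
  -- The vanishing integral controls `g` almost everywhere; on a piece the one-sided momentum is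
  -- continuous, so it equals `k` at every point, ends included.
  have hpos : 0 < ∫ s in c..d, (Λ (σ s) * derivWithin θ (Icc c d) s - k) ^ 2 := by
    refine intervalIntegral.integral_pos hcd
      (((hsm c d hcd hs).continuousOn.sub continuousOn_const).pow 2) (fun _ _ => sq_nonneg _)
      ⟨s, hsI, ?_⟩
    have := sub_ne_zero.2 hne
    positivity
  have hle : ∫ s in c..d, (g s - k) ^ 2 ≤ ∫ s in a..b, (g s - k) ^ 2 :=
    intervalIntegral.integral_mono_interval hc hcd.le hd
      (Filter.Eventually.of_forall fun s => sq_nonneg _) iS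
  have hcongr : ∫ s in c..d, (g s - k) ^ 2
      = ∫ s in c..d, (Λ (σ s) * derivWithin θ (Icc c d) s - k) ^ 2 :=
    intervalIntegral.integral_congr_Ioo_of_le hcd.le fun x hx => by
      simp only [heq c d hc hd hx]
  rw [hcongr, hsq] at hle
  exact absurd hpos (not_lt.2 hle)

end TimeVariation

/-! ### Transfer of criticality between spacetime and optical metric -/

section Main

variable {n : ℕ} {M : Type*} [TopologicalSpace M] [ChartedSpace (EuclideanSpace ℝ (Fin n)) M]

theorem isProperVariation_snd {a b ε : ℝ} (hab : a < b) {θ : ℝ → ℝ} {σ : ℝ → M}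
    {ψ : ℝ → ℝ → ℝ × M}
    (hψ : IsProperVariation (spacetimeModel n) a b (fun s => (θ s, σ s)) ε ψ) :
    IsProperVariation (𝓡 n) a b σ ε (fun r s => (ψ r s).2) := by
  refine isProperVariation_of_piecewise hab hψ.pos
    (hψ.piecewise.mono fun c d _ _ _ h => (contMDiffOn_spacetime_iff.1 h).2) ?_ ?_ ?_
  · intro s hs; simp only [hψ.base s hs]
  · intro r hr; simp only [hψ.left r hr]
  · intro r hr; simp only [hψ.right r hr]

/-- Space variations are lifted with the time component unchanged. The lift need not be lightlike:
`hasDerivAt_energy_sub` requires that of the base curve only. -/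
theorem isProperVariation_prodMk {a b ε : ℝ} (hab : a < b) {θ : ℝ → ℝ} {σ : ℝ → M}
    (hγ : Piecewise (fun c d => ContMDiffOn 𝓘(ℝ, ℝ) (spacetimeModel n) ∞ (fun s => (θ s, σ s))
      (Icc c d)) a b) {ς : ℝ → ℝ → M} (hς : IsProperVariation (𝓡 n) a b σ ε ς) :
    IsProperVariation (spacetimeModel n) a b (fun s => (θ s, σ s)) ε
      (fun r s => (θ s, ς r s)) := by
  refine isProperVariation_of_piecewise hab hς.pos
    (((hγ.and (hereditary_contMDiffOn _) (hereditary_contMDiffOn_prod _ _) hς.piecewise)).mono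
      fun c d _ _ _ h => contMDiffOn_spacetime_iff.2 ⟨?_, h.2⟩) ?_ ?_ ?_
  · exact (contMDiffOn_spacetime_iff.1 h.1).1.comp contDiff_snd.contDiffOn
      fun p (hp : p ∈ Ioo (-ε) ε ×ˢ Icc c d) => hp.2
  · intro s hs; simp only [hς.base s hs]
  · intro r hr; simp only [hς.left r hr]
  · intro r hr; simp only [hς.right r hr]

variable [IsManifold (𝓡 n) ∞ M] {F : TangentBundle (𝓡 n) M → ℝ} {Λ : M → ℝ}

theorem isFutureLightlike_velocity_iff (hF : IsFinslerMetric F) (hΛpos : ∀ x, 0 < Λ x)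
    {θ : ℝ → ℝ} {σ : ℝ → M} {S : Set ℝ} {s : ℝ} (hS : UniqueDiffWithinAt ℝ S s)
    (hθ : DifferentiableWithinAt ℝ θ S s)
    (hσ : MDifferentiableWithinAt 𝓘(ℝ, ℝ) (𝓡 n) σ S s) :
    (IsLightlike F Λ (velocity (spacetimeModel n) (fun s => (θ s, σ s)) S s) ∧
      IsFuturePointing F Λ (velocity (spacetimeModel n) (fun s => (θ s, σ s)) S s)) ↔
      0 < F (velocity (𝓡 n) σ S s) ∧
        derivWithin θ S s = opticalMetric F Λ (velocity (𝓡 n) σ S s) := by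
  rw [velocity_prodMk hS hθ hσ]
  exact isLightlike_and_isFuturePointing_iff hF hΛpos (θ s, σ s) _ _

/-- On a smooth piece the velocity within the piece is the right velocity at every point but `d`,
and the left velocity at `d`. -/
theorem IsFutureLightlikeCurve.on_piece (hF : IsFinslerMetric F) (hΛpos : ∀ x, 0 < Λ x)
    {a b : ℝ} {θ : ℝ → ℝ} {σ : ℝ → M}
    (h : IsFutureLightlikeCurve F Λ a b (fun s => (θ s, σ s))) {c d : ℝ} (hc : a ≤ c) (hcd : c < d)
    (hd : d ≤ b)
    (hγ : ContMDiffOn 𝓘(ℝ, ℝ) (spacetimeModel n) ∞ (fun s => (θ s, σ s)) (Icc c d)) {s : ℝ}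
    (hs : s ∈ Icc c d) :
    0 < F (velocity (𝓡 n) σ (Icc c d) s) ∧
      derivWithin θ (Icc c d) s = opticalMetric F Λ (velocity (𝓡 n) σ (Icc c d) s) := by
  obtain ⟨h1, h2⟩ := contMDiffOn_spacetime_iff.1 hγ
  rw [← isFutureLightlike_velocity_iff hF hΛpos (uniqueDiffOn_Icc hcd s hs)
    ((h1.differentiableOn (by simp)) s hs) ((h2 s hs).mdifferentiableWithinAt (by simp))]
  have hdiff := (hγ s hs).mdifferentiableWithinAt (by simp)
  rcases hs.2.eq_or_lt with rfl | hsd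
  · rw [← velocity_left_eq hc hcd le_rfl hdiff]
    exact h.2 s ⟨hc.trans_lt hcd, hd⟩
  · rw [← velocity_right_eq hs.1 hsd hd hdiff]
    exact h.1 s ⟨hc.trans hs.1, hsd.trans_le hd⟩

variable {a b a' b' k κ : ℝ} {θ : ℝ → ℝ} {σ : ℝ → M} {φ S : ℝ → ℝ}

/-- The projection of a lightlike geodesic, suitably reparametrized, is an optical geodesic. -/
theorem isGeodesic_comp_of_isGeodesic (hF : IsFinslerMetric F)
    (hΛ : ContMDiff (𝓡 n) 𝓘(ℝ, ℝ) ∞ Λ) (hΛpos : ∀ x, 0 < Λ x) (hab : a < b) (hab' : a' < b')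
    (hκ : 0 < κ)
    (hreg : ∀ c d, a ≤ c → c < d → d ≤ b →
      ContMDiffOn 𝓘(ℝ, ℝ) (spacetimeModel n) ∞ (fun s => (θ s, σ s)) (Icc c d) →
      ∀ s ∈ Icc c d, 0 < F (velocity (𝓡 n) σ (Icc c d) s) ∧
      derivWithin θ (Icc c d) s = opticalMetric F Λ (velocity (𝓡 n) σ (Icc c d) s) ∧
      Λ (σ s) * derivWithin θ (Icc c d) s = k)
    (h : IsReparametrization a' b' a b φ S)
    (hφ : ∀ u ∈ Icc a' b', HasDerivWithinAt φ (κ * Λ (σ (φ u))) (Icc a' b') u)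
    (hφs : Piecewise (fun c d => ContDiffOn ℝ ∞ φ (Icc (S c) (S d))) a b)
    (hSs : Piecewise (fun c d => ContDiffOn ℝ ∞ S (Icc c d)) a b)
    (hgeo : IsGeodesic (spacetimeModel n) (staticL F Λ) a b (fun s => (θ s, σ s))) :
    IsGeodesic (𝓡 n) (fun p => opticalMetric F Λ p ^ 2) a' b' (σ ∘ φ) := by
  have hO := hF.opticalMetric hΛ hΛpos
  have hγ := hgeo.1.piecewise
  have hσ : Piecewise (fun c d => ContMDiffOn 𝓘(ℝ, ℝ) (𝓡 n) ∞ σ (Icc c d)) a b :=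
    hγ.mono fun c d _ _ _ h => (contMDiffOn_spacetime_iff.1 h).2
  refine ⟨isPiecewiseSmooth_of_piecewise hab' (h.piecewise_comp hab hφs hσ), fun ε ψ hψ => ?_⟩
  -- A variation of `σ ∘ φ` is carried back by `S` and then lifted to spacetime. Its base curve `(σ
  -- ∘ φ) ∘ S` is known to agree with `σ` only on `[a, b]`, so the fields are checked anew.
  have hς := h.symm.isProperVariation_comp hab' hab (h.piecewise_symm hSs) hψ
  have hς' : IsProperVariation (𝓡 n) a b σ ε (fun r => ψ r ∘ S) :=
    ⟨hς.pos, hς.continuousOn, hς.piecewise_smooth,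
      fun s hs => by rw [hς.base s hs]; simp only [Function.comp_apply, h.rightInv s hs],
      fun r hr => by
        rw [hς.left r hr]; simp only [Function.comp_apply, h.rightInv a (left_mem_Icc.2 hab.le)],
      fun r hr => by
        rw [hς.right r hr]; simp only [Function.comp_apply, h.rightInv b (right_mem_Icc.2 hab.le)]⟩
  have hvar := isProperVariation_prodMk hab hγ hς'
  have hσc : ContinuousOn σ (Icc a b) := (continuous_snd.comp_continuousOn hgeo.1.1)
  have h1 := (hgeo.2 ε _ hvar).sub (hasDerivAt_energy_sub hF hΛ hΛpos hab hσc hreg hvar)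
  have h2 := h1.const_mul κ
  rw [sub_zero, mul_zero] at h2
  refine h2.congr_of_eventuallyEq ?_
  filter_upwards [Ioo_mem_nhds (neg_lt_zero.2 hψ.pos) hψ.pos] with r hr
  have e := hO.energy_comp h hab' hab hκ (w := fun s => Λ (σ s)) (fun s _ => hΛpos _) hφ
    (hς'.piecewise_slice hr)
  have e' : energy (𝓡 n) (fun p => opticalMetric F Λ p ^ 2) a' b' (ψ r)
      = energy (𝓡 n) (fun p => opticalMetric F Λ p ^ 2) a' b' ((ψ r ∘ S) ∘ φ) :=
    energy_congr hab'.le fun u hu => by simp only [Function.comp_apply, h.leftInv u hu]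
  rw [e', e]
  simp only [Pi.sub_apply]
  ring

/-- Lightlike lifts of optical geodesics are geodesics. -/
theorem isGeodesic_of_isGeodesic_comp (hF : IsFinslerMetric F)
    (hΛ : ContMDiff (𝓡 n) 𝓘(ℝ, ℝ) ∞ Λ) (hΛpos : ∀ x, 0 < Λ x) (hab : a < b) (hab' : a' < b')
    (hκ : 0 < κ)
    (hreg : ∀ c d, a ≤ c → c < d → d ≤ b →
      ContMDiffOn 𝓘(ℝ, ℝ) (spacetimeModel n) ∞ (fun s => (θ s, σ s)) (Icc c d) →
      ∀ s ∈ Icc c d, 0 < F (velocity (𝓡 n) σ (Icc c d) s) ∧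
      derivWithin θ (Icc c d) s = opticalMetric F Λ (velocity (𝓡 n) σ (Icc c d) s) ∧
      Λ (σ s) * derivWithin θ (Icc c d) s = k)
    (h : IsReparametrization a' b' a b φ S)
    (hφ : ∀ u ∈ Icc a' b', HasDerivWithinAt φ (κ * Λ (σ (φ u))) (Icc a' b') u)
    (hφs : Piecewise (fun c d => ContDiffOn ℝ ∞ φ (Icc (S c) (S d))) a b)
    (hγ : IsPiecewiseSmooth (spacetimeModel n) a b (fun s => (θ s, σ s)))
    (hgeo : IsGeodesic (𝓡 n) (fun p => opticalMetric F Λ p ^ 2) a' b' (σ ∘ φ)) :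
    IsGeodesic (spacetimeModel n) (staticL F Λ) a b (fun s => (θ s, σ s)) := by
  have hO := hF.opticalMetric hΛ hΛpos
  refine ⟨hγ, fun ε ψ hψ => ?_⟩
  -- Projected to `M` and composed with `φ`, the variation is admissible for the optical geodesic,
  -- so its weighted energy is critical; adding the difference of the energies recovers that of `L`.
  have hς := isProperVariation_snd hab hψ
  have hvar := h.isProperVariation_comp hab hab' hφs hς
  have hσc : ContinuousOn σ (Icc a b) := (continuous_snd.comp_continuousOn hγ.1)
  have h1 := (hasDerivAt_energy_sub hF hΛ hΛpos hab hσc hreg hψ).add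
    ((hgeo.2 ε _ hvar).const_mul κ⁻¹)
  rw [mul_zero, add_zero] at h1
  refine h1.congr_of_eventuallyEq ?_
  filter_upwards [Ioo_mem_nhds (neg_lt_zero.2 hψ.pos) hψ.pos] with r hr
  have e := hO.energy_comp h hab' hab hκ (w := fun s => Λ (σ s)) (fun s _ => hΛpos _) hφ
    (hς.piecewise_slice hr)
  simp only [Pi.add_apply, e]
  rw [inv_mul_cancel_left₀ hκ.ne']
  ring

/-- A continuously differentiable curve with vanishing velocity is constant. -/
theorem eq_of_mfderivWithin_eq_zero [T2Space M]
    (hσ : ContMDiffOn 𝓘(ℝ, ℝ) (𝓡 n) 1 σ (Icc a b))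
    (h0 : ∀ s ∈ Icc a b, mfderivWithin 𝓘(ℝ, ℝ) (𝓡 n) σ (Icc a b) s = 0) :
    ∀ s ∈ Icc a b, σ s = σ a := by
  have hclosed : IsClosed ({s | σ s = σ a} ∩ Icc a b) := by
    have : {s | σ s = σ a} ∩ Icc a b = Icc a b ∩ σ ⁻¹' {σ a} := by
      ext s; exact and_comm
    rw [this]
    exact hσ.continuousOn.preimage_isClosed_of_isClosed isClosed_Icc isClosed_singleton
  -- Continuous induction: agreement with `σ a` is a closed condition, and it extends to the right
  -- of `t` because the curve read in a chart at `σ t` has zero derivative.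
  refine fun s hs => hclosed.Icc_subset_of_forall_mem_nhdsWithin rfl (fun t ht => ?_) hs
  obtain ⟨htσ, hta, htb⟩ := ht
  have htI : t ∈ Icc a b := ⟨hta, htb.le⟩
  set e := extChartAt (𝓡 n) (σ t) with he
  have hnb := (hσ.continuousOn t htI).preimage_mem_nhdsWithin
    (extChartAt_source_mem_nhds (I := 𝓡 n) (σ t))
  obtain ⟨δ, hδ, hsub⟩ := Metric.mem_nhdsWithin_iff.1 hnb
  set d := min b (t + δ / 2) with hd
  have htd : t < d := lt_min htb (by linarith)
  have hdb : d ≤ b := min_le_left _ _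
  have hI : Icc t d ⊆ Icc a b := Icc_subset_Icc hta hdb
  have hsrc : ∀ u ∈ Icc t d, σ u ∈ e.source := by
    intro u hu
    refine hsub ⟨?_, hI hu⟩
    have : u ≤ t + δ / 2 := hu.2.trans (min_le_right _ _)
    rw [Metric.mem_ball, Real.dist_eq, abs_lt]
    constructor <;> linarith [hu.1]
  have hder : ∀ u ∈ Icc t d, HasDerivWithinAt (fun u => e (σ u)) 0 (Icc t d) u := by
    intro u hu
    have hs1 : σ u ∈ (chartAt (EuclideanSpace ℝ (Fin n)) (σ t)).source := by
      rw [← extChartAt_source (𝓡 n)]; exact hsrc u hu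
    have h1 : MDifferentiableAt (𝓡 n) 𝓘(ℝ, EuclideanSpace ℝ (Fin n)) e (σ u) :=
      mdifferentiableAt_extChartAt hs1
    have h2 := ((hσ u (hI hu)).mdifferentiableWithinAt one_ne_zero).hasMFDerivWithinAt.mono hI
    rw [h0 u (hI hu)] at h2
    have h3 : HasMFDerivWithinAt 𝓘(ℝ, ℝ) 𝓘(ℝ, EuclideanSpace ℝ (Fin n)) (e ∘ σ) (Icc t d) u
        (0 : ℝ →L[ℝ] EuclideanSpace ℝ (Fin n)) := by
      have h4 := h1.hasMFDerivAt.comp_hasMFDerivWithinAt u h2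
      rwa [ContinuousLinearMap.comp_zero] at h4
    have h5 : HasFDerivWithinAt (𝕜 := ℝ) (fun u => e (σ u))
        (0 : ℝ →L[ℝ] EuclideanSpace ℝ (Fin n)) (Icc t d) u := h3.hasFDerivWithinAt
    have h6 := h5.hasDerivWithinAt
    rwa [zero_apply] at h6
  have hconst : ∀ u ∈ Icc t d, e (σ u) = e (σ t) := by
    have hU := uniqueDiffOn_Icc htd
    exact constant_of_derivWithin_zero (fun u hu => (hder u hu).differentiableWithinAt)
      fun u hu => (hder u (Ico_subset_Icc_self hu)).derivWithin (hU u (Ico_subset_Icc_self hu))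
  refine mem_nhdsWithin.2 ⟨Iio d, isOpen_Iio, htd, fun u hu => ?_⟩
  have hu' : u ∈ Icc t d := ⟨le_of_lt hu.2, le_of_lt hu.1⟩
  have := e.injOn (hsrc u hu') (hsrc t (left_mem_Icc.2 htd.le)) (hconst u hu')
  exact this.trans htσ

end Main

theorem Piecewise.exists_mem {Q : ℝ → ℝ → Prop} {a b s : ℝ} (hQ : Hereditary Q)
    (h : Piecewise Q a b) (hab : a < b) (hs : s ∈ Icc a b) :
    ∃ c d, a ≤ c ∧ c < d ∧ d ≤ b ∧ s ∈ Icc c d ∧ Q c d := by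
  rcases hs.2.eq_or_lt with rfl | hsb
  · obtain ⟨c, hc, h⟩ := h.exists_left hQ ⟨hab, le_rfl⟩
    exact ⟨c, s, hc.1, hc.2, le_rfl, ⟨hc.2.le, le_rfl⟩, h⟩
  · obtain ⟨d, hd, h⟩ := h.exists_right hQ ⟨hs.1, hsb⟩
    exact ⟨s, d, hs.1, hd.1, hd.2, ⟨le_rfl, hd.1.le⟩, h⟩

/-! ### The two implications -/

section Main

variable {n : ℕ} {M : Type*} [TopologicalSpace M] [ChartedSpace (EuclideanSpace ℝ (Fin n)) M]

/-- Identifies the momentum `Λθ'` of a lightlike curve with the quantity in condition 2. -/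
theorem mul_opticalMetric (F : TangentBundle (𝓡 n) M → ℝ) {Λ : M → ℝ} (hΛpos : ∀ x, 0 < Λ x)
    (p : TangentBundle (𝓡 n) M) : Λ p.1 * opticalMetric F Λ p = √(Λ p.1) * F p := by
  have h := Real.sqrt_pos.2 (hΛpos p.1)
  unfold opticalMetric
  nth_rewrite 1 [← Real.mul_self_sqrt (hΛpos p.1).le]
  field_simp

variable [IsManifold (𝓡 n) ∞ M] {F : TangentBundle (𝓡 n) M → ℝ} {Λ : M → ℝ} {a b k : ℝ} {θ : ℝ → ℝ}
  {σ : ℝ → M}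

theorem IsFinslerMetric.velocity_eq_zero_iff (hF : IsFinslerMetric F) {S : Set ℝ} {s : ℝ} :
    F (velocity (𝓡 n) σ S s) = 0 ↔ mfderivWithin 𝓘(ℝ, ℝ) (𝓡 n) σ S s = 0 := by
  constructor
  · intro h
    have h1 : mfderivWithin 𝓘(ℝ, ℝ) (𝓡 n) σ S s (1 : ℝ) = 0 := by
      by_contra hne
      exact (hF.pos _ _ hne).ne' h
    let A : ℝ →L[ℝ] EuclideanSpace ℝ (Fin n) := mfderivWithin 𝓘(ℝ, ℝ) (𝓡 n) σ S s
    have hA : A = 0 := ContinuousLinearMap.ext_ring h1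
    exact hA
  · intro h
    unfold velocity
    rw [h]
    exact hF.map_zero _

/-- Conservation of energy along a regular continuously differentiable geodesic. -/
theorem IsFinslerMetric.constant_speed_of_contMDiffOn (hF : IsFinslerMetric F) (hab : a < b)
    (hρ : ContMDiffOn 𝓘(ℝ, ℝ) (𝓡 n) 1 σ (Icc a b))
    (hgeo : IsGeodesic (𝓡 n) (fun p => F p ^ 2) a b σ)
    (hpos : ∀ u ∈ Icc a b, 0 < F (velocity (𝓡 n) σ (Icc a b) u)) :
    ∀ u ∈ Icc a b, ∀ v ∈ Icc a b,
      F (velocity (𝓡 n) σ (Icc a b) u) = F (velocity (𝓡 n) σ (Icc a b) v) := by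
  -- Each smooth piece has constant speed by `constant_speed`; since the curve is `C¹`, the
  -- velocities from both sides agree at a break point and the constants match.
  refine hgeo.1.piecewise.induction_of_lt
    (P := fun c d => ∀ u ∈ Icc c d, ∀ v ∈ Icc c d,
      F (velocity (𝓡 n) σ (Icc a b) u) = F (velocity (𝓡 n) σ (Icc a b) v)) hab ?_ ?_
  · intro c d hc hcd hd hsm
    have hsub : Icc c d ⊆ Icc a b := Icc_subset_Icc hc hd
    have hv : ∀ u ∈ Icc c d, velocity (𝓡 n) σ (Icc c d) u = velocity (𝓡 n) σ (Icc a b) u :=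
      fun u hu => velocity_mono hsub (uniqueDiffOn_Icc hcd u hu)
        ((hρ u (hsub hu)).mdifferentiableWithinAt one_ne_zero)
    have := hF.constant_speed hcd hsm (hgeo.restrict hF.continuous_sq hc hcd hd)
      (fun u hu => by rw [hv u hu]; exact hpos u (hsub hu))
    intro u hu v hv'
    rw [← hv u hu, ← hv v hv']
    exact this u hu v hv'
  · intro c m d _ hcm hmd _ h1 h2
    have key : ∀ u ∈ Icc c d,
        F (velocity (𝓡 n) σ (Icc a b) u) = F (velocity (𝓡 n) σ (Icc a b) m) := by
      intro u hu
      rcases le_total u m with hum | hum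
      · exact h1 u ⟨hu.1, hum⟩ m ⟨hcm.le, le_rfl⟩
      · exact h2 u ⟨hum, hu.2⟩ m ⟨le_rfl, hmd.le⟩
    intro u hu v hv
    rw [key u hu, key v hv]

theorem isFutureLightlikeCurve_of_hasDerivWithinAt (hF : IsFinslerMetric F)
    (hΛpos : ∀ x, 0 < Λ x)
    (hσ : ContMDiffOn 𝓘(ℝ, ℝ) (𝓡 n) 1 σ (Icc a b))
    (hpos : ∀ s ∈ Icc a b, 0 < F (velocity (𝓡 n) σ (Icc a b) s))
    (hθ : ∀ s ∈ Icc a b, HasDerivWithinAt θ (opticalMetric F Λ (velocity (𝓡 n) σ (Icc a b) s))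
      (Icc a b) s) :
    IsFutureLightlikeCurve F Λ a b (fun s => (θ s, σ s)) := by
  have key : ∀ c d s, a ≤ c → c < d → d ≤ b → s ∈ Icc c d →
      IsLightlike F Λ (velocity (spacetimeModel n) (fun s => (θ s, σ s)) (Icc c d) s) ∧
      IsFuturePointing F Λ (velocity (spacetimeModel n) (fun s => (θ s, σ s)) (Icc c d) s) := by
    intro c d s hc hcd hd hs
    have hsub : Icc c d ⊆ Icc a b := Icc_subset_Icc hc hd
    have hU := uniqueDiffOn_Icc hcd s hs
    have h1 := (hσ s (hsub hs)).mdifferentiableWithinAt one_ne_zero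
    have h2 := (hθ s (hsub hs)).mono hsub
    rw [isFutureLightlike_velocity_iff hF hΛpos hU h2.differentiableWithinAt (h1.mono hsub),
      velocity_mono hsub hU h1]
    exact ⟨hpos s (hsub hs), h2.derivWithin hU⟩
  exact ⟨fun s hs => key s b s hs.1 hs.2 le_rfl ⟨le_rfl, hs.2.le⟩,
    fun s hs => key a s s le_rfl hs.1 hs.2 ⟨hs.1.le, le_rfl⟩⟩

/-- The spatial part of a lightlike geodesic is a pregeodesic of the optical metric. -/
theorem isPregeodesic_of_isGeodesic (hF : IsFinslerMetric F)
    (hΛ : ContMDiff (𝓡 n) 𝓘(ℝ, ℝ) ∞ Λ) (hΛpos : ∀ x, 0 < Λ x) (hab : a < b)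
    (hreg : ∀ c d, a ≤ c → c < d → d ≤ b →
      ContMDiffOn 𝓘(ℝ, ℝ) (spacetimeModel n) ∞ (fun s => (θ s, σ s)) (Icc c d) →
      ∀ s ∈ Icc c d, 0 < F (velocity (𝓡 n) σ (Icc c d) s) ∧
      derivWithin θ (Icc c d) s = opticalMetric F Λ (velocity (𝓡 n) σ (Icc c d) s) ∧
      Λ (σ s) * derivWithin θ (Icc c d) s = k)
    (hgeo : IsGeodesic (spacetimeModel n) (staticL F Λ) a b (fun s => (θ s, σ s))) :
    IsPregeodesic (𝓡 n) (fun p => opticalMetric F Λ p ^ 2) a b σ := by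
  have hO := hF.opticalMetric hΛ hΛpos
  have hγ := hgeo.1.piecewise
  have hσ : Piecewise (fun c d => ContMDiffOn 𝓘(ℝ, ℝ) (𝓡 n) ∞ σ (Icc c d)) a b :=
    hγ.mono fun c d _ _ _ h => (contMDiffOn_spacetime_iff.1 h).2
  have hw : Piecewise (fun c d => ContDiffOn ℝ ∞ (fun s => Λ (σ s)) (Icc c d)) a b :=
    hσ.mono fun c d _ _ _ h => contMDiffOn_iff_contDiffOn.1 (hΛ.comp_contMDiffOn h)
  have hσc : ContinuousOn σ (Icc a b) := continuous_snd.comp_continuousOn hgeo.1.1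
  have hwc : ContinuousOn (fun s => Λ (σ s)) (Icc a b) := hΛ.continuous.comp_continuousOn hσc
  -- The equation solved is `φ' = Λ(σ ∘ φ)`, the case `κ = 1`.
  obtain ⟨a', b', φ, S, hb', hφS, hφ, hS⟩ := exists_reparametrization hab hwc fun s _ => hΛpos _
  have hφs := hφS.piecewise_contDiffOn hab hw hφ
  have hSs : Piecewise (fun c d => ContDiffOn ℝ ∞ S (Icc c d)) a b :=
    hw.mono fun c d hc hcd hd hwcd => contDiffOn_infty_of_hasDerivWithinAt hcd
      (fun s hs => (hS s (Icc_subset_Icc hc hd hs)).mono (Icc_subset_Icc hc hd))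
      (hwcd.inv fun s _ => (hΛpos _).ne')
  have hρ : IsGeodesic (𝓡 n) (fun p => opticalMetric F Λ p ^ 2) a' b' (σ ∘ φ) :=
    isGeodesic_comp_of_isGeodesic hF hΛ hΛpos hab hb' one_pos hreg hφS
      (by simpa only [one_mul] using hφ) hφs hSs hgeo
  have hρreg : Piecewise (fun c d => ContMDiffOn 𝓘(ℝ, ℝ) (𝓡 n) ∞ (σ ∘ φ) (Icc c d) ∧
      ∀ u ∈ Icc c d, 0 < opticalMetric F Λ (velocity (𝓡 n) (σ ∘ φ) (Icc c d) u)) a' b' := by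
    have hand := hφS.piecewise_and hφs (hereditary_contMDiffOn _) hγ
    rw [← hφS.inv_left, ← hφS.inv_right]
    refine hand.map S hφS.strictMonoOn_inv fun c d hc hcd hd hh => ?_
    have hσcd := (contMDiffOn_spacetime_iff.1 hh.2).2
    have hmaps := hφS.mapsTo_piece hab hc hcd hd
    have hc' : c ∈ Icc a b := ⟨hc, hcd.le.trans hd⟩
    have hd' : d ∈ Icc a b := ⟨hc.trans hcd.le, hd⟩
    have hScd := hφS.strictMonoOn_inv hc' hd' hcd
    have hsub : Icc (S c) (S d) ⊆ Icc a' b' :=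
      Icc_subset_Icc (hφS.symm.mapsTo hab hc').1 (hφS.symm.mapsTo hab hd').2
    refine ⟨hσcd.comp hh.1.contMDiffOn hmaps, fun u hu => ?_⟩
    rw [hO.velocity_comp ((hφ u (hsub hu)).mono hsub) (hΛpos _) hmaps
      (uniqueDiffOn_Icc hScd u hu) ((hσcd _ (hmaps hu)).mdifferentiableWithinAt (by simp))]
    exact mul_pos (hΛpos _) (div_pos (hreg c d hc hcd hd hh.2 _ (hmaps hu)).1
      (Real.sqrt_pos.2 (hΛpos _)))
  have hφc : ContinuousOn φ (Icc a' b') := fun u hu => (hφ u hu).continuousWithinAt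
  have hS1 : ContDiffOn ℝ 1 S (Icc a b) :=
    contDiffOn_one_of_hasDerivWithinAt hab hS (hwc.inv₀ fun s _ => (hΛpos _).ne')
  -- The curve `σ ∘ φ` is `C¹` by the absence of corners, and `σ = (σ ∘ φ) ∘ S` inherits this
  -- because `S' = 1/Λ(σ)` is continuous.
  have hρ1 := hO.contMDiffOn_of_isGeodesic hb' hρreg hρ
  refine ⟨(hρ1.comp hS1.contMDiffOn (hφS.symm.mapsTo hab)).congr fun s hs => ?_, a', b', φ, hb',
    contDiffOn_one_of_hasDerivWithinAt hb' hφ (hwc.comp hφc (hφS.mapsTo hb')), fun u hu => ?_,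
    hφS.map_left, hφS.map_right, hρ⟩
  · simp only [Function.comp_apply, hφS.rightInv s hs]
  · rw [(hφ u hu).derivWithin (uniqueDiffOn_Icc hb' u hu)]
    exact hΛpos _

/-- Lightlike lifts of suitably parametrized optical pregeodesics are geodesics. -/
theorem isGeodesic_of_isPregeodesic (hF : IsFinslerMetric F)
    (hΛ : ContMDiff (𝓡 n) 𝓘(ℝ, ℝ) ∞ Λ) (hΛpos : ∀ x, 0 < Λ x) (hab : a < b) (hk : 0 < k)
    (hγ : IsPiecewiseSmooth (spacetimeModel n) a b (fun s => (θ s, σ s)))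
    (hσ : IsPregeodesic (𝓡 n) (fun p => opticalMetric F Λ p ^ 2) a b σ)
    (hspeed : ∀ s ∈ Icc a b, opticalMetric F Λ (velocity (𝓡 n) σ (Icc a b) s) = k / Λ (σ s))
    (hθ : ∀ s ∈ Icc a b, HasDerivWithinAt θ (k / Λ (σ s)) (Icc a b) s) :
    IsGeodesic (spacetimeModel n) (staticL F Λ) a b (fun s => (θ s, σ s)) := by
  have hO := hF.opticalMetric hΛ hΛpos
  obtain ⟨hσ1, a', b', φ, hab', hφ1, hφpos, hφa, hφb, hgeo⟩ := hσ
  have hmd : ∀ s ∈ Icc a b, MDifferentiableWithinAt 𝓘(ℝ, ℝ) (𝓡 n) σ (Icc a b) s :=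
    fun s hs => (hσ1 s hs).mdifferentiableWithinAt one_ne_zero
  have hreg : ∀ c d, a ≤ c → c < d → d ≤ b →
      ContMDiffOn 𝓘(ℝ, ℝ) (spacetimeModel n) ∞ (fun s => (θ s, σ s)) (Icc c d) →
      ∀ s ∈ Icc c d, 0 < F (velocity (𝓡 n) σ (Icc c d) s) ∧
      derivWithin θ (Icc c d) s = opticalMetric F Λ (velocity (𝓡 n) σ (Icc c d) s) ∧
      Λ (σ s) * derivWithin θ (Icc c d) s = k := by
    intro c d hc hcd hd _ s hs
    have hsub : Icc c d ⊆ Icc a b := Icc_subset_Icc hc hd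
    have hU := uniqueDiffOn_Icc hcd s hs
    rw [velocity_mono hsub hU (hmd s (hsub hs)), hspeed s (hsub hs),
      ((hθ s (hsub hs)).mono hsub).derivWithin hU]
    refine ⟨?_, rfl, mul_div_cancel₀ _ (hΛpos _).ne'⟩
    have h1 : 0 < opticalMetric F Λ (velocity (𝓡 n) σ (Icc a b) s) := by
      rw [hspeed s (hsub hs)]; exact div_pos hk (hΛpos _)
    exact (div_pos_iff_of_pos_right (Real.sqrt_pos.2 (hΛpos _))).1 h1
  have hUφ := uniqueDiffOn_Icc hab'
  have hφd : ∀ u ∈ Icc a' b',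
      HasDerivWithinAt φ (derivWithin φ (Icc a' b') u) (Icc a' b') u :=
    fun u hu => (hφ1.differentiableOn one_ne_zero u hu).hasDerivWithinAt
  have hmono : StrictMonoOn φ (Icc a' b') := by
    refine strictMonoOn_of_deriv_pos (convex_Icc _ _) hφ1.continuousOn fun u hu => ?_
    rw [interior_Icc] at hu
    rw [← derivWithin_of_mem_nhds (Icc_mem_nhds hu.1 hu.2)]
    exact hφpos u (Ioo_subset_Icc_self hu)
  obtain ⟨S, hφS⟩ := IsReparametrization.of_strictMonoOn hab' hmono hφ1.continuousOn hφa hφb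
  have hmaps := hφS.mapsTo hab'
  have hvel : ∀ u ∈ Icc a' b', opticalMetric F Λ (velocity (𝓡 n) (σ ∘ φ) (Icc a' b') u) =
      derivWithin φ (Icc a' b') u * (k / Λ (σ (φ u))) := by
    intro u hu
    rw [hO.velocity_comp (hφd u hu) (hφpos u hu) hmaps (hUφ u hu) (hmd _ (hmaps hu)),
      hspeed _ (hmaps hu)]
  have hvpos : ∀ u ∈ Icc a' b', 0 < opticalMetric F Λ (velocity (𝓡 n) (σ ∘ φ) (Icc a' b') u) := by
    intro u hu
    rw [hvel u hu]
    exact mul_pos (hφpos u hu) (div_pos hk (hΛpos _))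
  have hconst := hO.constant_speed_of_contMDiffOn hab'
    (hσ1.comp hφ1.contMDiffOn hmaps) hgeo hvpos
  have ha' : a' ∈ Icc a' b' := left_mem_Icc.2 hab'.le
  -- The optical speed of `σ ∘ φ` is `φ' k / Λ(σ ∘ φ)`. Since it is constant, `φ' = κ Λ(σ ∘ φ)` with
  -- `κ` equal to that speed divided by `k`.
  set κ := opticalMetric F Λ (velocity (𝓡 n) (σ ∘ φ) (Icc a' b') a') / k with hκ
  have hκpos : 0 < κ := div_pos (hvpos a' ha') hk
  have hφκ : ∀ u ∈ Icc a' b', HasDerivWithinAt φ (κ * Λ (σ (φ u))) (Icc a' b') u := by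
    intro u hu
    have h1 := hφd u hu
    have h2 := hvel u hu
    have h3 := (hΛpos (σ (φ u))).ne'
    rwa [show derivWithin φ (Icc a' b') u = κ * Λ (σ (φ u)) by
      rw [hκ, hconst a' ha' u hu, h2]; field_simp] at h1
  -- The given `φ` is only `C¹`; its differential equation makes it piecewise smooth, as the
  -- transport of variations requires.
  have hw : Piecewise (fun c d => ContDiffOn ℝ ∞ (fun s => κ * Λ (σ s)) (Icc c d)) a b :=
    hγ.piecewise.mono fun c d _ _ _ h => contDiffOn_const.mul
      (contMDiffOn_iff_contDiffOn.1 (hΛ.comp_contMDiffOn (contMDiffOn_spacetime_iff.1 h).2))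
  exact isGeodesic_of_isGeodesic_comp hF hΛ hΛpos hab hab' hκpos hreg hφS hφκ
    (hφS.piecewise_contDiffOn hab hw hφκ) hγ hgeo

end Main

theorem mainTheorem4 {n : ℕ} {M : Type*} [TopologicalSpace M]
    [ChartedSpace (EuclideanSpace ℝ (Fin n)) M] [IsManifold (𝓡 n) ∞ M]
    [T2Space M] [ParacompactSpace M] [ConnectedSpace M]
    (F : TangentBundle (𝓡 n) M → ℝ) (hF : IsFinslerMetric F)
    (Λ : M → ℝ) (hΛ : ContMDiff (𝓡 n) 𝓘(ℝ, ℝ) ∞ Λ) (hΛpos : ∀ x, 0 < Λ x)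
    (a b : ℝ) (hab : a < b) (θ : ℝ → ℝ) (σ : ℝ → M)
    (hγ : IsPiecewiseSmooth (spacetimeModel n) a b (fun s => (θ s, σ s))) :
    (IsGeodesic (spacetimeModel n) (staticL F Λ) a b (fun s => (θ s, σ s)) ∧
        IsFutureLightlikeCurve F Λ a b (fun s => (θ s, σ s))) ↔
      (IsPregeodesic (𝓡 n) (fun p => opticalMetric F Λ p ^ 2) a b σ ∧
        (¬ ∃ x : M, ∀ s ∈ Icc a b, σ s = x) ∧
        (∃ k : ℝ, ∀ s ∈ Icc a b,
          √(Λ (σ s)) * F (velocity (𝓡 n) σ (Icc a b) s) = k) ∧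
        ∀ s ∈ Icc a b,
          θ s = θ a + ∫ r in a..s, F (velocity (𝓡 n) σ (Icc a b) r) / √(Λ (σ r))) := by
  have hσc : ContinuousOn σ (Icc a b) := continuous_snd.comp_continuousOn hγ.1
  have hcont : ∀ k : ℝ, ContinuousOn (fun s => k / Λ (σ s)) (Icc a b) := fun k =>
    continuousOn_const.div (hΛ.continuous.comp_continuousOn hσc) fun s _ => (hΛpos _).ne'
  have hspeed : ∀ s k, √(Λ (σ s)) * F (velocity (𝓡 n) σ (Icc a b) s) = k →
      opticalMetric F Λ (velocity (𝓡 n) σ (Icc a b) s) = k / Λ (σ s) := by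
    rintro s k rfl
    rw [eq_div_iff (hΛpos _).ne', mul_comm]
    exact mul_opticalMetric F hΛpos (velocity (𝓡 n) σ (Icc a b) s)
  constructor
  · rintro ⟨hgeo, hlight⟩
    obtain ⟨k, hk⟩ := exists_conserved_momentum hF hΛ hab hgeo
    have hreg : ∀ c d, a ≤ c → c < d → d ≤ b →
        ContMDiffOn 𝓘(ℝ, ℝ) (spacetimeModel n) ∞ (fun s => (θ s, σ s)) (Icc c d) →
        ∀ s ∈ Icc c d, 0 < F (velocity (𝓡 n) σ (Icc c d) s) ∧
        derivWithin θ (Icc c d) s = opticalMetric F Λ (velocity (𝓡 n) σ (Icc c d) s) ∧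
        Λ (σ s) * derivWithin θ (Icc c d) s = k := by
      intro c d hc hcd hd hsm s hs
      have h := hlight.on_piece hF hΛpos hc hcd hd hsm hs
      exact ⟨h.1, h.2, hk c d hc hcd hd hsm s hs⟩
    have hpre := isPregeodesic_of_isGeodesic hF hΛ hΛpos hab hreg hgeo
    have hmd : ∀ s ∈ Icc a b, MDifferentiableWithinAt 𝓘(ℝ, ℝ) (𝓡 n) σ (Icc a b) s :=
      fun s hs => (hpre.1 s hs).mdifferentiableWithinAt one_ne_zero
    have hpoint : ∀ s ∈ Icc a b, 0 < F (velocity (𝓡 n) σ (Icc a b) s) ∧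
        √(Λ (σ s)) * F (velocity (𝓡 n) σ (Icc a b) s) = k := by
      intro s hs
      obtain ⟨c, d, hc, hcd, hd, hscd, hsm⟩ :=
        hγ.piecewise.exists_mem (hereditary_contMDiffOn _) hab hs
      obtain ⟨h1, h2, h3⟩ := hreg c d hc hcd hd hsm s hscd
      rw [velocity_mono (Icc_subset_Icc hc hd) (uniqueDiffOn_Icc hcd s hscd) (hmd s hs)] at h1 h2
      rw [h2] at h3
      exact ⟨h1, (mul_opticalMetric F hΛpos (velocity (𝓡 n) σ (Icc a b) s)).symm.trans h3⟩
    refine ⟨hpre, ?_, ⟨k, fun s hs => (hpoint s hs).2⟩, fun s hs => ?_⟩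
    · rintro ⟨x, hx⟩
      have ha : a ∈ Icc a b := left_mem_Icc.2 hab.le
      refine (hpoint a ha).1.ne' ?_
      rw [velocity_congr (γ' := fun _ => x) hx ha, hF.velocity_eq_zero_iff]
      exact mfderivWithin_const
    · have hsub : Icc a s ⊆ Icc a b := Icc_subset_Icc_right hs.2
      have hint : ∫ r in a..s, F (velocity (𝓡 n) σ (Icc a b) r) / √(Λ (σ r))
          = ∫ r in a..s, k / Λ (σ r) := by
        refine intervalIntegral.integral_congr fun r hr => ?_
        rw [uIcc_of_le hs.1] at hr
        exact hspeed r k (hpoint r (hsub hr)).2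
      -- At break points only the right derivative of `θ` is at hand, which is enough for this form
      -- of the fundamental theorem of calculus.
      rw [hint, intervalIntegral.integral_eq_sub_of_hasDeriv_right_of_le hs.1
        ((continuous_fst.comp_continuousOn hγ.1).mono hsub) (fun r hr => ?_)
        (((hcont k).mono hsub).intervalIntegrable_of_Icc hs.1)]
      · simp
      · have hr' : r ∈ Ico a b := ⟨hr.1.le, hr.2.trans_le hs.2⟩
        obtain ⟨d, hd, hsm⟩ := hγ.piecewise.exists_right (hereditary_contMDiffOn _) hr'
        have hmem : r ∈ Icc r d := left_mem_Icc.2 hd.1.le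
        have h1 := (((contMDiffOn_spacetime_iff.1 hsm).1.differentiableOn (by simp)) r
          hmem).hasDerivWithinAt
        rw [show derivWithin (fun s => θ s) (Icc r d) r = k / Λ (σ r) by
          rw [eq_div_iff (hΛpos _).ne', mul_comm]
          exact hk r d hr.1.le hd.1 hd.2 hsm r hmem] at h1
        exact h1.mono_of_mem_nhdsWithin (Icc_mem_nhdsGT hd.1)
  · rintro ⟨hpre, hne, ⟨k, hk⟩, hint⟩
    have hF0 := hF.nonneg
    -- If `k = 0`, then `F(σ')` vanishes identically and `σ` is constant, contrary to condition 1.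
    have hk0 : 0 < k := by
      have ha : a ∈ Icc a b := left_mem_Icc.2 hab.le
      refine lt_of_le_of_ne ?_ fun h0 => hne ⟨σ a, ?_⟩
      · rw [← hk a ha]; exact mul_nonneg (Real.sqrt_nonneg _) (hF0 _)
      · refine eq_of_mfderivWithin_eq_zero hpre.1 fun s hs => ?_
        rw [← hF.velocity_eq_zero_iff]
        have := hk s hs
        rw [← h0] at this
        exact (mul_eq_zero.1 this).resolve_left (Real.sqrt_pos.2 (hΛpos _)).ne'
    have hsp := fun s hs => hspeed s k (hk s hs)
    -- By condition 2 the integrand in condition 3 is the continuous function `k / Λ(σ)`, so `θ` is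
    -- differentiable at every point of `[a, b]`.
    have hθ : ∀ s ∈ Icc a b, HasDerivWithinAt θ (k / Λ (σ s)) (Icc a b) s := by
      intro s hs
      have key : ∀ t ∈ Icc a b, θ t = θ a + ∫ r in a..t, k / Λ (σ r) := by
        intro t ht
        rw [hint t ht]
        congr 1
        refine intervalIntegral.integral_congr fun r hr => ?_
        rw [uIcc_of_le ht.1] at hr
        exact hsp r ⟨hr.1, hr.2.trans ht.2⟩
      exact ((hasDerivWithinAt_integral_of_continuousOn hab (hcont k) hs).const_add (θ a)).congr
        key (key s hs)
    refine ⟨isGeodesic_of_isPregeodesic hF hΛ hΛpos hab hk0 hγ hpre hsp hθ,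
      isFutureLightlikeCurve_of_hasDerivWithinAt hF hΛpos hpre.1 (fun s hs => ?_) fun s hs => ?_⟩
    · have := hk s hs
      rw [← this] at hk0
      exact pos_of_mul_pos_right hk0 (Real.sqrt_nonneg _)
    · rw [hsp s hs]
      exact hθ s hs
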